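/- Let $n\ge 1$, and let $\mathrm{Y}(n)$ be the Yangian of $\mathfrak{gl}_n$: the unital associative algebra over $\mathbb{C}$ with generators $t_{ij}^{(r)}$ ($1\le i,j\le n$, $r\ge 1$) and defining relations $$[t^{(r+1)}_{ij},t^{(s)}_{kl}]-[t^{(r)}_{ij},t^{(s+1)}_{kl}]=t^{(r)}_{kj}t^{(s)}_{il}-t^{(s)}_{kj}t^{(r)}_{il},\qquad r,s\ge 0,\quad t^{(0)}_{ij}=\delta_{ij}.$$ Put $t_{ij}(u)=\sum_{r\ge 0}t_{ij}^{(r)}u^{-r}$ and $T(u)=(t_{ij}(u))_{i,j=1}^n$. This matrix of formal series in $u^{-1}$ has an inverse, $T^{-1}(u)$. The algebra $\mathrm{Y}(n)$ is a Hopf algebra with coproduct $\Delta: t_{ij}(u)\mapsto\sum_a t_{ia}(u)\otimes t_{aj}(u)$, counit $\epsilon: T(u)\mapsto 1$ and antipode $\mathrm{S}: T(u)\mapsto T^{-1}(u)$. A series $f(u+a)$ with $a\in\mathbb{C}$ is always expanded in powers of $u^{-1}$. Let $T_a(u)$ denote $T(u)$ acting in the $a$-th factor of $(\mathbb{C}^n)^{\otimes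 n}$, and let $A_n$ be the antisymmetrizer $e_{i_1}\otimes\cdots\otimes e_{i_n}\mapsto\sum_{\sigma\in\mathfrak{S}_n}\operatorname{sgn}\sigma\cdot e_{i_{\sigma(1)}}\otimes\cdots\otimes e_{i_{\sigma(n)}}$. There is a unique series $\operatorname{qdet}T(u)\in\mathrm{Y}(n)[[u^{-1}]]$, the quantum determinant, such that $$A_n\,T_1(u)\,T_2(u-1)\cdots T_n(u-n+1)=A_n\operatorname{qdet}T(u),$$ and its constant term is $1$. Define the series $z(u)$ with coefficients in $\mathrm{Y}(n)$ by $$z(u)^{-1}=\frac1n\operatorname{tr}\bigl(T(u)\,T^{-1}(u-n)\bigr).$$ **Theorem.** 1. (Quantum Liouville formula) $$z(u)=\frac{\operatorname{qdet}T(u-1)}{\operatorname{qdet}T(u)},$$ where the numerator may be multiplied by the inverse of the denominator on either side. 2. We have $z(u)=1+z_2u^{-2}+z_3u^{-3}+\cdots$, and the coefficients $z_2,z_3,\dots$ are algebraically independent (over $\mathbb{C}$) generators of the center of $\mathrm{Y}(n)$. 3. The square $\mathrm{S}^2$ of the antipode is the algebra automorphism of $\mathrm{Y}(n)$ given by $T(u)\mapsto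 z(u+n)\,T(u+n)$. In particular, $\operatorname{qdet}T(u)$ is stable under $\mathrm{S}^2$. -/

import Mathlib

noncomputable section

open PowerSeries TensorProduct

namespace GLYangian

/-! ### The Yangian for `gl_n` -/

/-- The symbols `t_{ij}^{(r)}`, `r ≥ 0`, in the free algebra on the generators `(i, j, r)`,
which stands for `t_{ij}^{(r+1)}`; here `t_{ij}^{(0)} = δ_{ij}`. -/
def freeGen {n : ℕ} (i j : Fin n) : ℕ → FreeAlgebra ℂ (Fin n × Fin n × ℕ)
  | 0 => if i = j then 1 else 0
  | r + 1 => FreeAlgebra.ι ℂ (i, j, r)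

/-- The defining relations of the Yangian. -/
inductive Rel (n : ℕ) : FreeAlgebra ℂ (Fin n × Fin n × ℕ) → FreeAlgebra ℂ (Fin n × Fin n × ℕ) → Prop
  | mk (i j k l : Fin n) (r s : ℕ) : Rel n
      ((freeGen i j (r + 1) * freeGen k l s - freeGen k l s * freeGen i j (r + 1)) -
        (freeGen i j r * freeGen k l (s + 1) - freeGen k l (s + 1) * freeGen i j r))
      (freeGen k j r * freeGen i l s - freeGen k j s * freeGen i l r)

/-- The Yangian `Y(n) = Y(gl_n)`. -/
def Yangian (n : ℕ) : Type := RingQuot (Rel n)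

instance (n : ℕ) : Ring (Yangian n) := inferInstanceAs (Ring (RingQuot (Rel n)))

instance (n : ℕ) : Algebra ℂ (Yangian n) := inferInstanceAs (Algebra ℂ (RingQuot (Rel n)))

/-- The quotient map from the free algebra. -/
def proj (n : ℕ) : FreeAlgebra ℂ (Fin n × Fin n × ℕ) →ₐ[ℂ] Yangian n :=
  RingQuot.mkAlgHom ℂ (Rel n)

/-- The element `t_{ij}^{(r)}` of the Yangian, with `t_{ij}^{(0)} = δ_{ij}`. -/
def t {n : ℕ} (i j : Fin n) (r : ℕ) : Yangian n := proj n (freeGen i j r)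

theorem t_zero {n : ℕ} (i j : Fin n) : t i j 0 = if i = j then 1 else 0 := by
  unfold t freeGen; split_ifs <;> simp

theorem t_rel {n : ℕ} (i j k l : Fin n) (r s : ℕ) :
    (t i j (r + 1) * t k l s - t k l s * t i j (r + 1)) -
      (t i j r * t k l (s + 1) - t k l (s + 1) * t i j r) =
    t k j r * t i l s - t k j s * t i l r := by
  have h := RingQuot.mkAlgHom_rel ℂ (Rel.mk i j k l r s)
  change proj n _ = proj n _ at h
  unfold t
  simpa only [map_sub, map_mul] using h

/-- The generating matrix `T(u)`, with entries the series
`t_{ij}(u) = δ_{ij} + t_{ij}^{(1)} u⁻¹ + ⋯`; the variable `X` of the power series is `u⁻¹`. -/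
def T (n : ℕ) : Matrix (Fin n) (Fin n) (Yangian n)⟦X⟧ :=
  Matrix.of fun i j => PowerSeries.mk fun r => t i j r

/-- The series `f(u + a)` for a formal series `f(u) = ∑ f_r u^{-r}`: every `u⁻¹` is replaced by
`(u + a)⁻¹ = u⁻¹ (1 + a u⁻¹)⁻¹`. -/
def shift {A : Type*} [Ring A] [Algebra ℂ A] (a : ℂ) (f : A⟦X⟧) : A⟦X⟧ :=
  PowerSeries.mk fun m => ∑ r ∈ Finset.range (m + 1),
    PowerSeries.coeff m ((X * (1 + PowerSeries.C a * X)⁻¹ : ℂ⟦X⟧) ^ r) • PowerSeries.coeff r f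

/-- The inverse matrix `T⁻¹(u)`. It is a two-sided inverse by `isUnit_T`. -/
def Tinv (n : ℕ) : Matrix (Fin n) (Fin n) (Yangian n)⟦X⟧ := Ring.inverse (T n)

/-- The series `(1/n) tr (T(u) T⁻¹(u - n))`. -/
def zInv (n : ℕ) : (Yangian n)⟦X⟧ :=
  (1 / n : ℂ) • (T n * (Tinv n).map (shift (-(n : ℂ)))).trace

/-- The series `z(u)`, the inverse of `zInv n`; see `isUnit_zInv`. -/
def z (n : ℕ) : (Yangian n)⟦X⟧ := Ring.inverse (zInv n)

/-! ### The quantum determinant -/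

/-- The matrix `M` acting on the `a`-th copy of `ℂⁿ` in the `m`-fold tensor power of `ℂⁿ`, in the
basis `e_I = e_{I 0} ⊗ ⋯ ⊗ e_{I (m-1)}`. -/
def leg {n m : ℕ} {R : Type*} [Zero R] (a : Fin m) (M : Matrix (Fin n) (Fin n) R) :
    Matrix (Fin m → Fin n) (Fin m → Fin n) R :=
  open Classical in
  Matrix.of fun I J => if ∀ b, b ≠ a → I b = J b then M (I a) (J a) else 0

/-- The antisymmetrizer `e_I ↦ ∑_σ sgn σ • e_{I ∘ σ}` on the `m`-fold tensor power of `ℂⁿ`. -/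
def antisymmetrizer (n m : ℕ) (R : Type*) [Ring R] :
    Matrix (Fin m → Fin n) (Fin m → Fin n) R :=
  Matrix.of fun K I => ∑ σ : Equiv.Perm (Fin m),
    if K = I ∘ σ then (((Equiv.Perm.sign σ : ℤˣ) : ℤ) : R) else 0

/-- The operator `A_m T_1(u) T_2(u - 1) ⋯ T_m(u - m + 1)`. -/
def antisymT (n m : ℕ) : Matrix (Fin m → Fin n) (Fin m → Fin n) (Yangian n)⟦X⟧ :=
  antisymmetrizer n m (Yangian n)⟦X⟧ *
    (List.ofFn fun a : Fin m => leg a ((T n).map (shift (-((a : ℕ) : ℂ))))).prod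

/-- `d` is a quantum determinant of `T(u)`: the operator `A_n T_1(u) ⋯ T_n(u - n + 1)` equals
`A_n d(u)`. -/
def IsQuantumDeterminant (n : ℕ) (d : (Yangian n)⟦X⟧) : Prop :=
  antisymT n n = antisymmetrizer n n (Yangian n)⟦X⟧ * Matrix.diagonal fun _ => d

/-- The only candidate for the quantum determinant: the diagonal matrix element of
`A_n T_1(u) ⋯ T_n(u - n + 1)` at `e_1 ⊗ ⋯ ⊗ e_n`. -/
def qdet (n : ℕ) : (Yangian n)⟦X⟧ := antisymT n n id id

theorem IsQuantumDeterminant.eq_qdet {n : ℕ} {d : (Yangian n)⟦X⟧}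
    (h : IsQuantumDeterminant n d) : d = qdet n := by
  unfold qdet
  rw [h, Matrix.mul_diagonal]
  have : antisymmetrizer n n (Yangian n)⟦X⟧ id id = 1 := by
    simp only [antisymmetrizer, Matrix.of_apply]
    rw [Finset.sum_eq_single 1]
    · simp
    · intro σ _ hσ
      rw [if_neg]
      intro hh
      apply hσ
      ext i
      simpa using congrArg Fin.val (congrFun hh i).symm
    · simp
  rw [this, one_mul]

/-! ### Invertibility of the series -/

/-- A matrix of series as a series of matrices. -/
def matSeriesEquiv (n : ℕ) (A : Type*) [Ring A] :
    Matrix (Fin n) (Fin n) A⟦X⟧ ≃+* (Matrix (Fin n) (Fin n) A)⟦X⟧ where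
  toFun M := PowerSeries.mk fun r => M.map (PowerSeries.coeff r)
  invFun f := Matrix.of fun i j => PowerSeries.mk fun r => PowerSeries.coeff r f i j
  left_inv M := by ext i j r; simp
  right_inv f := by ext r i j; simp
  map_add' M N := by ext r i j; simp
  map_mul' M N := by
    ext r i j
    simp only [PowerSeries.coeff_mk, Matrix.map_apply, Matrix.mul_apply, map_sum,
      PowerSeries.coeff_mul, Matrix.sum_apply]
    exact Finset.sum_comm

theorem isUnit_of_constantCoeff {n : ℕ} {A : Type*} [Ring A] (M : Matrix (Fin n) (Fin n) A⟦X⟧)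
    (h : M.map PowerSeries.constantCoeff = 1) : IsUnit M := by
  have : IsUnit (matSeriesEquiv n A M) := by
    rw [PowerSeries.isUnit_iff_constantCoeff]
    have h2 : PowerSeries.constantCoeff (matSeriesEquiv n A M) = 1 := by
      rw [← h, ← PowerSeries.coeff_zero_eq_constantCoeff_apply]
      simp [matSeriesEquiv]
    rw [h2]
    exact isUnit_one
  exact (MulEquiv.isUnit_map (matSeriesEquiv n A)).1 this

theorem T_map_constantCoeff (n : ℕ) : (T n).map PowerSeries.constantCoeff = 1 := by
  ext i j
  rw [Matrix.map_apply, ← PowerSeries.coeff_zero_eq_constantCoeff_apply, T, Matrix.of_apply,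
    PowerSeries.coeff_mk, t_zero, Matrix.one_apply]

theorem isUnit_T (n : ℕ) : IsUnit (T n) := isUnit_of_constantCoeff _ (T_map_constantCoeff n)

theorem T_mul_Tinv (n : ℕ) : T n * Tinv n = 1 := Ring.mul_inverse_cancel _ (isUnit_T n)

theorem Tinv_mul_T (n : ℕ) : Tinv n * T n = 1 := Ring.inverse_mul_cancel _ (isUnit_T n)

theorem Tinv_map_constantCoeff (n : ℕ) : (Tinv n).map PowerSeries.constantCoeff = 1 := by
  have h := congrArg (fun M => M.map (PowerSeries.constantCoeff (R := Yangian n))) (T_mul_Tinv n)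
  simpa only [Matrix.map_mul, T_map_constantCoeff, one_mul,
    Matrix.map_one _ (map_zero _) (map_one _)] using h

theorem constantCoeff_shift {A : Type*} [Ring A] [Algebra ℂ A] (a : ℂ) (f : A⟦X⟧) :
    PowerSeries.constantCoeff (shift a f) = PowerSeries.constantCoeff f := by
  rw [← PowerSeries.coeff_zero_eq_constantCoeff_apply]
  simp [shift]

theorem constantCoeff_zInv (n : ℕ) (hn : 0 < n) : PowerSeries.constantCoeff (zInv n) = 1 := by
  have h1 : (PowerSeries.constantCoeff (zInv n)) =
      (1 / n : ℂ) • ((T n * (Tinv n).map (shift (-(n : ℂ)))).map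
        (PowerSeries.constantCoeff (R := Yangian n))).trace := by
    rw [zInv, ← PowerSeries.coeff_zero_eq_constantCoeff_apply, PowerSeries.coeff_smul]
    simp only [Matrix.trace, Matrix.diag, map_sum, Matrix.map_apply,
      PowerSeries.coeff_zero_eq_constantCoeff_apply]
  have h2 : ((Tinv n).map (shift (-(n : ℂ)))).map (PowerSeries.constantCoeff (R := Yangian n)) =
      1 := by
    rw [← Tinv_map_constantCoeff]
    ext i j
    simp [constantCoeff_shift]
  rw [h1, Matrix.map_mul, T_map_constantCoeff, h2, one_mul, Matrix.trace_one, Fintype.card_fin]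
  have : (n : Yangian n) = (n : ℂ) • (1 : Yangian n) := by
    rw [Nat.cast_smul_eq_nsmul]; simp
  rw [this, smul_smul, one_div, inv_mul_cancel₀ (by exact_mod_cast hn.ne'), one_smul]

theorem isUnit_zInv (n : ℕ) (hn : 0 < n) : IsUnit (zInv n) := by
  rw [PowerSeries.isUnit_iff_constantCoeff, constantCoeff_zInv n hn]
  exact isUnit_one
/-! ### The Hopf algebra structure -/

/-- The homomorphism out of the Yangian given by the images of the generators. -/
def lift {n : ℕ} {A : Type*} [Ring A] [Algebra ℂ A] (g : Fin n → Fin n → ℕ → A)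
    (h0 : ∀ i j, g i j 0 = if i = j then 1 else 0)
    (h : ∀ i j k l r s, (g i j (r + 1) * g k l s - g k l s * g i j (r + 1)) -
      (g i j r * g k l (s + 1) - g k l (s + 1) * g i j r) =
        g k j r * g i l s - g k j s * g i l r) : Yangian n →ₐ[ℂ] A :=
  RingQuot.liftAlgHom ℂ ⟨FreeAlgebra.lift ℂ fun p => g p.1 p.2.1 (p.2.2 + 1), by
    have key : ∀ i j r, FreeAlgebra.lift ℂ (fun p : Fin n × Fin n × ℕ => g p.1 p.2.1 (p.2.2 + 1))
        (freeGen i j r) = g i j r := by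
      intro i j r
      cases r with
      | zero => rw [h0, freeGen]; split_ifs <;> simp
      | succ r => simp [freeGen]
    rintro _ _ ⟨i, j, k, l, r, s⟩
    simp only [map_sub, map_mul, key, h]⟩

theorem lift_t {n : ℕ} {A : Type*} [Ring A] [Algebra ℂ A] (g : Fin n → Fin n → ℕ → A)
    (h0) (h) (i j : Fin n) (r : ℕ) : lift g h0 h (t i j r) = g i j r := by
  unfold lift t proj
  refine (RingQuot.liftAlgHom_mkAlgHom_apply _ _ _ _).trans ?_
  cases r with
  | zero => rw [h0, freeGen]; split_ifs <;> simp
  | succ r => simp [freeGen]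

theorem algHom_ext {n : ℕ} {A : Type*} [Ring A] [Algebra ℂ A] {f g : Yangian n →ₐ[ℂ] A}
    (h : ∀ i j r, f (t i j r) = g (t i j r)) : f = g := by
  apply RingQuot.ringQuot_ext'
  apply FreeAlgebra.hom_ext
  funext ⟨i, j, r⟩
  exact h i j (r + 1)

theorem t_induction {n : ℕ} (S : Subalgebra ℂ (Yangian n)) (h : ∀ i j r, t i j r ∈ S)
    (x : Yangian n) : x ∈ S := by
  obtain ⟨y, rfl⟩ := RingQuot.mkAlgHom_surjective ℂ (Rel n) x
  induction y using FreeAlgebra.induction with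
  | grade0 c => rw [AlgHom.commutes]; exact S.algebraMap_mem c
  | grade1 p => exact h p.1 p.2.1 (p.2.2 + 1)
  | mul a b ha hb => rw [map_mul]; exact S.mul_mem ha hb
  | add a b ha hb => rw [map_add]; exact S.add_mem ha hb

section RTT

variable {n : ℕ} {B : Type*} [Ring B]

/-- `D [U_{ij}, V_{kl}] = E (U_{kj} V_{il} - V_{kj} U_{il})`. -/
def RTT (D E : B) (U V : Matrix (Fin n) (Fin n) B) : Prop :=
  ∀ i j k l, D * (U i j * V k l - V k l * U i j) = E * (U k j * V i l - V k j * U i l)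

/-- `U` on the first tensor factor. -/
def leg1 (U : Matrix (Fin n) (Fin n) B) : Matrix (Fin n × Fin n) (Fin n × Fin n) B :=
  Matrix.of fun p q => if p.2 = q.2 then U p.1 q.1 else 0

/-- `U` on the second tensor factor. -/
def leg2 (U : Matrix (Fin n) (Fin n) B) : Matrix (Fin n × Fin n) (Fin n × Fin n) B :=
  Matrix.of fun p q => if p.1 = q.1 then U p.2 q.2 else 0

/-- The `R`-matrix, with denominators cleared. -/
def Rmat (n : ℕ) (D E : B) : Matrix (Fin n × Fin n) (Fin n × Fin n) B :=
  Matrix.of fun p q => (if p = q then D else 0) - (if p = q.swap then E else 0)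

theorem leg1_mul_apply (U : Matrix (Fin n) (Fin n) B) 
    (M : Matrix (Fin n × Fin n) (Fin n × Fin n) B) (p q : Fin n × Fin n) :
    (leg1 U * M) p q = ∑ a, U p.1 a * M (a, p.2) q := by
  simp only [leg1, Matrix.mul_apply, Fintype.sum_prod_type, Matrix.of_apply]
  simp

theorem leg2_mul_apply (U : Matrix (Fin n) (Fin n) B) 
    (M : Matrix (Fin n × Fin n) (Fin n × Fin n) B) (p q : Fin n × Fin n) :
    (leg2 U * M) p q = ∑ a, U p.2 a * M (p.1, a) q := by
  simp only [leg2, Matrix.mul_apply, Fintype.sum_prod_type, Matrix.of_apply]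
  simp

theorem leg1_mul (U V : Matrix (Fin n) (Fin n) B) : leg1 (U * V) = leg1 U * leg1 V := by
  ext p q
  rw [leg1_mul_apply]
  simp only [leg1, Matrix.of_apply, Matrix.mul_apply]
  split_ifs <;> simp

theorem leg2_mul (U V : Matrix (Fin n) (Fin n) B) : leg2 (U * V) = leg2 U * leg2 V := by
  ext p q
  rw [leg2_mul_apply]
  simp only [leg2, Matrix.of_apply, Matrix.mul_apply]
  split_ifs <;> simp

theorem leg1_one : leg1 (1 : Matrix (Fin n) (Fin n) B) = 1 := by
  ext p q
  simp only [leg1, Matrix.of_apply, Matrix.one_apply, Prod.ext_iff]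
  split_ifs <;> simp_all

theorem leg2_one : leg2 (1 : Matrix (Fin n) (Fin n) B) = 1 := by
  ext p q
  simp only [leg2, Matrix.of_apply, Matrix.one_apply, Prod.ext_iff]
  split_ifs <;> simp_all

theorem leg1_leg2 (U V : Matrix (Fin n) (Fin n) B) (p q) :
    (leg1 U * leg2 V) p q = U p.1 q.1 * V p.2 q.2 := by
  rw [leg1_mul_apply]; simp [leg2]

theorem leg2_leg1 (U V : Matrix (Fin n) (Fin n) B) (p q) :
    (leg2 V * leg1 U) p q = V p.2 q.2 * U p.1 q.1 := by
  rw [leg2_mul_apply]; simp [leg1]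

theorem Rmat_mul (D E : B) (M : Matrix (Fin n × Fin n) (Fin n × Fin n) B) (p q) :
    (Rmat n D E * M) p q = D * M p q - E * M p.swap q := by
  simp only [Rmat, Matrix.mul_apply, Matrix.of_apply, sub_mul, Finset.sum_sub_distrib, ite_mul,
    zero_mul, Finset.sum_ite_eq, Finset.mem_univ, if_true]
  congr 1
  rw [Finset.sum_eq_single p.swap]
  · simp
  · intro b _ hb
    rw [if_neg]
    rintro rfl
    simp at hb
  · simp

theorem mul_Rmat (D E : B) (M : Matrix (Fin n × Fin n) (Fin n × Fin n) B) (p q) :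
    (M * Rmat n D E) p q = M p q * D - M p q.swap * E := by
  simp only [Rmat, Matrix.mul_apply, Matrix.of_apply, mul_sub, Finset.sum_sub_distrib, mul_ite,
    mul_zero, Finset.sum_ite_eq', Finset.mem_univ, if_true]

theorem RTT_iff {D E : B} (hD : ∀ b, D * b = b * D) (hE : ∀ b, E * b = b * E)
    (U V : Matrix (Fin n) (Fin n) B) :
    RTT D E U V ↔ Rmat n D E * (leg1 U * leg2 V) = leg2 V * leg1 U * Rmat n D E := by
  have key : ∀ i j k l, (D * (U i j * V k l - V k l * U i j) = E * (U k j * V i l - V k j * U i l))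
      ↔ (D * (U i j * V k l) - E * (U k j * V i l) =
        V k l * U i j * D - V k j * U i l * E) := by
    intro i j k l
    rw [← hD, ← hE, mul_sub, mul_sub, sub_eq_sub_iff_sub_eq_sub]
  constructor
  · intro h
    ext ⟨i, k⟩ ⟨j, l⟩
    rw [Rmat_mul, mul_Rmat]
    simp only [leg1_leg2, leg2_leg1, Prod.swap]
    exact (key i j k l).1 (h i j k l)
  · intro h i j k l
    have := congrFun (congrFun h (i, k)) (j, l)
    rw [Rmat_mul, mul_Rmat] at this
    simp only [leg1_leg2, leg2_leg1, Prod.swap] at this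
    exact (key i j k l).2 this

theorem RTT.mul {D E : B} (hD : ∀ b, D * b = b * D) (hE : ∀ b, E * b = b * E)
    {U V U' V' : Matrix (Fin n) (Fin n) B} (h : RTT D E U V) (h' : RTT D E U' V')
    (h1 : ∀ i j k l, U' i j * V k l = V k l * U' i j)
    (h2 : ∀ i j k l, U i j * V' k l = V' k l * U i j) : RTT D E (U * U') (V * V') := by
  rw [RTT_iff hD hE] at h h' ⊢
  have c1 : leg1 U' * leg2 V = leg2 V * leg1 U' := by
    ext p q; rw [leg1_leg2, leg2_leg1, h1]
  have c2 : leg1 U * leg2 V' = leg2 V' * leg1 U := by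
    ext p q; rw [leg1_leg2, leg2_leg1, h2]
  calc Rmat n D E * (leg1 (U * U') * leg2 (V * V'))
      = Rmat n D E * (leg1 U * (leg1 U' * leg2 V) * leg2 V') := by
        rw [leg1_mul, leg2_mul]; simp only [mul_assoc]
    _ = (Rmat n D E * (leg1 U * leg2 V)) * (leg1 U' * leg2 V') := by
        rw [c1]; simp only [mul_assoc]
    _ = leg2 V * leg1 U * (Rmat n D E * (leg1 U' * leg2 V')) := by
        rw [h]; simp only [mul_assoc]
    _ = leg2 V * (leg1 U * leg2 V') * leg1 U' * Rmat n D E := by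
        rw [h']; simp only [mul_assoc]
    _ = leg2 (V * V') * leg1 (U * U') * Rmat n D E := by
        rw [c2, leg1_mul, leg2_mul]; simp only [mul_assoc]

theorem RTT.inv {D E : B} (hD : ∀ b, D * b = b * D) (hE : ∀ b, E * b = b * E)
    {U V U' V' : Matrix (Fin n) (Fin n) B} (h : RTT D E U V)
    (hU : U * U' = 1) (hU' : U' * U = 1) (hV : V * V' = 1) (hV' : V' * V = 1) (i j k l : Fin n) :
    D * (V' k l * U' i j - U' i j * V' k l) = E * (V' i l * U' k j - U' i l * V' k j) := by
  rw [RTT_iff hD hE] at h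
  have e1 : leg1 U * leg1 U' = 1 := by rw [← leg1_mul, hU, leg1_one]
  have e1' : leg1 U' * leg1 U = 1 := by rw [← leg1_mul, hU', leg1_one]
  have e2 : leg2 V * leg2 V' = 1 := by rw [← leg2_mul, hV, leg2_one]
  have e2' : leg2 V' * leg2 V = 1 := by rw [← leg2_mul, hV', leg2_one]
  have H : leg1 U' * leg2 V' * Rmat n D E = Rmat n D E * (leg2 V' * leg1 U') := by
    calc leg1 U' * leg2 V' * Rmat n D E
        = leg1 U' * leg2 V' * (Rmat n D E * (leg1 U * ((leg2 V * leg2 V') * leg1 U'))) := by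
          rw [e2, one_mul, e1, mul_one]
      _ = leg1 U' * leg2 V' * (Rmat n D E * (leg1 U * leg2 V)) * (leg2 V' * leg1 U') := by
          simp only [mul_assoc]
      _ = leg1 U' * (leg2 V' * leg2 V) * leg1 U * Rmat n D E * (leg2 V' * leg1 U') := by
          rw [h]; simp only [mul_assoc]
      _ = Rmat n D E * (leg2 V' * leg1 U') := by rw [e2', mul_one, e1', one_mul]
  have := congrFun (congrFun H (i, k)) (j, l)
  rw [Rmat_mul, mul_Rmat] at this
  simp only [leg1_leg2, leg2_leg1, Prod.swap] at this
  rw [← hD, ← hE] at this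
  rw [mul_sub, mul_sub, sub_eq_sub_iff_sub_eq_sub]
  exact this.symm

end RTT

section TwoVar

variable {A : Type*} [Ring A]

/-- A series in `u⁻¹` as a series in two variables. -/
def inU : A⟦X⟧ →+* A⟦X⟧⟦X⟧ := PowerSeries.C

/-- A series in `v⁻¹` as a series in two variables. -/
def inV : A⟦X⟧ →+* A⟦X⟧⟦X⟧ := PowerSeries.map PowerSeries.C

/-- `v⁻¹ - u⁻¹`. -/
def dd (A : Type*) [Ring A] : A⟦X⟧⟦X⟧ := X - PowerSeries.C X

/-- `u⁻¹ v⁻¹`. -/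
def ee (A : Type*) [Ring A] : A⟦X⟧⟦X⟧ := X * PowerSeries.C X

theorem X_comm (b : A⟦X⟧⟦X⟧) : X * b = b * X := (PowerSeries.commute_X b).symm.eq

theorem CX_comm (b : A⟦X⟧⟦X⟧) : PowerSeries.C X * b = b * PowerSeries.C X := by
  ext q p
  rw [PowerSeries.coeff_C_mul, PowerSeries.coeff_mul_C, (PowerSeries.commute_X _).eq]

theorem dd_comm (b : A⟦X⟧⟦X⟧) : dd A * b = b * dd A := by
  rw [dd, sub_mul, mul_sub, X_comm, CX_comm]

theorem ee_comm (b : A⟦X⟧⟦X⟧) : ee A * b = b * ee A := by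
  rw [ee, mul_assoc, CX_comm, ← mul_assoc, X_comm, mul_assoc]

theorem coeff_uv (f g : A⟦X⟧) (p q : ℕ) :
    PowerSeries.coeff p (PowerSeries.coeff q (inU f * inV g)) =
      PowerSeries.coeff p f * PowerSeries.coeff q g := by
  simp [inU, inV, PowerSeries.coeff_C_mul, PowerSeries.coeff_mul_C]

theorem coeff_vu (f g : A⟦X⟧) (p q : ℕ) :
    PowerSeries.coeff p (PowerSeries.coeff q (inV g * inU f)) =
      PowerSeries.coeff q g * PowerSeries.coeff p f := by
  simp [inU, inV, PowerSeries.coeff_C_mul, PowerSeries.coeff_mul_C]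

/-- The relations of the Yangian in terms of coefficients. -/
def CoeffRel {n : ℕ} (g : Fin n → Fin n → ℕ → A) : Prop :=
  ∀ i j k l r s, (g i j (r + 1) * g k l s - g k l s * g i j (r + 1)) -
    (g i j r * g k l (s + 1) - g k l (s + 1) * g i j r) = g k j r * g i l s - g k j s * g i l r

theorem coeff_dd_zero_right (b : A⟦X⟧⟦X⟧) (p : ℕ) :
    PowerSeries.coeff (p + 1) (PowerSeries.coeff 0 (dd A * b)) =
      - PowerSeries.coeff p (PowerSeries.coeff 0 b) := by
  simp [dd, sub_mul, PowerSeries.coeff_C_mul, PowerSeries.coeff_succ_X_mul]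

theorem coeff_dd_zero_left (b : A⟦X⟧⟦X⟧) (q : ℕ) :
    PowerSeries.coeff 0 (PowerSeries.coeff (q + 1) (dd A * b)) =
      PowerSeries.coeff 0 (PowerSeries.coeff q b) := by
  simp [dd, sub_mul, PowerSeries.coeff_C_mul, PowerSeries.coeff_succ_X_mul]

theorem coeff_dd_zero (b : A⟦X⟧⟦X⟧) :
    PowerSeries.coeff 0 (PowerSeries.coeff 0 (dd A * b)) = 0 := by
  simp [dd, sub_mul]

theorem coeff_dd (b : A⟦X⟧⟦X⟧) (p q : ℕ) :
    PowerSeries.coeff (p + 1) (PowerSeries.coeff (q + 1) (dd A * b)) =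
      PowerSeries.coeff (p + 1) (PowerSeries.coeff q b) -
        PowerSeries.coeff p (PowerSeries.coeff (q + 1) b) := by
  simp [dd, sub_mul, PowerSeries.coeff_C_mul, PowerSeries.coeff_succ_X_mul]

theorem coeff_ee (b : A⟦X⟧⟦X⟧) (p q : ℕ) :
    PowerSeries.coeff (p + 1) (PowerSeries.coeff (q + 1) (ee A * b)) =
      PowerSeries.coeff p (PowerSeries.coeff q b) := by
  simp [ee, mul_assoc, PowerSeries.coeff_C_mul, PowerSeries.coeff_succ_X_mul]

theorem coeff_ee_zero_right (b : A⟦X⟧⟦X⟧) (p : ℕ) :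
    PowerSeries.coeff p (PowerSeries.coeff 0 (ee A * b)) = 0 := by
  simp [ee, mul_assoc]

theorem coeff_ee_zero_left (b : A⟦X⟧⟦X⟧) (q : ℕ) :
    PowerSeries.coeff 0 (PowerSeries.coeff q (ee A * b)) = 0 := by
  rw [ee, X_comm, mul_assoc, PowerSeries.coeff_C_mul]
  simp

theorem coeffRel_iff {n : ℕ} (M : Matrix (Fin n) (Fin n) A⟦X⟧)
    (h0 : M.map PowerSeries.constantCoeff = 1) :
    CoeffRel (fun i j r => PowerSeries.coeff r (M i j)) ↔
      RTT (dd A) (ee A) (M.map inU) (M.map inV) := by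
  have h0' : ∀ i j, PowerSeries.coeff 0 (M i j) = if i = j then 1 else 0 := by
    intro i j
    simpa [Matrix.one_apply] using congrFun (congrFun h0 i) j
  constructor
  · intro h i j k l
    ext q p
    simp only [Matrix.map_apply]
    rcases q with _ | q <;> rcases p with _ | p
    · rw [coeff_dd_zero, coeff_ee_zero_right]
    · rw [coeff_dd_zero_right, coeff_ee_zero_right, map_sub, map_sub, coeff_uv, coeff_vu, h0']
      split_ifs <;> simp
    · rw [coeff_dd_zero_left, coeff_ee_zero_left, map_sub, map_sub, coeff_uv, coeff_vu, h0']
      split_ifs <;> simp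
    · rw [coeff_dd, coeff_ee]
      simp only [map_sub, coeff_uv, coeff_vu]
      exact h i j k l p q
  · intro h i j k l p q
    have := congrArg (fun b => PowerSeries.coeff (p + 1) (PowerSeries.coeff (q + 1) b)) (h i j k l)
    simp only [Matrix.map_apply, coeff_dd, coeff_ee] at this
    simpa only [map_sub, coeff_uv, coeff_vu] using this

end TwoVar

theorem coeff_T {n : ℕ} (i j : Fin n) (r : ℕ) : PowerSeries.coeff r (T n i j) = t i j r := by
  simp [T]

theorem rtt_T (n : ℕ) :
    RTT (dd (Yangian n)) (ee (Yangian n)) ((T n).map inU) ((T n).map inV) := by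
  rw [← coeffRel_iff _ (T_map_constantCoeff n)]
  intro i j k l r s
  simp only [coeff_T]
  exact t_rel i j k l r s

/-- The matrix series `T_{[1]}(u) T_{[2]}(u)` over `Y(n) ⊗ Y(n)`. -/
def T12 (n : ℕ) : Matrix (Fin n) (Fin n) (Yangian n ⊗[ℂ] Yangian n)⟦X⟧ :=
  (T n).map (PowerSeries.map
    (Algebra.TensorProduct.includeLeft : Yangian n →ₐ[ℂ] Yangian n ⊗[ℂ] Yangian n).toRingHom) *
  (T n).map (PowerSeries.map
    (Algebra.TensorProduct.includeRight : Yangian n →ₐ[ℂ] Yangian n ⊗[ℂ] Yangian n).toRingHom)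

theorem map_series_constantCoeff {n : ℕ} {A : Type*} [Ring A] (f : Yangian n →+* A) :
    ((T n).map (PowerSeries.map f)).map PowerSeries.constantCoeff = 1 := by
  ext i j
  have := congrFun (congrFun (T_map_constantCoeff n) i) j
  simp only [Matrix.map_apply] at this ⊢
  simp only [← PowerSeries.coeff_zero_eq_constantCoeff_apply, PowerSeries.coeff_map] at this ⊢
  rw [this, Matrix.one_apply, Matrix.one_apply]
  split_ifs <;> simp

theorem rtt_map {n : ℕ} {A : Type*} [Ring A] (f : Yangian n →+* A) :
    RTT (dd A) (ee A) (((T n).map (PowerSeries.map f)).map inU)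
      (((T n).map (PowerSeries.map f)).map inV) := by
  rw [← coeffRel_iff _ (map_series_constantCoeff f)]
  intro i j k l r s
  simp only [Matrix.map_apply, PowerSeries.coeff_map, coeff_T]
  simpa only [map_sub, map_mul] using congrArg f (t_rel i j k l r s)

theorem T12_constantCoeff (n : ℕ) : (T12 n).map PowerSeries.constantCoeff = 1 := by
  rw [T12, Matrix.map_mul, map_series_constantCoeff, map_series_constantCoeff, one_mul]

theorem coeffRel_T12 (n : ℕ) : CoeffRel fun i j r => PowerSeries.coeff r (T12 n i j) := by
  rw [coeffRel_iff _ (T12_constantCoeff n), T12, Matrix.map_mul, Matrix.map_mul]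
  refine RTT.mul dd_comm ee_comm (rtt_map _) (rtt_map _) ?_ ?_ <;>
  · intro i j k l
    ext q p
    simp only [Matrix.map_apply, coeff_uv, coeff_vu, PowerSeries.coeff_map]
    simp

/-- The coproduct `t_{ij}(u) ↦ ∑_a t_{ia}(u) ⊗ t_{aj}(u)`. -/
def comulHom (n : ℕ) : Yangian n →ₐ[ℂ] Yangian n ⊗[ℂ] Yangian n :=
  lift (fun i j r => PowerSeries.coeff r (T12 n i j))
    (fun i j => by
      simpa [Matrix.one_apply] using congrFun (congrFun (T12_constantCoeff n) i) j)
    (coeffRel_T12 n)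

theorem comulHom_t {n : ℕ} (i j : Fin n) (r : ℕ) : comulHom n (t i j r) =
    ∑ a, ∑ p ∈ Finset.HasAntidiagonal.antidiagonal r, t i a p.1 ⊗ₜ[ℂ] t a j p.2 := by
  refine (lift_t _ _ _ i j r).trans ?_
  simp [T12, Matrix.mul_apply, PowerSeries.coeff_mul, coeff_T]

/-- The counit `T(u) ↦ 1`. -/
def counitHom (n : ℕ) : Yangian n →ₐ[ℂ] ℂ :=
  lift (fun i j r => if r = 0 then (if i = j then 1 else 0) else 0) (fun i j => by simp)
    (fun i j k l r s => by
      have hc : ∀ a b : ℂ, a * b - b * a = 0 := fun a b => by ring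
      rw [hc, hc, sub_zero]
      rcases r with _ | r <;> rcases s with _ | s <;> simp)

theorem counitHom_t {n : ℕ} (i j : Fin n) (r : ℕ) : counitHom n (t i j r) =
    if r = 0 then (if i = j then 1 else 0) else 0 := by
  rw [counitHom, lift_t]

/-- The antipode `T(u) ↦ T⁻¹(u)`, as a homomorphism into the opposite algebra. -/
def antipodeHom (n : ℕ) : Yangian n →ₐ[ℂ] (Yangian n)ᵐᵒᵖ :=
  lift (fun i j r => MulOpposite.op (PowerSeries.coeff r (Tinv n i j)))
    (fun i j => by
      have := congrFun (congrFun (Tinv_map_constantCoeff n) i) j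
      simp only [Matrix.map_apply, Matrix.one_apply] at this
      rw [PowerSeries.coeff_zero_eq_constantCoeff_apply, this]
      split_ifs <;> simp)
    (fun i j k l r s => by
      have key : ∀ i j k l, dd (Yangian n) * ((Tinv n).map inV k l * (Tinv n).map inU i j -
          (Tinv n).map inU i j * (Tinv n).map inV k l) = ee (Yangian n) *
          ((Tinv n).map inV i l * (Tinv n).map inU k j -
          (Tinv n).map inU i l * (Tinv n).map inV k j) := by
        refine RTT.inv dd_comm ee_comm (rtt_T n) ?_ ?_ ?_ ?_ <;>
        · rw [← Matrix.map_mul]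
          first
          | rw [T_mul_Tinv]
          | rw [Tinv_mul_T]
          simp
      have := congrArg (fun b => PowerSeries.coeff (r + 1) (PowerSeries.coeff (s + 1) b))
        (key i j k l)
      simp only [Matrix.map_apply, coeff_dd, coeff_ee] at this
      simp only [map_sub, coeff_uv, coeff_vu] at this
      simp only [← MulOpposite.op_mul, ← MulOpposite.op_sub]
      exact congrArg MulOpposite.op this)

/-- The antipode as a linear map. -/
def antipodeLin (n : ℕ) : Yangian n →ₗ[ℂ] Yangian n :=
  (MulOpposite.opLinearEquiv ℂ).symm.toLinearMap ∘ₗ (antipodeHom n).toLinearMap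

theorem antipodeLin_t {n : ℕ} (i j : Fin n) (r : ℕ) :
    antipodeLin n (t i j r) = PowerSeries.coeff r (Tinv n i j) := by
  simp [antipodeLin, antipodeHom, lift_t]

theorem antipodeLin_mul {n : ℕ} (a b : Yangian n) :
    antipodeLin n (a * b) = antipodeLin n b * antipodeLin n a := by
  simp [antipodeLin]

theorem antipodeLin_one (n : ℕ) : antipodeLin n 1 = 1 := by
  simp [antipodeLin]

theorem sum_antidiagonal_assoc {M : Type*} [AddCommMonoid M] (r : ℕ) (f : ℕ → ℕ → ℕ → M) :
    ∑ p ∈ Finset.HasAntidiagonal.antidiagonal r,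
      ∑ q ∈ Finset.HasAntidiagonal.antidiagonal p.1, f q.1 q.2 p.2 =
    ∑ p ∈ Finset.HasAntidiagonal.antidiagonal r,
      ∑ q ∈ Finset.HasAntidiagonal.antidiagonal p.2, f p.1 q.1 q.2 := by
  rw [Finset.sum_sigma', Finset.sum_sigma']
  refine Finset.sum_nbij' (fun x => ⟨(x.2.1, x.2.2 + x.1.2), (x.2.2, x.1.2)⟩)
    (fun x => ⟨(x.1.1 + x.2.1, x.2.2), (x.1.1, x.2.1)⟩) ?_ ?_ ?_ ?_ ?_
  · rintro ⟨⟨a, b⟩, ⟨c, d⟩⟩ h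
    simp only [Finset.mem_sigma, Finset.HasAntidiagonal.mem_antidiagonal] at h ⊢
    obtain ⟨h1, h2⟩ := h
    exact ⟨by omega, trivial⟩
  · rintro ⟨⟨a, b⟩, ⟨c, d⟩⟩ h
    simp only [Finset.mem_sigma, Finset.HasAntidiagonal.mem_antidiagonal] at h ⊢
    obtain ⟨h1, h2⟩ := h
    exact ⟨by omega, trivial⟩
  · rintro ⟨⟨a, b⟩, ⟨c, d⟩⟩ h
    simp only [Finset.mem_sigma, Finset.HasAntidiagonal.mem_antidiagonal] at h
    obtain ⟨h1, rfl⟩ := h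
    rfl
  · rintro ⟨⟨a, b⟩, ⟨c, d⟩⟩ h
    simp only [Finset.mem_sigma, Finset.HasAntidiagonal.mem_antidiagonal] at h
    obtain ⟨h1, rfl⟩ := h
    rfl
  · rintro ⟨⟨a, b⟩, ⟨c, d⟩⟩ h
    rfl

theorem comulHom_coassoc (n : ℕ) :
    (Algebra.TensorProduct.assoc ℂ ℂ ℂ (Yangian n) (Yangian n) (Yangian n)).toAlgHom.comp
      ((Algebra.TensorProduct.map (comulHom n) (.id ℂ (Yangian n))).comp (comulHom n)) =
    (Algebra.TensorProduct.map (.id ℂ (Yangian n)) (comulHom n)).comp (comulHom n) := by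
  apply algHom_ext
  intro i j r
  simp only [AlgHom.comp_apply, comulHom_t, map_sum, Algebra.TensorProduct.map_tmul, AlgHom.id_apply,
    TensorProduct.sum_tmul, TensorProduct.tmul_sum]
  have e : ∀ x y w : Yangian n, (Algebra.TensorProduct.assoc ℂ ℂ ℂ (Yangian n) (Yangian n)
      (Yangian n)).toAlgHom ((x ⊗ₜ[ℂ] y) ⊗ₜ[ℂ] w) = x ⊗ₜ[ℂ] (y ⊗ₜ[ℂ] w) := fun _ _ _ => rfl
  simp only [e]
  calc _ = ∑ a, ∑ b, ∑ p ∈ Finset.HasAntidiagonal.antidiagonal r,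
        ∑ q ∈ Finset.HasAntidiagonal.antidiagonal p.1,
          t i b q.1 ⊗ₜ[ℂ] (t b a q.2 ⊗ₜ[ℂ] t a j p.2) :=
        Finset.sum_congr rfl fun a _ => Finset.sum_comm
    _ = ∑ b, ∑ a, ∑ p ∈ Finset.HasAntidiagonal.antidiagonal r,
        ∑ q ∈ Finset.HasAntidiagonal.antidiagonal p.2,
          t i b p.1 ⊗ₜ[ℂ] (t b a q.1 ⊗ₜ[ℂ] t a j q.2) := by
        rw [Finset.sum_comm]
        refine Finset.sum_congr rfl fun b _ => Finset.sum_congr rfl fun a _ => ?_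
        exact sum_antidiagonal_assoc r fun p q s => t i b p ⊗ₜ[ℂ] (t b a q ⊗ₜ[ℂ] t a j s)
    _ = _ := Finset.sum_congr rfl fun b _ => Finset.sum_comm

theorem comulHom_rTensor (n : ℕ) :
    (Algebra.TensorProduct.map (counitHom n) (.id ℂ (Yangian n))).comp (comulHom n) =
      (Algebra.TensorProduct.lid ℂ (Yangian n)).symm := by
  apply algHom_ext
  intro i j r
  simp only [AlgHom.comp_apply, comulHom_t, map_sum, Algebra.TensorProduct.map_tmul, AlgHom.id_apply,
    counitHom_t]
  rw [Finset.sum_eq_single i]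
  · rw [Finset.sum_eq_single (0, r)]
    · simp
    · rintro ⟨p, q⟩ h hne
      rw [Finset.HasAntidiagonal.mem_antidiagonal] at h
      rw [if_neg, TensorProduct.zero_tmul]
      rintro rfl
      simp_all
    · simp
  · intro b _ hb
    simp [hb.symm]
  · simp

theorem comulHom_lTensor (n : ℕ) :
    (Algebra.TensorProduct.map (.id ℂ (Yangian n)) (counitHom n)).comp (comulHom n) =
      (Algebra.TensorProduct.rid ℂ ℂ (Yangian n)).symm := by
  apply algHom_ext
  intro i j r
  simp only [AlgHom.comp_apply, comulHom_t, map_sum, Algebra.TensorProduct.map_tmul, AlgHom.id_apply,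
    counitHom_t]
  rw [Finset.sum_eq_single j]
  · rw [Finset.sum_eq_single (r, 0)]
    · simp
    · rintro ⟨p, q⟩ h hne
      rw [Finset.HasAntidiagonal.mem_antidiagonal] at h
      rw [if_neg, TensorProduct.tmul_zero]
      rintro rfl
      simp_all
    · simp
  · intro b _ hb
    simp [hb]
  · simp

/-- The coproduct and the counit make the Yangian a bialgebra. -/
instance (n : ℕ) : Bialgebra ℂ (Yangian n) :=
  Bialgebra.ofAlgHom (comulHom n) (counitHom n) (comulHom_coassoc n) (comulHom_rTensor n)
    (comulHom_lTensor n)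

theorem comul_t {n : ℕ} (i j : Fin n) (r : ℕ) : Coalgebra.comul (R := ℂ) (t i j r) =
    ∑ a, ∑ p ∈ Finset.HasAntidiagonal.antidiagonal r, t i a p.1 ⊗ₜ[ℂ] t a j p.2 := comulHom_t i j r

theorem counit_t {n : ℕ} (i j : Fin n) (r : ℕ) : Coalgebra.counit (R := ℂ) (t i j r) =
    if r = 0 then (if i = j then 1 else 0) else 0 := counitHom_t i j r

theorem mul_antipode_rTensor (n : ℕ) :
    LinearMap.mul' ℂ (Yangian n) ∘ₗ (antipodeLin n).rTensor (Yangian n) ∘ₗ Coalgebra.comul =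
      Algebra.linearMap ℂ (Yangian n) ∘ₗ Coalgebra.counit := by
  set G : Yangian n ⊗[ℂ] Yangian n →ₗ[ℂ] Yangian n :=
    LinearMap.mul' ℂ (Yangian n) ∘ₗ (antipodeLin n).rTensor (Yangian n) with hG
  have hGt : ∀ x y, G (x ⊗ₜ y) = antipodeLin n x * y := fun x y => by simp [hG]
  have hm : ∀ (x y : Yangian n) (p), G (p * (x ⊗ₜ y)) = antipodeLin n x * G p * y := by
    intro x y p
    induction p using TensorProduct.induction_on with
    | zero => simp
    | tmul a b =>
      rw [Algebra.TensorProduct.tmul_mul_tmul, hGt, hGt, antipodeLin_mul]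
      simp only [mul_assoc]
    | add p q hp hq => rw [add_mul, map_add, hp, hq, map_add, mul_add, add_mul]
  have hs : ∀ (p q) (c : ℂ), G p = algebraMap ℂ _ c → G (p * q) = algebraMap ℂ _ c * G q := by
    intro p q c hp
    induction q using TensorProduct.induction_on with
    | zero => simp
    | tmul x y => rw [hm, hp, hGt, ← Algebra.commutes, mul_assoc]
    | add q q' h h' => rw [mul_add, map_add, h, h', map_add, mul_add]
  have main : ∀ x : Yangian n, G (Coalgebra.comul (R := ℂ) x) =
      algebraMap ℂ _ (Coalgebra.counit (R := ℂ) x) := by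
    intro x
    let S : Subalgebra ℂ (Yangian n) :=
      { carrier := {x | G (Coalgebra.comul (R := ℂ) x) =
          algebraMap ℂ _ (Coalgebra.counit (R := ℂ) x)}
        mul_mem' := fun {a b} ha hb => by
          simp only [Set.mem_ofPred_eq] at ha hb ⊢
          rw [Bialgebra.comul_mul, hs _ _ _ ha, hb, Bialgebra.counit_mul, map_mul]
        add_mem' := fun {a b} ha hb => by
          simp only [Set.mem_ofPred_eq] at ha hb ⊢
          rw [map_add, map_add, ha, hb, map_add, map_add]
        algebraMap_mem' := fun c => by
          simp only [Set.mem_ofPred_eq]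
          rw [Bialgebra.comul_algebraMap, Algebra.TensorProduct.algebraMap_apply, hGt,
            mul_one, Bialgebra.counit_algebraMap, Algebra.algebraMap_eq_smul_one, map_smul,
            antipodeLin_one] }
    refine t_induction S (fun i j r => ?_) x
    change G _ = _
    rw [comul_t, counit_t]
    simp only [map_sum, hGt, antipodeLin_t]
    have := congrArg (PowerSeries.coeff r) (congrFun (congrFun (Tinv_mul_T n) i) j)
    simp only [Matrix.mul_apply, map_sum, PowerSeries.coeff_mul, coeff_T, Matrix.one_apply] at this
    rw [this]
    split_ifs <;> simp_all [PowerSeries.coeff_one]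
  exact LinearMap.ext main

theorem mul_antipode_lTensor (n : ℕ) :
    LinearMap.mul' ℂ (Yangian n) ∘ₗ (antipodeLin n).lTensor (Yangian n) ∘ₗ Coalgebra.comul =
      Algebra.linearMap ℂ (Yangian n) ∘ₗ Coalgebra.counit := by
  set G : Yangian n ⊗[ℂ] Yangian n →ₗ[ℂ] Yangian n :=
    LinearMap.mul' ℂ (Yangian n) ∘ₗ (antipodeLin n).lTensor (Yangian n) with hG
  have hGt : ∀ x y, G (x ⊗ₜ y) = x * antipodeLin n y := fun x y => by simp [hG]
  have hm : ∀ (x y : Yangian n) (p), G ((x ⊗ₜ y) * p) = x * G p * antipodeLin n y := by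
    intro x y p
    induction p using TensorProduct.induction_on with
    | zero => simp
    | tmul a b =>
      rw [Algebra.TensorProduct.tmul_mul_tmul, hGt, hGt, antipodeLin_mul]
      simp only [mul_assoc]
    | add p q hp hq => rw [mul_add, map_add, hp, hq, map_add, mul_add, add_mul]
  have hs : ∀ (p q) (c : ℂ), G q = algebraMap ℂ _ c → G (p * q) = algebraMap ℂ _ c * G p := by
    intro p q c hq
    induction p using TensorProduct.induction_on with
    | zero => simp
    | tmul x y => rw [hm, hq, hGt, ← Algebra.commutes, mul_assoc]
    | add q q' h h' => rw [add_mul, map_add, h, h', map_add, mul_add]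
  have main : ∀ x : Yangian n, G (Coalgebra.comul (R := ℂ) x) =
      algebraMap ℂ _ (Coalgebra.counit (R := ℂ) x) := by
    intro x
    let S : Subalgebra ℂ (Yangian n) :=
      { carrier := {x | G (Coalgebra.comul (R := ℂ) x) =
          algebraMap ℂ _ (Coalgebra.counit (R := ℂ) x)}
        mul_mem' := fun {a b} ha hb => by
          simp only [Set.mem_ofPred_eq] at ha hb ⊢
          rw [Bialgebra.comul_mul, hs _ _ _ hb, ha, Bialgebra.counit_mul, map_mul,
            Algebra.commutes]
        add_mem' := fun {a b} ha hb => by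
          simp only [Set.mem_ofPred_eq] at ha hb ⊢
          rw [map_add, map_add, ha, hb, map_add, map_add]
        algebraMap_mem' := fun c => by
          simp only [Set.mem_ofPred_eq]
          rw [Bialgebra.comul_algebraMap, Algebra.TensorProduct.algebraMap_apply, hGt,
            antipodeLin_one, mul_one, Bialgebra.counit_algebraMap] }
    refine t_induction S (fun i j r => ?_) x
    change G _ = _
    rw [comul_t, counit_t]
    simp only [map_sum, hGt, antipodeLin_t]
    have := congrArg (PowerSeries.coeff r) (congrFun (congrFun (T_mul_Tinv n) i) j)
    simp only [Matrix.mul_apply, map_sum, PowerSeries.coeff_mul, coeff_T, Matrix.one_apply] at this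
    rw [this]
    split_ifs <;> simp_all [PowerSeries.coeff_one]
  exact LinearMap.ext main

/-- The Hopf algebra structure of the Yangian, with antipode `T(u) ↦ T⁻¹(u)`. -/
instance (n : ℕ) : HopfAlgebra ℂ (Yangian n) where
  antipode := antipodeLin n
  mul_antipode_rTensor_comul := mul_antipode_rTensor n
  mul_antipode_lTensor_comul := mul_antipode_lTensor n

theorem antipode_t {n : ℕ} (i j : Fin n) (r : ℕ) :
    HopfAlgebra.antipode ℂ (t i j r) = PowerSeries.coeff r (Tinv n i j) := antipodeLin_t i j r

end GLYangian

end

/-! Centrality of z(u). The defining relations are the RTT relation for T(u) and T(v). Multiplying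
it by T⁻¹(v) on both sides and putting v = u − n, one finds that the transposes of T(u) and T⁻¹(u −
n) multiply to the scalar matrix z(u)⁻¹; the shift n is the one for which the terms produced by
summing over an index cancel (`sum_T_mul_Tinv_shift`). The exchange computation
`contraction_commutes` then shows that this scalar series commutes with every t_ij.

Liouville formula. The RTT relation at v = u − 1 makes A_n T_1(u) ⋯ T_n(u − n + 1) alternating in
its columns, as it already is in its rows, so one entry determines it. Expanding along the last and
along the first column gives two expressions for the same cofactors, whence `sum_T_qdet_Tinv` and
then t_lj(u) qdet T(u − 1) = qdet T(u) z(u) t_lj(u). Centrality of qdet T(u) = ∑ d_r u⁻ʳ is not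
available beforehand; it is proved together with the formula by induction on r. If the d_q with q <
r are central, the error of the formula in degree r + 1 is a commutator with t_ii⁽¹⁾, the same for
every i, and it vanishes after summation because ∑ t_ii⁽¹⁾ is central. Degree r + 1 of the formula
then expresses r d_r through earlier d_q and the coefficients of z. The same recursion shows that
all d_r are polynomials in z_2, z_3, ….

Center. Give t_ij⁽ʳ⁺¹⁾ the weight 2r + 1. The associated graded algebra is a polynomial ring whose
Poisson bracket comes from gl_n[x]. Freeness (`eq_zero_of_theta_mem`) is proved with representations
by differential operators in which leading terms become multiplication by polynomials. The Poisson
center consists of the polynomials in the traces (`average_eq_self`), which are the leading symbols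
of the d_r, so induction on weight puts the center inside the algebra generated by the d_r.

Independence. The homomorphisms T(u) ↦ f(u)·1 to commutative algebras send z(u) to f(u − n)/f(u),
which can be any series 1 + g_2 u⁻² + ⋯.

Antipode. Applying S to T T⁻¹ = 1 characterizes S²(T) as the inverse of T⁻¹ under transposed
multiplication, and the identity for z(u)⁻¹ shifted by n says that z(u + n)T(u + n) has the same
property. This map is unipotent for the weight filtration, hence bijective, and on qdet T(u) the
factors z(u + n − a) telescope. -/

noncomputable section

open PowerSeries TensorProduct

namespace GLYangian

/-! ### Substitution of central series into power series -/

section Subst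

variable {R S : Type*} [Ring R] [Ring S]

/-- The series `∑ φ(f_r) g^r`, where `g` has no constant term. -/
def substFun (φ : R →+* S⟦X⟧) (g : S⟦X⟧) (f : R⟦X⟧) : S⟦X⟧ :=
  PowerSeries.mk fun m => ∑ r ∈ Finset.range (m + 1), coeff m (φ (coeff r f) * g ^ r)

theorem coeff_mul_pow_eq_zero {g : S⟦X⟧} (hg : constantCoeff g = 0) (x : S⟦X⟧) {m r : ℕ}
    (h : m < r) : coeff m (x * g ^ r) = 0 := by
  have h1 : ∀ r m : ℕ, m < r → coeff m (g ^ r) = 0 := by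
    intro r
    induction r with
    | zero => intro m hm; omega
    | succ r ih =>
      intro m hm
      rw [pow_succ, coeff_mul]
      refine Finset.sum_eq_zero fun p hp => ?_
      rw [Finset.HasAntidiagonal.mem_antidiagonal] at hp
      by_cases h2 : p.1 < r
      · rw [ih _ h2, zero_mul]
      · have : p.2 = 0 := by omega
        rw [this, coeff_zero_eq_constantCoeff_apply, hg, mul_zero]
  rw [coeff_mul]
  refine Finset.sum_eq_zero fun p hp => ?_
  rw [Finset.HasAntidiagonal.mem_antidiagonal] at hp
  rw [h1 _ _ (by omega), mul_zero]

theorem coeff_substFun (φ : R →+* S⟦X⟧) {g : S⟦X⟧} (hg : constantCoeff g = 0) (f : R⟦X⟧)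
    {m N : ℕ} (h : m < N) :
    coeff m (substFun φ g f) = coeff m (∑ r ∈ Finset.range N, φ (coeff r f) * g ^ r) := by
  rw [substFun, coeff_mk, map_sum]
  refine Finset.sum_subset (fun x hx => ?_) fun x _ hx => ?_
  · simp only [Finset.mem_range] at *; omega
  · apply coeff_mul_pow_eq_zero hg
    simp only [Finset.mem_range] at hx; omega

theorem coeff_mul_congr {a b a' b' : S⟦X⟧} {m : ℕ} (ha : ∀ k ≤ m, coeff k a = coeff k a')
    (hb : ∀ k ≤ m, coeff k b = coeff k b') : coeff m (a * b) = coeff m (a' * b') := by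
  rw [coeff_mul, coeff_mul]
  refine Finset.sum_congr rfl fun p hp => ?_
  rw [Finset.HasAntidiagonal.mem_antidiagonal] at hp
  rw [ha _ (by omega), hb _ (by omega)]

/-- Substitution of a central series without constant term, as a ring homomorphism. -/
def substHom (φ : R →+* S⟦X⟧) (g : S⟦X⟧) (hg : constantCoeff g = 0) (hc : ∀ x, Commute g x) :
    R⟦X⟧ →+* S⟦X⟧ where
  toFun := substFun φ g
  map_zero' := by ext m; simp [substFun]
  map_add' a b := by ext m; simp [substFun, add_mul, Finset.sum_add_distrib]
  map_one' := by
    ext m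
    rw [substFun, coeff_mk, Finset.sum_eq_single 0]
    · simp
    · intro r _ hr
      simp [coeff_one, hr]
    · simp
  map_mul' a b := by
    ext m
    rw [coeff_mul_congr (fun k hk => coeff_substFun φ hg a (N := m + 1) (by omega))
      (fun k hk => coeff_substFun φ hg b (N := m + 1) (by omega)),
      Finset.sum_mul_sum, coeff_substFun φ hg _ (Nat.lt_succ_self m)]
    set F : ℕ × ℕ → S := fun x =>
      coeff m (φ (coeff x.1 a) * φ (coeff x.2 b) * g ^ (x.1 + x.2)) with hF
    have h1 : ∀ x : ℕ × ℕ, coeff m (φ (coeff x.1 a) * g ^ x.1 * (φ (coeff x.2 b) * g ^ x.2)) =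
        F x := by
      intro x
      rw [hF]
      simp only
      rw [pow_add, mul_assoc, mul_assoc, ← mul_assoc (g ^ x.1), ((hc _).pow_left _).eq, mul_assoc]
    have h2 : ∀ k, coeff m (φ (coeff k (a * b)) * g ^ k) =
        ∑ x ∈ Finset.HasAntidiagonal.antidiagonal k, F x := by
      intro k
      rw [coeff_mul k, map_sum, Finset.sum_mul, map_sum]
      refine Finset.sum_congr rfl fun x hx => ?_
      rw [Finset.HasAntidiagonal.mem_antidiagonal] at hx
      simp only [hF]
      rw [map_mul φ, hx]
    simp only [← Finset.sum_product', map_sum, h1, h2]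
    set s := (Finset.range (m + 1) ×ˢ Finset.range (m + 1)).filter fun x => x.1 + x.2 ≤ m with hs
    -- A pair with x.1 + x.2 > m carries a power of `g` of order greater than m, so the square of
    -- indices may be cut down to the triangle.
    have h3 : ∑ x ∈ Finset.range (m + 1) ×ˢ Finset.range (m + 1), F x = ∑ x ∈ s, F x := by
      refine (Finset.sum_filter_of_ne fun x _ hx => ?_).symm
      by_contra hlt
      exact hx (coeff_mul_pow_eq_zero hg _ (by omega))
    rw [h3, ← Finset.sum_fiberwise_of_maps_to (s := s) (t := Finset.range (m + 1))
      (g := fun x : ℕ × ℕ => x.1 + x.2) fun x hx => by simp only [hs, Finset.mem_filter, Finset.mem_range] at hx ⊢; omega]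
    refine Finset.sum_congr rfl fun k hk => Finset.sum_congr ?_ fun _ _ => rfl
    ext x
    simp only [hs, Finset.mem_filter, Finset.mem_range, Finset.mem_product,
      Finset.HasAntidiagonal.mem_antidiagonal] at hk ⊢
    omega

theorem substHom_apply (φ : R →+* S⟦X⟧) (g : S⟦X⟧) (hg) (hc) (f : R⟦X⟧) :
    substHom φ g hg hc f = substFun φ g f := rfl

theorem substHom_C (φ : R →+* S⟦X⟧) (g : S⟦X⟧) (hg) (hc) (x : R) :
    substHom φ g hg hc (C x) = φ x := by
  ext m
  rw [substHom_apply, substFun, coeff_mk, Finset.sum_eq_single 0]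
  · simp
  · intro r _ hr
    simp [coeff_C, hr]
  · simp

theorem substHom_X (φ : R →+* S⟦X⟧) (g : S⟦X⟧) (hg) (hc) :
    substHom φ g hg hc X = g := by
  ext m
  rw [substHom_apply, coeff_substFun φ hg _ (N := m + 2) (by omega), Finset.sum_eq_single 1]
  · simp
  · intro r _ hr
    simp [coeff_X, hr]
  · simp

end Subst

/-! ### The spectral shift f(u) ↦ f(u + a) -/

section Shift

variable {A : Type*} [Ring A] [Algebra ℂ A]

/-- The series `(u + a)⁻¹`. -/
def invShift (a : ℂ) : ℂ⟦X⟧ := X * (1 + C a * X)⁻¹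

theorem constantCoeff_invShift (a : ℂ) : constantCoeff (invShift a) = 0 := by simp [invShift]

theorem invShift_mul (a : ℂ) : invShift a * (1 + C a * X) = X := by
  rw [invShift, mul_assoc, PowerSeries.inv_mul_cancel _ (by simp), mul_one]

theorem commute_map_algebraMap (g : ℂ⟦X⟧) (x : A⟦X⟧) :
    Commute (PowerSeries.map (algebraMap ℂ A) g) x := by
  ext m
  rw [coeff_mul, coeff_mul, ← Finset.Nat.sum_antidiagonal_swap]
  refine Finset.sum_congr rfl fun p _ => ?_
  simp only [coeff_map, Prod.fst_swap, Prod.snd_swap, Algebra.commutes]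

/-- The shift `f(u) ↦ f(u + a)` as a ring homomorphism. -/
def shiftHom (A : Type*) [Ring A] [Algebra ℂ A] (a : ℂ) : A⟦X⟧ →+* A⟦X⟧ :=
  substHom C (PowerSeries.map (algebraMap ℂ A) (invShift a))
    (by rw [← coeff_zero_eq_constantCoeff_apply, coeff_map, coeff_zero_eq_constantCoeff_apply,
      constantCoeff_invShift, map_zero]) fun x => commute_map_algebraMap _ x

theorem shiftHom_apply (a : ℂ) (f : A⟦X⟧) : shiftHom A a f = shift a f := by
  ext m
  rw [shiftHom, substHom_apply, substFun, shift, coeff_mk, coeff_mk]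
  refine Finset.sum_congr rfl fun r _ => ?_
  rw [coeff_C_mul, ← map_pow, coeff_map, invShift, Algebra.smul_def, Algebra.commutes]

theorem shift_mul (a : ℂ) (f g : A⟦X⟧) : shift a (f * g) = shift a f * shift a g := by
  simp only [← shiftHom_apply, map_mul]

theorem shift_add (a : ℂ) (f g : A⟦X⟧) : shift a (f + g) = shift a f + shift a g := by
  simp only [← shiftHom_apply, map_add]

theorem shift_one (a : ℂ) : shift a (1 : A⟦X⟧) = 1 := by
  simp only [← shiftHom_apply, map_one]

theorem shift_zero_series (a : ℂ) : shift a (0 : A⟦X⟧) = 0 := by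
  simp only [← shiftHom_apply, map_zero]

theorem shift_sum {ι : Type*} (a : ℂ) (s : Finset ι) (f : ι → A⟦X⟧) :
    shift a (∑ i ∈ s, f i) = ∑ i ∈ s, shift a (f i) := by
  simp only [← shiftHom_apply, map_sum]

theorem shift_X (a : ℂ) : shift a (X : A⟦X⟧) = PowerSeries.map (algebraMap ℂ A) (invShift a) := by
  rw [← shiftHom_apply, shiftHom, substHom_X]

theorem coeff_shift (a : ℂ) (f : A⟦X⟧) (m : ℕ) : coeff m (shift a f) =
    ∑ r ∈ Finset.range (m + 1), coeff m (invShift a ^ r) • coeff r f := by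
  rw [shift, coeff_mk]
  rfl

theorem coeff_invShift_pow_self (a : ℂ) (r : ℕ) : coeff r (invShift a ^ r) = 1 := by
  rw [invShift, mul_pow, coeff_X_pow_mul']
  simp

/-- From (u + a)⁻ʳ = u⁻ʳ − r a u⁻ʳ⁻¹ + ⋯. This nonzero second coefficient is what later allows
difference equations in u to be solved for the coefficient of index r. -/
theorem coeff_invShift_pow_succ (a : ℂ) (r : ℕ) :
    coeff (r + 1) (invShift a ^ r) = - (r * a) := by
  have h1 : coeff 1 ((1 + C a * X : ℂ⟦X⟧)⁻¹) = -a := by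
    have := congrArg (coeff 1) (PowerSeries.mul_inv_cancel (1 + C a * X : ℂ⟦X⟧) (by simp))
    rw [add_mul, one_mul, mul_assoc, map_add, coeff_C_mul, coeff_succ_X_mul, coeff_one] at this
    simp at this
    exact eq_neg_of_add_eq_zero_left this
  have h2 : ∀ r : ℕ, coeff 1 ((1 + C a * X : ℂ⟦X⟧)⁻¹ ^ r) = -(r * a) := by
    intro r
    induction r with
    | zero => simp [coeff_one]
    | succ r ih =>
      rw [pow_succ, coeff_mul, Finset.Nat.sum_antidiagonal_succ]
      simp [ih, h1]
      ring
  rw [invShift, mul_pow, coeff_X_pow_mul', if_pos (by omega), Nat.add_sub_cancel_left, h2]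

theorem coeff_one_shift (a : ℂ) (f : A⟦X⟧) : coeff 1 (shift a f) = coeff 1 f := by
  rw [coeff_shift, Finset.sum_range_succ, Finset.sum_range_one, coeff_invShift_pow_self]
  simp [coeff_one]

/-- The two leading terms of a coefficient of `f(u + a)`. -/
theorem coeff_shift_succ (a : ℂ) (f : A⟦X⟧) (m : ℕ) : coeff (m + 1) (shift a f) =
    ∑ r ∈ Finset.range m, coeff (m + 1) (invShift a ^ r) • coeff r f +
      (-(m * a)) • coeff m f + coeff (m + 1) f := by
  rw [coeff_shift, Finset.sum_range_succ, Finset.sum_range_succ, coeff_invShift_pow_self,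
    coeff_invShift_pow_succ, one_smul]

theorem invShift_zero : invShift 0 = X := by simp [invShift]

theorem shift_zero (f : A⟦X⟧) : shift 0 f = f := by
  ext m
  rw [coeff_shift, invShift_zero, Finset.sum_range_succ, Finset.sum_eq_zero]
  · simp
  · intro r hr
    rw [Finset.mem_range] at hr
    rw [coeff_X_pow, if_neg (by omega), zero_smul]

theorem shift_invShift (a b : ℂ) : shift a (invShift b) = invShift (a + b) := by
  have hX : shift a (X : ℂ⟦X⟧) = invShift a := by
    rw [shift_X]; ext; simp
  have hC : shift a (C b : ℂ⟦X⟧) = C b := by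
    rw [← shiftHom_apply, shiftHom, substHom_C]
  have h1 := congrArg (shift a) (invShift_mul b)
  rw [shift_mul, shift_add, shift_one, shift_mul, hX, hC] at h1
  have ha := invShift_mul a
  have hab := invShift_mul (a + b)
  have h0 : (1 + C (a + b) * X : ℂ⟦X⟧) ≠ 0 := by
    intro h
    have := congrArg constantCoeff h
    simp at this
  have h2 : shift a (invShift b) * (1 + C (a + b) * X) = X := by
    rw [map_add]
    linear_combination (1 + C a * X) * h1 + (1 - shift a (invShift b) * C b) * ha
  exact mul_right_cancel₀ h0 (h2.trans hab.symm)

theorem shift_shift (a b : ℂ) (f : A⟦X⟧) : shift a (shift b f) = shift (a + b) f := by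
  ext m
  rw [coeff_shift, coeff_shift (a + b)]
  have h1 : ∀ r ∈ Finset.range (m + 1), coeff r (shift b f) =
      ∑ s ∈ Finset.range (m + 1), coeff r (invShift b ^ s) • coeff s f := by
    intro r hr
    rw [Finset.mem_range] at hr
    rw [coeff_shift]
    refine Finset.sum_subset (fun x hx => ?_) fun x _ hx => ?_
    · simp only [Finset.mem_range] at *; omega
    · simp only [Finset.mem_range] at hx
      have := coeff_mul_pow_eq_zero (constantCoeff_invShift b) 1 (m := r) (r := x) (by omega)
      rw [one_mul] at this
      rw [this, zero_smul]
  rw [Finset.sum_congr rfl fun r hr => by rw [h1 r hr, Finset.smul_sum], Finset.sum_comm]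
  refine Finset.sum_congr rfl fun s _ => ?_
  have h2 : invShift (a + b) ^ s = shift a (invShift b ^ s) := by
    rw [← shiftHom_apply, map_pow, shiftHom_apply, shift_invShift]
  rw [h2, coeff_shift, Finset.sum_smul]
  refine Finset.sum_congr rfl fun r _ => ?_
  rw [smul_smul, smul_eq_mul]

theorem map_shift {A' : Type*} [Ring A'] [Algebra ℂ A'] (φ : A →ₐ[ℂ] A') (a : ℂ) (f : A⟦X⟧) :
    PowerSeries.map (φ : A →+* A') (shift a f) = shift a (PowerSeries.map (φ : A →+* A') f) := by
  ext m
  simp [coeff_shift, map_sum]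

theorem shift_mem (S : Submodule ℂ A) (a : ℂ) {f : A⟦X⟧} (hf : ∀ r, coeff r f ∈ S) (r : ℕ) :
    coeff r (shift a f) ∈ S := by
  rw [coeff_shift]
  exact S.sum_mem fun s _ => S.smul_mem _ (hf s)

end Shift

/-! ### Specialization of identities in two variables -/

section Specialize

variable {A : Type*} [Ring A]

/-- Both variables are set equal. -/
def diag (A : Type*) [Ring A] : A⟦X⟧⟦X⟧ →+* A⟦X⟧ :=
  substHom (RingHom.id _) X (by simp) fun x => (PowerSeries.commute_X x).symm

theorem diag_inU (f : A⟦X⟧) : diag A (inU f) = f := by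
  rw [diag, inU, substHom_C, RingHom.id_apply]

theorem diag_inV (f : A⟦X⟧) : diag A (inV f) = f := by
  ext m
  rw [diag, substHom_apply, substFun, coeff_mk, Finset.sum_eq_single m]
  · simp [inV, coeff_mul_X_pow']
  · intro r hr hrm
    rw [Finset.mem_range] at hr
    have : m - r ≠ 0 := by omega
    simp [inV, coeff_mul_X_pow', coeff_C, this]
  · simp

theorem inV_X : inV (X : A⟦X⟧) = X := by simp [inV]

theorem inU_X : inU (X : A⟦X⟧) = C X := by simp [inU]

theorem eq_zero_of_X_mul {R : Type*} [Ring R] {x : R⟦X⟧} (h : X * x = 0) : x = 0 := by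
  ext m
  simpa [coeff_succ_X_mul] using congrArg (coeff (m + 1)) h

variable [Algebra ℂ A]

theorem shift_inU (a : ℂ) (f : A⟦X⟧) : shift a (inU f) = inU f := by
  rw [← shiftHom_apply, shiftHom, inU, substHom_C]

theorem shift_inV (a : ℂ) (f : A⟦X⟧) : shift a (inV f) = inV (shift a f) := by
  ext q p
  simp only [coeff_shift, inV, coeff_map, map_sum, coeff_smul, coeff_C, smul_ite, smul_zero]

/-- The series `(u + a)⁻¹` over `A`. -/
theorem shift_X_mul (a : ℂ) : shift a (X : A⟦X⟧) * (1 + a • X) = X := by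
  have := congrArg (PowerSeries.map (algebraMap ℂ A)) (invShift_mul a)
  rw [map_mul, ← shift_X] at this
  have h2 : PowerSeries.map (algebraMap ℂ A) (1 + C a * X) = 1 + a • X := by
    rw [map_add, map_one, map_mul, map_X, map_C]
    congr 1
    ext m
    rw [coeff_smul, coeff_C_mul, Algebra.smul_def]
  rwa [h2, map_X] at this

theorem shift_X_commute (a : ℂ) (x : A⟦X⟧) : shift a X * x = x * shift a X := by
  rw [shift_X]; exact commute_map_algebraMap _ x

/-- Since `dd` is (u − v)/(uv) and `ee` is 1/(uv), the hypothesis reads (u − v)b = c. The shift acts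
on the outer variable v and `diag` identifies the variables, so together they put v = u − a, where u
− v becomes a. -/
theorem specialize_eq {b c : A⟦X⟧⟦X⟧} (h : dd A * b = ee A * c) (a : ℂ) :
    a • diag A (shift (-a) b) = diag A (shift (-a) c) := by
  set g : A⟦X⟧ := shift (-a) X with hg
  have hX : diag A (shift (-a) X) = g := by rw [← inV_X, shift_inV, diag_inV]
  have hCX : diag A (shift (-a) (C X)) = X := by rw [← inU_X, shift_inU, diag_inU]
  have h1 := congrArg (fun x => diag A (shiftHom _ (-a) x)) h
  simp only [dd, ee, map_mul, map_sub, shiftHom_apply, hX, hCX] at h1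
  have h2 : g * (1 + (-a) • X) = X := shift_X_mul (-a)
  have h3 : g - X = a • (g * X) := by
    rw [mul_add, mul_one, mul_smul_comm, neg_smul, add_neg_eq_iff_eq_add] at h2
    rw [sub_eq_iff_eq_add', ← h2]
  have h4 : X * (X * (a • diag A (shift (-a) b) - diag A (shift (-a) c))) = 0 := by
    nth_rewrite 1 [← h2]
    rw [shift_X_commute, mul_assoc, ← mul_assoc g, mul_sub (g * X), ← h1, h3]
    simp
  exact sub_eq_zero.1 (eq_zero_of_X_mul (eq_zero_of_X_mul h4))

/-- Replacing v by v − a turns u − v into u − v + a. The factor 1 − a v⁻¹ clears the denominator of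
(v − a)⁻¹. -/
theorem shift_outer_eq {b c : A⟦X⟧⟦X⟧} (h : dd A * b = ee A * c) (a : ℂ) :
    (dd A + a • ee A) * shift (-a) b = ee A * shift (-a) c := by
  set g : A⟦X⟧⟦X⟧ := shift (-a) X with hg
  have hCX : shift (-a) (C X : A⟦X⟧⟦X⟧) = C X := by rw [← inU_X, shift_inU]
  have h1 := congrArg (fun x => (1 + (-a) • X) * shiftHom _ (-a) x) h
  have h2 : (1 + (-a) • X) * g = X := by rw [← shift_X_commute]; exact shift_X_mul (-a)
  simp only [dd, ee, map_mul, map_sub, shiftHom_apply, hCX] at h1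
  rw [← hg, ← mul_assoc, ← mul_assoc, mul_sub, ← mul_assoc, h2] at h1
  rw [dd, ee, ← h1]
  congr 1
  simp only [add_mul, one_mul, neg_smul, neg_mul, smul_mul_assoc]
  abel

/-- As a series in v⁻¹ the factor begins with −u⁻¹, which is not a zero divisor, so the coefficients
of `b` vanish one after another. -/
theorem eq_zero_of_dd_add_mul {b : A⟦X⟧⟦X⟧} {a : ℂ} (h : (dd A + a • ee A) * b = 0) : b = 0 := by
  have key : ∀ q, coeff q b = 0 := by
    intro q
    induction q with
    | zero =>
      have := congrArg (coeff 0) h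
      rw [dd, ee] at this
      simp [add_mul, sub_mul, mul_assoc] at this
      exact eq_zero_of_X_mul (by simpa using this)
    | succ q ih =>
      have := congrArg (coeff (q + 1)) h
      rw [dd, ee] at this
      simp [add_mul, sub_mul, mul_assoc, coeff_C_mul, coeff_succ_X_mul, ih] at this
      exact eq_zero_of_X_mul this
  ext1 q
  rw [key, map_zero]

end Specialize

/-! ### Exchange relations and a commuting contraction -/

section CentralContraction

variable {K B : Type*} [CommRing K] [Ring B] [Algebra K B] {n : ℕ}

/-- If `t` and `m` are matrices with `∑ i, t_{ij} m_{ik} = δ_{jk} w`, and `Z` satisfies the exchange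
relations with `t` and with `m`, then `w` commutes with `Z` up to the factor `D² - E²`. -/
theorem contraction_commutes {D E : K} (hD : ∀ x : B, D • x = 0 → x = 0)
    (hL : ∀ x : B, (D + n * E) • x = 0 → x = 0) {Z t m : Matrix (Fin n) (Fin n) B} {w : B}
    (h1 : ∀ a b i j, D • (Z a b * t i j - t i j * Z a b) = E • (Z i b * t a j - t i b * Z a j))
    (h2 : ∀ a b i k, (D + n * E) • (Z a b * m i k - m i k * Z a b) =
      E • ((if k = b then ∑ c, Z a c * m i c else 0) - if a = i then ∑ c, m c k * Z c b else 0))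
    (h3 : ∀ j k, ∑ i, t i j * m i k = if j = k then w else 0) (a b : Fin n) :
    (D ^ 2 - E ^ 2) • (Z a b * w - w * Z a b) = 0 := by
  set L := D + n * E with hLdef
  set θ := ∑ c, ∑ d, m c d * Z c d with hθ
  set θ' := ∑ c, ∑ d, Z c d * m c d with hθ'
  -- Summing `h2` with a = i produces the last contraction n times, and L − nE = D. This is where
  -- the multiple n in L is needed.
  have eG0 : ∀ b k, L • ∑ i, Z i b * m i k = D • ∑ c, m c k * Z c b +
      E • if k = b then θ' else 0 := by
    intro b k
    have : ∀ i, L • (Z i b * m i k) = L • (m i k * Z i b) +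
      E • ((if k = b then ∑ c, Z i c * m i c else 0) - ∑ c, m c k * Z c b) := by
      intro i
      have := h2 i b i k
      rw [if_pos rfl] at this
      rw [← this]; module
    rw [Finset.smul_sum, Finset.sum_congr rfl fun i _ => this i, Finset.sum_add_distrib,
      ← Finset.smul_sum, ← Finset.smul_sum, Finset.sum_sub_distrib, Finset.sum_const,
      Finset.card_univ, Fintype.card_fin, hLdef]
    split_ifs
    · rw [← Nat.cast_smul_eq_nsmul K]; module
    · rw [← Nat.cast_smul_eq_nsmul K, Finset.sum_const_zero]; module
  -- The trace of `eG0` over k = b is Lθ' = Dθ + nEθ', that is, Dθ' = Dθ.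
  have hθθ : θ' = θ := by
    have h4 : ∑ k, L • ∑ i, Z i k * m i k = L • θ' := by
      rw [hθ', Finset.sum_comm, Finset.smul_sum]
    have h5 : ∑ k, D • ∑ c, m c k * Z c k = D • θ := by
      rw [hθ, Finset.sum_comm, Finset.smul_sum]
    simp only [eG0, if_true, Finset.sum_add_distrib, h5, Finset.sum_const, Finset.card_univ,
      Fintype.card_fin] at h4
    rw [← Nat.cast_smul_eq_nsmul K, hLdef] at h4
    refine sub_eq_zero.1 (hD _ ?_)
    linear_combination (norm := module) -h4
  have eH : ∀ j a, D • ∑ i, ∑ c, t i j * (Z a c * m i c) = L • (w * Z a j) - E • (t a j * θ) := by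
    intro j a
    have h4 : ∀ i c, L • (t i j * (Z a c * m i c)) = L • (t i j * m i c * Z a c) +
        E • (t i j * ∑ c, Z a c * m i c) -
          E • if a = i then t i j * ∑ d, m d c * Z d c else 0 := by
      intro i c
      have := congrArg (fun x => t i j * x) (h2 a c i c)
      simp only [if_true, mul_smul_comm, mul_sub, mul_ite, mul_zero, smul_sub] at this
      rw [mul_assoc, add_sub_assoc, ← this]; module
    have h5 : L • ∑ i, ∑ c, t i j * (Z a c * m i c) = L • (w * Z a j) +
        (n : K) • E • ∑ i, ∑ c, t i j * (Z a c * m i c) - E • (t a j * θ) := by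
      simp only [Finset.smul_sum, h4, Finset.sum_add_distrib, Finset.sum_sub_distrib]
      congr 2
      · rw [Finset.sum_comm]
        simp only [← Finset.smul_sum, ← Finset.sum_mul, h3]
        simp
      · simp only [Finset.sum_const, Finset.card_univ, Fintype.card_fin,
          ← Nat.cast_smul_eq_nsmul K, Finset.smul_sum, Finset.mul_sum]
      · rw [Finset.sum_comm]
        simp only [hθ, smul_ite, smul_zero, Finset.sum_ite_eq, Finset.mem_univ, if_true,
          Finset.mul_sum, Finset.smul_sum]
        rw [Finset.sum_comm]
    rw [hLdef] at h5 ⊢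
    linear_combination (norm := module) h5
  -- The Leibniz rule for the commutator of Z with ∑ t m. The sums left over are eliminated by `e1`,
  -- `e2`, `eG1` and `eH1`, after one more multiplication by L that `hL` cancels.
  have e0 : (D * L) • (Z a b * w - w * Z a b) =
      (L * E) • (∑ i, Z i b * t a b * m i b - ∑ i, t i b * Z a b * m i b) +
      (D * E) • (∑ i, ∑ c, t i b * (Z a c * m i c) - t a b * ∑ c, m c b * Z c b) := by
    have hw : w = ∑ i, t i b * m i b := by rw [h3, if_pos rfl]
    have h4 : ∀ i, (D * L) • (Z a b * (t i b * m i b) - t i b * m i b * Z a b) =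
      (L * E) • (Z i b * t a b * m i b - t i b * Z a b * m i b) +
      (D * E) • (∑ c, t i b * (Z a c * m i c) -
        if a = i then t i b * ∑ c, m c b * Z c b else 0) := by
      intro i
      have e1 := congrArg (fun x => x * m i b) (h1 a b i b)
      have e2 := congrArg (fun x => t i b * x) (h2 a b i b)
      simp only [smul_mul_assoc, mul_smul_comm, mul_sub, sub_mul, ← mul_assoc, if_true,
        mul_ite, mul_zero, Finset.mul_sum] at e1 e2 ⊢
      linear_combination (norm := module) L • e1 + D • e2
    rw [hw, Finset.mul_sum, Finset.sum_mul, ← Finset.sum_sub_distrib, Finset.smul_sum,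
      Finset.sum_congr rfl fun i _ => h4 i, Finset.sum_add_distrib, ← Finset.smul_sum,
      ← Finset.smul_sum, Finset.sum_sub_distrib, Finset.sum_sub_distrib]
    simp
  have e1 : D • ∑ i, Z i b * t a b * m i b = D • (t a b * ∑ i, Z i b * m i b) +
      E • (Z a b * w - t a b * ∑ i, Z i b * m i b) := by
    have h4 : ∀ i, D • (Z i b * t a b * m i b) = D • (t a b * (Z i b * m i b)) +
        E • (Z a b * (t i b * m i b) - t a b * (Z i b * m i b)) := by
      intro i
      have := congrArg (fun x => x * m i b) (h1 i b a b)
      simp only [smul_mul_assoc, sub_mul, ← mul_assoc] at this ⊢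
      linear_combination (norm := module) this
    rw [Finset.smul_sum, Finset.sum_congr rfl fun i _ => h4 i, Finset.sum_add_distrib,
      ← Finset.smul_sum, ← Finset.smul_sum, Finset.sum_sub_distrib]
    simp only [← Finset.mul_sum, h3, if_true]
  have e2 : L • ∑ i, t i b * Z a b * m i b = L • (w * Z a b) +
      E • (∑ i, ∑ c, t i b * (Z a c * m i c) - t a b * ∑ c, m c b * Z c b) := by
    have h4 : ∀ i, L • (t i b * Z a b * m i b) = L • (t i b * m i b * Z a b) +
        E • (∑ c, t i b * (Z a c * m i c) -
          if a = i then t i b * ∑ c, m c b * Z c b else 0) := by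
      intro i
      have := congrArg (fun x => t i b * x) (h2 a b i b)
      simp only [mul_smul_comm, mul_sub, ← mul_assoc, if_true, mul_ite, mul_zero,
        Finset.mul_sum] at this ⊢
      linear_combination (norm := module) this
    rw [Finset.smul_sum, Finset.sum_congr rfl fun i _ => h4 i, Finset.sum_add_distrib,
      ← Finset.smul_sum, ← Finset.smul_sum, Finset.sum_sub_distrib, ← Finset.sum_mul, h3,
      if_pos rfl]
    simp
  have eG := eG0 b b
  rw [if_pos rfl, hθθ] at eG
  have eG1 := congrArg (fun x => t a b * x) eG
  simp only [mul_add, mul_smul_comm] at eG1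
  have eH1 := eH b a
  refine hL _ ?_
  linear_combination (norm := module) D • e0 + (L * E) • e1 - (D * E) • e2 + (D * E) • eG1 - (E * E) • eG1 + (D * E) • eH1 - (E * E) • eH1
end CentralContraction

/-! ### The series `z(u)` is central -/

section ZCentral

variable {n : ℕ}

/-- The RTT relation multiplied by T⁻¹(v) on both sides: the commutator with T(v) becomes minus the
commutator with T⁻¹(v), and in each term on the right T(v) meets one of the two inverses and
cancels. -/
theorem dd_mul_T_Tinv (i j c d : Fin n) :
    dd (Yangian n) * (inU (T n i j) * inV (Tinv n c d) - inV (Tinv n c d) * inU (T n i j)) =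
      ee (Yangian n) * ((if c = j then ∑ l, inU (T n i l) * inV (Tinv n l d) else 0) -
        if i = d then ∑ k, inV (Tinv n c k) * inU (T n k j) else 0) := by
  have hV : ∀ a b, ∑ k, inV (T n a k) * inV (Tinv n k b) =
      if a = b then (1 : (Yangian n)⟦X⟧⟦X⟧) else 0 := by
    intro a b
    have := congrArg inV (congrFun (congrFun (T_mul_Tinv n) a) b)
    rw [Matrix.mul_apply, map_sum, Matrix.one_apply] at this
    simp only [map_mul] at this
    rw [this]
    split_ifs <;> simp
  have hV' : ∀ a b, ∑ k, inV (Tinv n a k) * inV (T n k b) =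
      if a = b then (1 : (Yangian n)⟦X⟧⟦X⟧) else 0 := by
    intro a b
    have := congrArg inV (congrFun (congrFun (Tinv_mul_T n) a) b)
    rw [Matrix.mul_apply, map_sum, Matrix.one_apply] at this
    simp only [map_mul] at this
    rw [this]
    split_ifs <;> simp
  have h : ∑ k, ∑ l, inV (Tinv n c k) * (dd (Yangian n) *
      (inU (T n i j) * inV (T n k l) - inV (T n k l) * inU (T n i j))) * inV (Tinv n l d) =
      ∑ k, ∑ l, inV (Tinv n c k) * (ee (Yangian n) *
      (inU (T n k j) * inV (T n i l) - inV (T n k j) * inU (T n i l))) * inV (Tinv n l d) :=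
    Finset.sum_congr rfl fun k _ => Finset.sum_congr rfl fun l _ => by
      rw [show dd (Yangian n) * (inU (T n i j) * inV (T n k l) - inV (T n k l) * inU (T n i j)) =
        ee (Yangian n) * (inU (T n k j) * inV (T n i l) - inV (T n k j) * inU (T n i l))
        from rtt_T n i j k l]
  have h1 : ∀ (x : (Yangian n)⟦X⟧⟦X⟧) (k l : Fin n), inV (Tinv n c k) * (dd (Yangian n) * x) *
      inV (Tinv n l d) = dd (Yangian n) * (inV (Tinv n c k) * x * inV (Tinv n l d)) := by
    intro x k l
    rw [← mul_assoc, ← dd_comm, mul_assoc, mul_assoc, mul_assoc]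
  have h2 : ∀ (x : (Yangian n)⟦X⟧⟦X⟧) (k l : Fin n), inV (Tinv n c k) * (ee (Yangian n) * x) *
      inV (Tinv n l d) = ee (Yangian n) * (inV (Tinv n c k) * x * inV (Tinv n l d)) := by
    intro x k l
    rw [← mul_assoc, ← ee_comm, mul_assoc, mul_assoc, mul_assoc]
  simp only [h1, h2, ← Finset.mul_sum, mul_sub, sub_mul, Finset.sum_sub_distrib] at h
  have e1 : ∑ k, ∑ l, inV (Tinv n c k) * (inU (T n i j) * inV (T n k l)) * inV (Tinv n l d) =
      inV (Tinv n c d) * inU (T n i j) := by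
    simp only [mul_assoc, ← Finset.mul_sum, hV]
    simp
  have e2 : ∑ k, ∑ l, inV (Tinv n c k) * (inV (T n k l) * inU (T n i j)) * inV (Tinv n l d) =
      inU (T n i j) * inV (Tinv n c d) := by
    rw [Finset.sum_comm]
    simp only [← mul_assoc, ← Finset.sum_mul, hV']
    simp
  have e3 : ∑ k, ∑ l, inV (Tinv n c k) * (inU (T n k j) * inV (T n i l)) * inV (Tinv n l d) =
      if i = d then ∑ k, inV (Tinv n c k) * inU (T n k j) else 0 := by
    simp only [mul_assoc, ← Finset.mul_sum, hV]
    split_ifs <;> simp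
  have e4 : ∑ k, ∑ l, inV (Tinv n c k) * (inV (T n k j) * inU (T n i l)) * inV (Tinv n l d) =
      if c = j then ∑ l, inU (T n i l) * inV (Tinv n l d) else 0 := by
    rw [Finset.sum_comm]
    simp only [← mul_assoc, ← Finset.sum_mul, hV']
    split_ifs <;> simp
  rw [e1, e2, e3, e4] at h
  rw [mul_sub, mul_sub, ← neg_sub, h, neg_sub]

theorem specialize_uv (f g : (Yangian n)⟦X⟧) (a : ℂ) :
    diag _ (shift (-a) (inU f * inV g)) = f * shift (-a) g := by
  rw [shift_mul, shift_inU, shift_inV, map_mul, diag_inU, diag_inV]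

theorem specialize_vu (f g : (Yangian n)⟦X⟧) (a : ℂ) :
    diag _ (shift (-a) (inV g * inU f)) = shift (-a) g * f := by
  rw [shift_mul, shift_inU, shift_inV, map_mul, diag_inU, diag_inV]

theorem shift_sub' {A : Type*} [Ring A] [Algebra ℂ A] (a : ℂ) (f g : A⟦X⟧) :
    shift a (f - g) = shift a f - shift a g := by
  simp only [← shiftHom_apply, map_sub]

theorem T_Tinv_shift (i j c d : Fin n) (a : ℂ) :
    a • (T n i j * shift (-a) (Tinv n c d) - shift (-a) (Tinv n c d) * T n i j) =
      (if c = j then ∑ l, T n i l * shift (-a) (Tinv n l d) else 0) -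
        if i = d then ∑ k, shift (-a) (Tinv n c k) * T n k j else 0 := by
  have := specialize_eq (dd_mul_T_Tinv i j c d) a
  rw [shift_sub', shift_sub', map_sub, map_sub, specialize_uv, specialize_vu] at this
  rw [this]
  split_ifs <;>
    simp only [shift_sum, map_sum, specialize_uv, specialize_vu, shift_zero_series, map_zero]

theorem T_T_shift (i j k l : Fin n) (a : ℂ) :
    a • (T n i j * shift (-a) (T n k l) - shift (-a) (T n k l) * T n i j) =
      T n k j * shift (-a) (T n i l) - shift (-a) (T n k j) * T n i l := by
  have := specialize_eq (rtt_T n i j k l) a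
  simpa only [Matrix.map_apply, shift_sub', map_sub, specialize_uv, specialize_vu] using this

/-- Sum `T_Tinv_shift` at a = n over i = d. Its last term then occurs n times and cancels n times
the reversed product, so only the trace in the definition of `zInv` survives. In matrix form, the
transposes of T(u) and T⁻¹(u − n) multiply to a scalar. -/
theorem sum_T_mul_Tinv_shift (hn : 0 < n) (j c : Fin n) :
    ∑ i, T n i j * shift (-(n : ℂ)) (Tinv n c i) = if j = c then zInv n else 0 := by
  have hn' : (n : ℂ) ≠ 0 := by exact_mod_cast hn.ne'
  have h : ∑ i, (n : ℂ) • (T n i j * shift (-(n : ℂ)) (Tinv n c i) -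
      shift (-(n : ℂ)) (Tinv n c i) * T n i j) = _ :=
    Finset.sum_congr rfl fun i _ => T_Tinv_shift i j c i n
  simp only [if_true, Finset.sum_sub_distrib, ← Finset.smul_sum, Finset.sum_const,
    Finset.card_univ, Fintype.card_fin, ← Nat.cast_smul_eq_nsmul ℂ, smul_sub] at h
  have h2 := sub_left_inj.1 h
  have h3 : ∑ i, T n i j * shift (-(n : ℂ)) (Tinv n c i) = (1 / n : ℂ) •
      ((n : ℂ) • ∑ i, T n i j * shift (-(n : ℂ)) (Tinv n c i)) := by
    rw [smul_smul, one_div, inv_mul_cancel₀ hn', one_smul]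
  rw [h3, h2, zInv, Matrix.trace]
  by_cases hc : j = c
  · subst hc
    simp [Matrix.mul_apply]
  · simp [hc, Ne.symm hc]

/-- The mirror computation, summing over j = c. The scalar is identified with `zInv` only in
`sum_Tinv_shift_mul_T_eq`, once `zInv` is known to be central. -/
theorem sum_Tinv_shift_mul_T (hn : 0 < n) : ∃ w' : (Yangian n)⟦X⟧, ∀ i d : Fin n,
    ∑ j, shift (-(n : ℂ)) (Tinv n j d) * T n i j = if i = d then w' else 0 := by
  have hn' : (n : ℂ) ≠ 0 := by exact_mod_cast hn.ne'
  refine ⟨(1 / n : ℂ) • ∑ c, ∑ k, shift (-(n : ℂ)) (Tinv n c k) * T n k c, fun i d => ?_⟩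
  have h : ∑ j, (n : ℂ) • (T n i j * shift (-(n : ℂ)) (Tinv n j d) -
      shift (-(n : ℂ)) (Tinv n j d) * T n i j) = _ :=
    Finset.sum_congr rfl fun j _ => T_Tinv_shift i j j d n
  simp only [if_true, Finset.sum_sub_distrib, ← Finset.smul_sum, Finset.sum_const,
    Finset.card_univ, Fintype.card_fin, ← Nat.cast_smul_eq_nsmul ℂ, smul_sub] at h
  have h2 := sub_right_inj.1 h
  have h3 : ∑ j, shift (-(n : ℂ)) (Tinv n j d) * T n i j = (1 / n : ℂ) •
      ((n : ℂ) • ∑ j, shift (-(n : ℂ)) (Tinv n j d) * T n i j) := by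
    rw [smul_smul, one_div, inv_mul_cancel₀ hn', one_smul]
  rw [h3, h2]
  split_ifs <;> simp

/-- `contraction_commutes` over the center of the two-variable series ring, with Z = T(u), t = T(v)
and m the transpose of T⁻¹(v − n). Here D + nE stands for u − v + n, and D² − E² = (D + E)(D − E) is
cancelled one factor at a time. -/
theorem zInv_commute (hn : 0 < n) (i j : Fin n) (r s : ℕ) :
    t i j r * coeff s (zInv n) = coeff s (zInv n) * t i j r := by
  let B := (Yangian n)⟦X⟧⟦X⟧
  let K := Subring.center B
  let D : K := ⟨dd _, Subring.mem_center_iff.2 fun x => (dd_comm x).symm⟩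
  let E : K := ⟨ee _, Subring.mem_center_iff.2 fun x => (ee_comm x).symm⟩
  have hDs : ∀ x : B, D • x = dd _ * x := fun x => rfl
  have hEs : ∀ x : B, E • x = ee _ * x := fun x => rfl
  have hn1 : ∀ x : B, (n : K) • (ee (Yangian n) * x) = (n : ℂ) • ee (Yangian n) * x := by
    intro x
    rw [Nat.cast_smul_eq_nsmul, Nat.cast_smul_eq_nsmul, smul_mul_assoc]
  have hLs : ∀ x : B, (D + n * E) • x = (dd _ + (n : ℂ) • ee _) * x := by
    intro x
    rw [add_smul, mul_smul, hDs, hEs, hn1, add_mul]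
  have h := contraction_commutes (K := K) (B := B) (n := n) (D := D) (E := E)
    (Z := fun a b => inU (T n a b)) (t := fun a b => inV (T n a b))
    (m := fun i k => inV (shift (-(n : ℂ)) (Tinv n k i))) (w := inV (zInv n))
    (fun x hx => eq_zero_of_dd_add_mul (a := 0) (by rwa [zero_smul, add_zero]))
    (fun x hx => eq_zero_of_dd_add_mul (a := n) (by rwa [← hLs]))
    (fun a b i j => rtt_T n a b i j)
    (fun a b i k => by
      have := shift_outer_eq (dd_mul_T_Tinv a b k i) n
      rw [hLs, hEs]
      simp only [shift_sub', shift_mul, shift_inU, shift_inV] at this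
      rw [this]
      congr 2
      · split_ifs <;> simp only [shift_sum, shift_mul, shift_inU, shift_inV, shift_zero_series]
      · split_ifs <;> simp only [shift_sum, shift_mul, shift_inU, shift_inV, shift_zero_series])
    (fun j k => by
      have := congrArg inV (sum_T_mul_Tinv_shift hn j k)
      simp only [map_sum, map_mul] at this
      rw [this]
      split_ifs <;> simp) i j
  have h2 : (dd _ + (1 : ℂ) • ee _) * ((dd _ + (-1 : ℂ) • ee _) *
      (inU (T n i j) * inV (zInv n) - inV (zInv n) * inU (T n i j))) = 0 := by
    rw [← h, show D ^ 2 - E ^ 2 = (D + E) * (D - E) by ring, mul_smul, add_smul, sub_smul,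
      hDs, hDs, hEs, hEs, one_smul, neg_smul, one_smul, ← sub_eq_add_neg, add_mul, sub_mul]
  have h3 := sub_eq_zero.1 (eq_zero_of_dd_add_mul (eq_zero_of_dd_add_mul h2))
  have h4 := congrArg (fun b => coeff r (coeff s b)) h3
  simpa only [coeff_uv, coeff_vu, coeff_T] using h4

/-- A series with coefficients in the center commutes with every series. -/
theorem commute_of_coeff_mem_center {A : Type*} [Ring A] [Algebra ℂ A] {f : A⟦X⟧}
    (hf : ∀ r, coeff r f ∈ Subalgebra.center ℂ A) (g : A⟦X⟧) : f * g = g * f := by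
  ext m
  rw [coeff_mul, coeff_mul, ← Finset.Nat.sum_antidiagonal_swap]
  refine Finset.sum_congr rfl fun p _ => ?_
  exact (Subalgebra.mem_center_iff.1 (hf _) _).symm

theorem coeff_mem_center_of_commute {A : Type*} [Ring A] [Algebra ℂ A] {f : A⟦X⟧}
    (hf : ∀ x : A, f * C x = C x * f) (r : ℕ) : coeff r f ∈ Subalgebra.center ℂ A := by
  rw [Subalgebra.mem_center_iff]
  intro b
  simpa using (congrArg (coeff r) (hf b)).symm

theorem mem_center_of_t {x : Yangian n} (h : ∀ i j r, t i j r * x = x * t i j r) :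
    x ∈ Subalgebra.center ℂ (Yangian n) := by
  rw [Subalgebra.mem_center_iff]
  intro b
  have := t_induction (Subalgebra.centralizer ℂ {x}) (fun i j r => by
    rw [Subalgebra.mem_centralizer_iff]
    rintro _ rfl
    exact (h i j r).symm) b
  rw [Subalgebra.mem_centralizer_iff] at this
  exact (this x rfl).symm

theorem zInv_mem_center (hn : 0 < n) (r : ℕ) :
    coeff r (zInv n) ∈ Subalgebra.center ℂ (Yangian n) :=
  mem_center_of_t fun i j s => zInv_commute hn i j s r

theorem z_mul_zInv (hn : 0 < n) : z n * zInv n = 1 := Ring.inverse_mul_cancel _ (isUnit_zInv n hn)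

theorem zInv_mul_z (hn : 0 < n) : zInv n * z n = 1 := Ring.mul_inverse_cancel _ (isUnit_zInv n hn)

theorem z_mem_center (hn : 0 < n) (r : ℕ) : coeff r (z n) ∈ Subalgebra.center ℂ (Yangian n) := by
  refine coeff_mem_center_of_commute (fun x => ?_) r
  have h := commute_of_coeff_mem_center (zInv_mem_center hn) (C x)
  calc z n * C x = z n * (C x * zInv n) * z n := by
        rw [mul_assoc, mul_assoc, zInv_mul_z hn, mul_one]
    _ = C x * z n := by rw [← h, ← mul_assoc, z_mul_zInv hn, one_mul]

theorem constantCoeff_z (hn : 0 < n) : constantCoeff (z n) = 1 := by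
  have := congrArg constantCoeff (z_mul_zInv hn)
  rwa [map_mul, constantCoeff_zInv n hn, mul_one, map_one] at this

end ZCentral

/-! ### The quantum determinant -/

/-! ### Operators on tensor legs, antisymmetrization and signs -/

section Alternating

theorem leg_mul_apply {n m : ℕ} {R : Type*} [Ring R] (a : Fin m) (M : Matrix (Fin n) (Fin n) R)
    (P : Matrix (Fin m → Fin n) (Fin m → Fin n) R) (I J : Fin m → Fin n) :
    (leg a M * P) I J = ∑ c, M (I a) c * P (Function.update I a c) J := by
  classical
  rw [Matrix.mul_apply]
  symm
  refine Finset.sum_of_injOn (fun c => Function.update I a c)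
    (fun c _ d _ h => Function.update_injective I a h) (fun _ _ => Finset.mem_coe.2 (Finset.mem_univ _)) ?_ ?_
  · intro K _ hK
    rw [leg, Matrix.of_apply, if_neg, zero_mul]
    intro h
    refine hK ⟨K a, by simp, ?_⟩
    funext b
    by_cases hb : b = a
    · subst hb; simp
    · simp [hb, h b hb]
  · intro c _
    rw [leg, Matrix.of_apply, if_pos, Function.update_self]
    intro b hb
    simp [hb]

/-- Distinct legs alter distinct entries of the multi-index, so a single path of intermediate
indices contributes. The factors stay in the order of the list because `R` need not be commutative.
-/
theorem prod_leg_apply {n m : ℕ} {R : Type*} [Ring R] (M : Fin m → Matrix (Fin n) (Fin n) R)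
    (l : List (Fin m)) (hl : l.Nodup) (I J : Fin m → Fin n) :
    (l.map fun a => leg a (M a)).prod I J =
      open Classical in
      if ∀ b, b ∉ l → I b = J b then (l.map fun a => M a (I a) (J a)).prod else 0 := by
  classical
  induction l generalizing I with
  | nil =>
    simp only [List.map_nil, List.prod_nil, Matrix.one_apply, List.not_mem_nil, not_false_eq_true,
      forall_const, funext_iff]
  | cons a l ih =>
    rw [List.nodup_cons] at hl
    rw [List.map_cons, List.prod_cons, leg_mul_apply, Finset.sum_eq_single (J a)]
    · rw [ih hl.2, List.map_cons, List.prod_cons]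
      have h1 : (∀ b, b ∉ l → Function.update I a (J a) b = J b) ↔
          ∀ b, b ∉ a :: l → I b = J b := by
        refine forall_congr' fun b => ?_
        by_cases hb : b = a
        · subst hb; simp
        · simp [hb]
      have h2 : (l.map fun b => M b (Function.update I a (J a) b) (J b)) =
          l.map fun b => M b (I b) (J b) := by
        refine List.map_congr_left fun b hb => ?_
        rw [Function.update_of_ne]
        rintro rfl
        exact hl.1 hb
      rw [h2]
      simp only [h1]
      split_ifs <;> simp
    · intro c _ hc
      rw [ih hl.2, if_neg, mul_zero]
      intro h
      have := h a hl.1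
      rw [Function.update_self] at this
      exact hc this
    · simp

theorem antisymmetrizer_mul_apply {n m : ℕ} {R : Type*} [Ring R]
    (M : Matrix (Fin m → Fin n) (Fin m → Fin n) R) (K J : Fin m → Fin n) :
    (antisymmetrizer n m R * M) K J =
      ∑ σ : Equiv.Perm (Fin m), ((Equiv.Perm.sign σ : ℤˣ) : ℤ) • M (K ∘ σ) J := by
  rw [Matrix.mul_apply]
  simp only [antisymmetrizer, Matrix.of_apply, Finset.sum_mul]
  rw [Finset.sum_comm, ← Equiv.sum_comp (Equiv.inv _)]
  refine Finset.sum_congr rfl fun σ _ => ?_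
  rw [Finset.sum_eq_single (K ∘ σ)]
  · rw [if_pos]
    · simp
    · funext a; simp
  · intro I _ hI
    rw [if_neg, zero_mul]
    rintro rfl
    apply hI
    funext a; simp
  · simp

theorem antisymmetrizer_mul_comp {n m : ℕ} {R : Type*} [Ring R]
    (M : Matrix (Fin m → Fin n) (Fin m → Fin n) R) (K J : Fin m → Fin n)
    (τ : Equiv.Perm (Fin m)) :
    (antisymmetrizer n m R * M) (K ∘ τ) J =
      ((Equiv.Perm.sign τ : ℤˣ) : ℤ) • (antisymmetrizer n m R * M) K J := by
  rw [antisymmetrizer_mul_apply, antisymmetrizer_mul_apply, ← Equiv.sum_comp (Equiv.mulLeft τ⁻¹),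
    Finset.smul_sum]
  refine Finset.sum_congr rfl fun σ _ => ?_
  rw [smul_smul]
  congr 1
  · simp
  · congr 1
    funext a; simp

/-- The sign of a map from `Fin n` to itself, zero if it is not a permutation. -/
def eps {n : ℕ} (K : Fin n → Fin n) : ℤ :=
  open Classical in
  if h : K.Bijective then ((Equiv.Perm.sign (Equiv.ofBijective K h) : ℤˣ) : ℤ) else 0

theorem eps_of_perm {n : ℕ} (σ : Equiv.Perm (Fin n)) :
    eps (σ : Fin n → Fin n) = ((Equiv.Perm.sign σ : ℤˣ) : ℤ) := by
  rw [eps, dif_pos σ.bijective]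
  congr 2
  ext; simp

theorem eps_comp {n : ℕ} (K : Fin n → Fin n) (τ : Equiv.Perm (Fin n)) :
    eps (K ∘ τ) = ((Equiv.Perm.sign τ : ℤˣ) : ℤ) * eps K := by
  by_cases h : K.Bijective
  · have : K = (Equiv.ofBijective K h : Equiv.Perm (Fin n)) := by funext a; simp
    rw [this, eps_of_perm, ← Equiv.Perm.coe_mul, eps_of_perm, Equiv.Perm.sign_mul, Units.val_mul,
      mul_comm]
  · have h2 : ¬ (K ∘ τ).Bijective := by rwa [Equiv.bijective_comp]
    rw [eps, eps, dif_neg h, dif_neg h2, mul_zero]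

/-- A bijective K is `id` composed with a permutation. Otherwise K is fixed by some transposition,
so F K = −F K, and 2 is invertible. -/
theorem alternating_eq {n : ℕ} {R : Type*} [Ring R] [Algebra ℂ R] (F : (Fin n → Fin n) → R)
    (h : ∀ K (τ : Equiv.Perm (Fin n)), F (K ∘ τ) = ((Equiv.Perm.sign τ : ℤˣ) : ℤ) • F K)
    (K : Fin n → Fin n) : F K = eps K • F id := by
  by_cases hK : K.Bijective
  · have : K = (Equiv.ofBijective K hK : Equiv.Perm (Fin n)) := by funext a; simp
    rw [this, eps_of_perm, ← h]
    rfl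
  · rw [eps, dif_neg hK, zero_smul]
    have h1 : ¬ K.Injective := fun hi => hK (Finite.injective_iff_bijective.1 hi)
    simp only [Function.Injective, not_forall] at h1
    obtain ⟨a, b, hab, hne⟩ := h1
    have h2 := h K (Equiv.swap a b)
    have h3 : K ∘ Equiv.swap a b = K := by
      funext c
      rw [Function.comp_apply, Equiv.swap_apply_def]
      split_ifs with h4 h5
      · rw [h4, hab]
      · rw [h5, hab]
      · rfl
    rw [h3, Equiv.Perm.sign_swap hne] at h2
    simp only [Units.val_neg, Units.val_one, neg_smul, one_smul] at h2
    have h4 : (2 : ℂ) • F K = 0 := by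
      rw [two_smul]; nth_rewrite 1 [h2]; exact neg_add_cancel _
    have := congrArg (fun x => (1 / 2 : ℂ) • x) h4
    simpa [smul_smul] using this

theorem alternating_of_adjacent {m : ℕ} {ι R : Type*} [Ring R] (F : (Fin m → ι) → R)
    (h : ∀ K (a b : Fin m), (a : ℕ) + 1 = b → F (K ∘ Equiv.swap a b) = - F K)
    (K) (τ : Equiv.Perm (Fin m)) : F (K ∘ τ) = ((Equiv.Perm.sign τ : ℤˣ) : ℤ) • F K := by
  rcases m with _ | m
  · have : τ = 1 := Subsingleton.elim _ _
    subst this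
    simp
  have hτ : τ ∈ Submonoid.closure
      (Set.range fun i : Fin m => Equiv.swap i.castSucc i.succ) := by
    rw [Equiv.Perm.mclosure_swap_castSucc_succ]; trivial
  induction hτ using Submonoid.closure_induction generalizing K with
  | mem x hx =>
    obtain ⟨i, rfl⟩ := hx
    have hne : i.castSucc ≠ i.succ := (Fin.castSucc_lt_succ).ne
    simp only [h K _ _ (show ((i.castSucc : Fin (m+1)) : ℕ) + 1 = i.succ by simp),
      Equiv.Perm.sign_swap hne]
    simp
  | one => simp
  | mul x y _ _ hx hy =>
    rw [Equiv.Perm.coe_mul, ← Function.comp_assoc, hy, hx, smul_smul, Equiv.Perm.sign_mul,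
      Units.val_mul, mul_comm]

/-- Isolates two neighbouring factors of an ordered product, so that a relation between them can be
applied in place. The two outer lists do not depend on F. -/
theorem prod_map_finRange_adjacent {m : ℕ} {R : Type*} [Monoid R] (a b : Fin m)
    (hab : (a : ℕ) + 1 = b) : ∃ l₁ l₂ : List (Fin m), a ∉ l₁ ∧ b ∉ l₁ ∧ a ∉ l₂ ∧ b ∉ l₂ ∧
      ∀ F : Fin m → R, ((List.finRange m).map F).prod =
        (l₁.map F).prod * (F a * F b) * (l₂.map F).prod := by
  have h1 : List.finRange m = (List.finRange m).take a ++ a :: b :: (List.finRange m).drop (b + 1) := by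
    conv_lhs => rw [← List.take_append_drop a (List.finRange m)]
    congr 1
    rw [List.drop_eq_getElem_cons (by simp), hab, List.drop_eq_getElem_cons (by simp)]
    simp
  have h2 := List.nodup_finRange m
  rw [h1] at h2
  simp only [List.nodup_append, List.nodup_cons, List.mem_cons, not_or] at h2
  refine ⟨(List.finRange m).take a, (List.finRange m).drop (b + 1), fun h => ?_, fun h => ?_, ?_,
    ?_, fun F => ?_⟩
  · exact h2.2.2 a h a (Or.inl rfl) rfl
  · exact h2.2.2 b h b (Or.inr (Or.inl rfl)) rfl
  · exact h2.2.1.1.2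
  · exact h2.2.1.2.1
  · conv_lhs => rw [h1]
    simp [mul_assoc]

end Alternating

/-! ### Existence of the quantum determinant and its column expansions -/

section QuantumDeterminant

/-- The product `t_{I 0, J 0}(u) t_{I 1, J 1}(u - 1) ⋯`. -/
def tProd {n m : ℕ} (I J : Fin m → Fin n) : (Yangian n)⟦X⟧ :=
  ((List.finRange m).map fun a : Fin m => shift (-((a : ℕ) : ℂ)) (T n (I a) (J a))).prod

theorem antisymT_apply {n m : ℕ} (K J : Fin m → Fin n) :
    antisymT n m K J =
      ∑ σ : Equiv.Perm (Fin m), ((Equiv.Perm.sign σ : ℤˣ) : ℤ) • tProd (K ∘ σ) J := by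
  rw [antisymT, antisymmetrizer_mul_apply]
  refine Finset.sum_congr rfl fun σ _ => ?_
  rw [List.ofFn_eq_map, prod_leg_apply (fun a : Fin m => (T n).map (shift (-((a : ℕ) : ℂ)))) _
    (List.nodup_finRange m), if_pos fun b hb => (hb (List.mem_finRange b)).elim]
  rfl

/-- The relation behind the antisymmetry of quantum minors in the columns. -/
theorem T_T_shift_antisymm {n : ℕ} (i j k l : Fin n) (c : ℂ) :
    shift c (T n i j) * shift (c - 1) (T n k l) - shift c (T n k j) * shift (c - 1) (T n i l) +
      (shift c (T n i l) * shift (c - 1) (T n k j) -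
        shift c (T n k l) * shift (c - 1) (T n i j)) = 0 := by
  have h1 := T_T_shift i j k l 1
  have h2 := T_T_shift i l k j 1
  rw [one_smul] at h1 h2
  have h3 : T n i j * shift (-1) (T n k l) - T n k j * shift (-1) (T n i l) +
      (T n i l * shift (-1) (T n k j) - T n k l * shift (-1) (T n i j)) = 0 := by
    linear_combination (norm := abel) h1 + h2
  have := congrArg (shift c) h3
  simpa only [shift_add, shift_sub', shift_mul, shift_shift, shift_zero_series, ← sub_eq_add_neg]
    using this

/-- Pair σ with σ(a b). The four terms of a pair share their outer factors, and the combination of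
their middle factors vanishes by `T_T_shift_antisymm`, because the arguments of neighbouring factors
differ by exactly 1. -/
theorem antisymT_comp_swap {n m : ℕ} (K J : Fin m → Fin n) (a b : Fin m) (hab : (a : ℕ) + 1 = b) :
    antisymT n m K (J ∘ Equiv.swap a b) = - antisymT n m K J := by
  have hne : a ≠ b := by rintro rfl; omega
  rw [antisymT_apply, antisymT_apply, eq_neg_iff_add_eq_zero, ← Finset.sum_add_distrib]
  refine Finset.sum_involution (fun σ _ => σ * Equiv.swap a b) (fun σ _ => ?_) (fun σ _ _ h => ?_)
    (fun _ _ => Finset.mem_univ _) fun σ _ => by simp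
  · obtain ⟨l₁, l₂, h1, h2, h3, h4, hl⟩ :=
      prod_map_finRange_adjacent (R := (Yangian n)⟦X⟧) a b hab
    obtain ⟨P, hP⟩ : ∃ P : List (Fin m) → (Fin m → Fin n) → (Fin m → Fin n) → (Yangian n)⟦X⟧,
      P = fun l I J => (l.map fun x : Fin m => shift (-((x : ℕ) : ℂ)) (T n (I x) (J x))).prod :=
      ⟨_, rfl⟩
    have hs : ∀ (I J : Fin m → Fin n) (l : List (Fin m)), a ∉ l → b ∉ l →
        P l (I ∘ Equiv.swap a b) J = P l I J := by
      intro I J l ha hb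
      rw [hP]
      refine congrArg List.prod (List.map_congr_left fun x hx => ?_)
      rw [Function.comp_apply, Equiv.swap_apply_of_ne_of_ne] <;> rintro rfl <;> contradiction
    have hs' : ∀ (I J : Fin m → Fin n) (l : List (Fin m)), a ∉ l → b ∉ l →
        P l I (J ∘ Equiv.swap a b) = P l I J := by
      intro I J l ha hb
      rw [hP]
      refine congrArg List.prod (List.map_congr_left fun x hx => ?_)
      rw [Function.comp_apply, Equiv.swap_apply_of_ne_of_ne] <;> rintro rfl <;> contradiction
    have hsign : ((Equiv.Perm.sign (σ * Equiv.swap a b) : ℤˣ) : ℤ) =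
        -((Equiv.Perm.sign σ : ℤˣ) : ℤ) := by
      rw [Equiv.Perm.sign_mul, Equiv.Perm.sign_swap hne]; simp
    have hb : (-((b : ℕ) : ℂ)) = -((a : ℕ) : ℂ) - 1 := by
      rw [← hab]; push_cast; ring
    have hT : ∀ I J : Fin m → Fin n, tProd I J = P l₁ I J * (shift (-((a : ℕ) : ℂ))
        (T n (I a) (J a)) * shift (-((a : ℕ) : ℂ) - 1) (T n (I b) (J b))) * P l₂ I J := by
      intro I J
      rw [tProd, hl, hb, hP]
    rw [hsign, Equiv.Perm.coe_mul, ← Function.comp_assoc]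
    generalize K ∘ σ = I
    rw [hT I, hT I, hT (I ∘ _), hT (I ∘ _), hs _ _ _ h1 h2, hs _ _ _ h1 h2, hs _ _ _ h3 h4,
      hs _ _ _ h3 h4, hs' _ _ _ h1 h2, hs' _ _ _ h3 h4]
    simp only [Function.comp_apply, Equiv.swap_apply_left, Equiv.swap_apply_right]
    have := congrArg (fun x => ((Equiv.Perm.sign σ : ℤˣ) : ℤ) • (P l₁ I J * x * P l₂ I J))
      (T_T_shift_antisymm (I a) (J a) (I b) (J b) (-((a : ℕ) : ℂ)))
    simp only [mul_zero, zero_mul, smul_zero, mul_add, add_mul, mul_sub, sub_mul, smul_add,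
      smul_sub] at this
    rw [← this]
    simp only [neg_smul]
    abel
  · have := congrArg Equiv.Perm.sign h
    rw [Equiv.Perm.sign_mul, Equiv.Perm.sign_swap hne] at this
    simp at this

/-- Rows alternate because of the antisymmetrizer, columns because of the RTT relation. Hence the
entry at (`id`, `id`) determines the operator, which gives existence of the quantum determinant. -/
theorem antisymT_eq {n : ℕ} (K J : Fin n → Fin n) :
    antisymT n n K J = eps K • eps J • qdet n := by
  rw [alternating_eq (fun K => antisymT n n K J)
    (fun K τ => antisymmetrizer_mul_comp _ K J τ) K,
    alternating_eq (fun J => antisymT n n id J)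
    (fun J τ => alternating_of_adjacent _ (fun J a b hab => antisymT_comp_swap _ J a b hab) J τ) J]
  rfl

theorem antisymmetrizer_eq {n : ℕ} {R : Type*} [Ring R] [Algebra ℂ R] (K J : Fin n → Fin n) :
    antisymmetrizer n n R K J = eps K • eps J • (1 : R) := by
  have h1 : ∀ K J, antisymmetrizer n n R K J = (antisymmetrizer n n R *
      (1 : Matrix (Fin n → Fin n) (Fin n → Fin n) R)) K J := by
    intro K J; rw [mul_one]
  have h2 : antisymmetrizer n n R id id = 1 := by
    simp only [antisymmetrizer, Matrix.of_apply]
    rw [Finset.sum_eq_single 1]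
    · simp
    · intro σ _ hσ
      rw [if_neg]
      intro hh
      apply hσ
      ext i
      simpa using congrArg Fin.val (congrFun hh i).symm
    · simp
  have hr : ∀ J K (τ : Equiv.Perm (Fin n)), antisymmetrizer n n R (K ∘ τ) J =
      ((Equiv.Perm.sign τ : ℤˣ) : ℤ) • antisymmetrizer n n R K J := by
    intro J K τ
    rw [h1, h1, antisymmetrizer_mul_comp]
  have hc : ∀ K J (τ : Equiv.Perm (Fin n)), antisymmetrizer n n R K (J ∘ τ) =
      ((Equiv.Perm.sign τ : ℤˣ) : ℤ) • antisymmetrizer n n R K J := by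
    intro K J τ
    simp only [antisymmetrizer, Matrix.of_apply]
    rw [← Equiv.sum_comp (Equiv.mulLeft τ⁻¹), Finset.smul_sum]
    refine Finset.sum_congr rfl fun σ _ => ?_
    have : (J ∘ τ) ∘ (Equiv.mulLeft τ⁻¹ σ : Equiv.Perm (Fin n)) = J ∘ σ := by
      funext a; simp
    rw [this]
    split_ifs <;> simp
  rw [← h2, alternating_eq (fun K => antisymmetrizer n n R K J) (hr J) K,
    alternating_eq (fun J => antisymmetrizer n n R id J) (hc id) J]

theorem isQuantumDeterminant_qdet (n : ℕ) : IsQuantumDeterminant n (qdet n) := by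
  rw [IsQuantumDeterminant]
  ext1 K J
  rw [antisymT_eq, Matrix.mul_diagonal, antisymmetrizer_eq]
  simp only [smul_mul_assoc, one_mul]

theorem qdet_eq_sum (n : ℕ) : qdet n =
    ∑ σ : Equiv.Perm (Fin n), ((Equiv.Perm.sign σ : ℤˣ) : ℤ) • tProd (σ : Fin n → Fin n) id := by
  rw [qdet, antisymT_apply]
  rfl

theorem sum_tProd {n : ℕ} (J : Fin n → Fin n) :
    ∑ σ : Equiv.Perm (Fin n), ((Equiv.Perm.sign σ : ℤˣ) : ℤ) • tProd (σ : Fin n → Fin n) J =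
      eps J • qdet n := by
  have h1 : eps (id : Fin n → Fin n) = 1 := by
    have := eps_of_perm (1 : Equiv.Perm (Fin n))
    simpa using this
  rw [← one_smul ℤ (eps J • qdet n), ← h1, ← antisymT_eq, antisymT_apply]
  rfl

theorem constantCoeff_tProd {n m : ℕ} (I J : Fin m → Fin n) :
    constantCoeff (tProd I J) = if I = J then 1 else 0 := by
  have h : constantCoeff (tProd I J) =
      ((List.finRange m).map fun a => if I a = J a then (1 : Yangian n) else 0).prod := by
    rw [tProd, map_list_prod, List.map_map]
    congr 1
    refine List.map_congr_left fun a _ => ?_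
    rw [Function.comp_apply, constantCoeff_shift, ← coeff_zero_eq_constantCoeff_apply, coeff_T,
      t_zero]
  rw [h]
  split_ifs with hIJ
  · subst hIJ; simp
  · obtain ⟨a, ha⟩ := Function.ne_iff.1 hIJ
    exact List.prod_eq_zero (List.mem_map.2 ⟨a, List.mem_finRange a, if_neg ha⟩)

theorem constantCoeff_qdet (n : ℕ) : constantCoeff (qdet n) = 1 := by
  rw [qdet_eq_sum, map_sum, Finset.sum_eq_single 1]
  · simp [constantCoeff_tProd]
  · intro σ _ hσ
    rw [map_zsmul, constantCoeff_tProd, if_neg, smul_zero]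
    intro h
    exact hσ (Equiv.ext (congrFun h))
  · simp

theorem tProd_snoc {n m : ℕ} (I : Fin (m + 1) → Fin n) (J : Fin m → Fin n) (c : Fin n) :
    tProd I (Fin.snoc J c : Fin (m + 1) → Fin n) =
      tProd (I ∘ Fin.castSucc) J * shift (-(m : ℂ)) (T n (I (Fin.last m)) c) := by
  rw [tProd, List.finRange_succ_last, List.map_append, List.prod_append, List.map_map]
  simp [tProd, Function.comp_def]

theorem tProd_cons {n m : ℕ} (I : Fin (m + 1) → Fin n) (J : Fin m → Fin n) (c : Fin n) :
    tProd I (Fin.cons c J : Fin (m + 1) → Fin n) =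
      T n (I 0) c * shift (-1) (tProd (I ∘ Fin.succ) J) := by
  rw [tProd, List.finRange_succ, List.map_cons, List.prod_cons, List.map_map, tProd,
    ← shiftHom_apply (-1), map_list_prod, List.map_map]
  congr 1
  · simp [shift_zero]
  · congr 1
    refine List.map_congr_left fun a _ => ?_
    simp [shiftHom_apply, shift_shift]

theorem finRotate_castSucc {m : ℕ} (i : Fin m) : finRotate (m + 1) i.castSucc = i.succ := by
  ext
  rw [coe_finRotate_of_ne_last (Fin.castSucc_lt_last i).ne]
  simp

theorem perm_inv_apply_self {ι : Type*} (σ : Equiv.Perm ι) (x : ι) : σ⁻¹ (σ x) = x := by simp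

theorem cons_eq_snoc_comp {m : ℕ} {ι : Type*} (J : Fin m → ι) (c : ι) :
    (Fin.cons c J : Fin (m + 1) → ι) = (Fin.snoc J c : Fin (m + 1) → ι) ∘
      ((finRotate (m + 1))⁻¹ : Equiv.Perm (Fin (m + 1))) := by
  funext i
  obtain ⟨j, rfl⟩ := (finRotate (m + 1)).surjective i
  rw [Function.comp_apply, perm_inv_apply_self]
  induction j using Fin.lastCases with
  | last => rw [finRotate_last, Fin.cons_zero, Fin.snoc_last]
  | cast j =>
    rw [Fin.snoc_castSucc, finRotate_castSucc, Fin.cons_succ]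

/-- The cofactors μ_i for the columns other than k appear in the expansion along the last column,
where they are solved for with T⁻¹, and, with argument u − 1, in the expansion along the first
column. Eliminating them gives the identity without any commutation of qdet T(u) with other
elements. -/
theorem sum_T_qdet_Tinv {m : ℕ} (j k : Fin (m + 1)) :
    ∑ i, T (m + 1) i j * (shift (-1) (qdet (m + 1)) *
      shift (-((m + 1 : ℕ) : ℂ)) (Tinv (m + 1) k i)) = if j = k then qdet (m + 1) else 0 := by
  -- the map from `Fin m` that omits the value `k`
  set J : Fin m → Fin (m + 1) := k.succAbove with hJ
  set s : ℤ := ((Equiv.Perm.sign (finRotate (m + 1))⁻¹ : ℤˣ) : ℤ) with hs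
  have heps : ∀ c, eps (Fin.cons c J : Fin (m + 1) → Fin (m + 1)) =
      s * eps (Fin.snoc J c : Fin (m + 1) → Fin (m + 1)) := by
    intro c
    rw [cons_eq_snoc_comp, eps_comp]
  have heps0 : ∀ c, c ≠ k → eps (Fin.cons c J : Fin (m + 1) → Fin (m + 1)) = 0 := by
    intro c hc
    rw [eps, dif_neg]
    intro hb
    obtain ⟨x, hx⟩ := Fin.exists_succAbove_eq hc
    have : (Fin.cons c J : Fin (m + 1) → Fin (m + 1)) 0 = (Fin.cons c J : Fin (m + 1) → Fin (m + 1)) x.succ := by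
      rw [Fin.cons_zero, Fin.cons_succ, hJ, hx]
    exact (Fin.succ_ne_zero x) (hb.1 this).symm
  have hepsk : eps (Fin.cons k J : Fin (m + 1) → Fin (m + 1)) * eps (Fin.cons k J : Fin (m + 1) → Fin (m + 1)) = 1 := by
    have hb : (Fin.cons k J : Fin (m + 1) → Fin (m + 1)).Bijective := by
      rw [← Finite.injective_iff_bijective, Fin.cons_injective_iff]
      exact ⟨by simp [hJ], Fin.succAbove_right_injective⟩
    rw [eps, dif_pos hb, ← Units.val_mul, Int.units_mul_self, Units.val_one]
  set μ : Fin (m + 1) → (Yangian (m + 1))⟦X⟧ := fun i => ∑ σ : Equiv.Perm (Fin (m + 1)),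
    if σ (Fin.last m) = i then ((Equiv.Perm.sign σ : ℤˣ) : ℤ) • tProd (σ ∘ Fin.castSucc) J else 0
    with hμ
  -- Expansion along the last column reads ∑_a μ_a(u) t_ac(u − m) = ± qdet T(u), or 0 if c ≠ k.
  -- Multiplication by T⁻¹(u − m) on the right isolates μ_i.
  have eq1 : ∀ i, μ i = ∑ c, eps (Fin.snoc J c : Fin (m + 1) → Fin (m + 1)) •
      (qdet (m + 1) * shift (-(m : ℂ)) (Tinv (m + 1) c i)) := by
    intro i
    have h1 : ∀ a : Fin (m + 1), ∑ c, shift (-(m : ℂ)) (T (m + 1) a c) * shift (-(m : ℂ)) (Tinv (m + 1) c i) =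
        if a = i then 1 else 0 := by
      intro a
      have := congrArg (shift (-(m : ℂ))) (congrFun (congrFun (T_mul_Tinv (m + 1)) a) i)
      rw [Matrix.mul_apply, shift_sum, Matrix.one_apply] at this
      simp only [shift_mul] at this
      rw [this]
      split_ifs
      · exact shift_one _
      · exact shift_zero_series _
    simp only [← smul_mul_assoc, ← sum_tProd, tProd_snoc, Finset.sum_mul]
    simp only [hμ]
    rw [Finset.sum_comm]
    refine Finset.sum_congr rfl fun σ _ => ?_
    simp only [smul_mul_assoc, mul_assoc, ← Finset.smul_sum, ← Finset.mul_sum, h1]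
    split_ifs <;> simp
  -- Expansion along the first column. Reindexing by the rotation moves the omitted row σ(last) to
  -- the front and accounts for the sign s.
  have eq2 : eps (Fin.cons j J : Fin (m + 1) → Fin (m + 1)) • qdet (m + 1) =
      s • ∑ i, T (m + 1) i j * shift (-1) (μ i) := by
    rw [← sum_tProd, ← Equiv.sum_comp (Equiv.mulRight (finRotate (m + 1))⁻¹), Finset.smul_sum]
    simp only [hμ, shift_sum, Finset.mul_sum, Finset.smul_sum]
    rw [Finset.sum_comm]
    refine Finset.sum_congr rfl fun σ _ => ?_
    rw [Finset.sum_eq_single (σ (Fin.last m)), if_pos rfl, tProd_cons, Equiv.coe_mulRight,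
      Equiv.Perm.sign_mul, Units.val_mul, ← hs, mul_comm, mul_smul]
    · have h1 : (σ * (finRotate (m + 1))⁻¹ : Equiv.Perm (Fin (m + 1))) 0 = σ (Fin.last m) := by
        rw [Equiv.Perm.mul_apply, ← finRotate_last, perm_inv_apply_self]
      have h2 : (σ * (finRotate (m + 1))⁻¹ : Equiv.Perm (Fin (m + 1))) ∘ Fin.succ = σ ∘ Fin.castSucc := by
        funext a
        rw [Function.comp_apply, Function.comp_apply, Equiv.Perm.mul_apply,
          ← finRotate_castSucc, perm_inv_apply_self]
      rw [h1, h2]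
      congr 1
      rw [← shiftHom_apply, ← shiftHom_apply, map_zsmul, mul_smul_comm]
    · intro b _ hb
      rw [if_neg hb.symm, shift_zero_series, mul_zero, smul_zero]
    · simp
  have eq3 : ∀ i, s • shift (-1) (μ i) = eps (Fin.cons k J : Fin (m + 1) → Fin (m + 1)) •
      (shift (-1) (qdet (m + 1)) * shift (-((m + 1 : ℕ) : ℂ)) (Tinv (m + 1) k i)) := by
    intro i
    rw [eq1, shift_sum, Finset.smul_sum, Finset.sum_eq_single k]
    · rw [← shiftHom_apply, map_zsmul, map_mul, smul_smul, ← heps, shiftHom_apply, shiftHom_apply,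
        shift_shift]
      congr 4
      push_cast; ring
    · intro c _ hc
      rw [← shiftHom_apply, map_zsmul, smul_smul, ← heps, heps0 c hc, zero_smul]
    · simp
  have eq4 : eps (Fin.cons j J : Fin (m + 1) → Fin (m + 1)) • qdet (m + 1) = eps (Fin.cons k J : Fin (m + 1) → Fin (m + 1)) •
      ∑ i, T (m + 1) i j * (shift (-1) (qdet (m + 1)) * shift (-((m + 1 : ℕ) : ℂ)) (Tinv (m + 1) k i)) := by
    rw [eq2, Finset.smul_sum, Finset.smul_sum]
    refine Finset.sum_congr rfl fun i _ => ?_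
    rw [← mul_smul_comm, eq3, mul_smul_comm]
  have eq5 := congrArg (fun x => eps (Fin.cons k J : Fin (m + 1) → Fin (m + 1)) • x) eq4
  simp only [smul_smul, hepsk, one_smul] at eq5
  rw [← eq5]
  split_ifs with hjk
  · rw [hjk, hepsk, one_smul]
  · rw [heps0 j hjk, mul_zero, zero_smul]

end QuantumDeterminant

/-! ### The quantum Liouville formula -/

section Liouville

variable {n : ℕ}

theorem isUnit_T_diag (i : Fin n) : IsUnit (T n i i) := by
  rw [PowerSeries.isUnit_iff_constantCoeff]
  have := congrFun (congrFun (T_map_constantCoeff n) i) i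
  rw [Matrix.map_apply, Matrix.one_apply_eq] at this
  rw [this]
  exact isUnit_one

/-- Associativity in ∑ t_ij(u) t⁻¹_ki(u − n) t_jk(u) gives z⁻¹ t_jj = t_jj w'. Since z⁻¹ is central
and t_jj(u) is invertible, the two scalars agree. -/
theorem sum_Tinv_shift_mul_T_eq (hn : 0 < n) (l i : Fin n) :
    ∑ k, shift (-(n : ℂ)) (Tinv n k i) * T n l k = if l = i then zInv n else 0 := by
  obtain ⟨w', hw'⟩ := sum_Tinv_shift_mul_T hn
  have h1 : ∀ j, zInv n * T n j j = T n j j * w' := by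
    intro j
    have e1 : ∑ k, (∑ i, T n i j * shift (-(n : ℂ)) (Tinv n k i)) * T n j k =
        zInv n * T n j j := by
      simp only [sum_T_mul_Tinv_shift hn]
      simp
    have e2 : ∑ k, (∑ i, T n i j * shift (-(n : ℂ)) (Tinv n k i)) * T n j k =
        T n j j * w' := by
      simp only [Finset.sum_mul]
      rw [Finset.sum_comm]
      simp only [mul_assoc, ← Finset.mul_sum, hw']
      simp
    rw [← e1, e2]
  have h2 : w' = zInv n := by
    have := h1 ⟨0, hn⟩
    rw [commute_of_coeff_mem_center (zInv_mem_center hn)] at this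
    exact ((isUnit_T_diag _).mul_left_cancel this).symm
  rw [hw', h2]

/-- Contract `sum_T_qdet_Tinv` on the right with t_lk(u) over k; by `sum_Tinv_shift_mul_T_eq` this
replaces T⁻¹(u − n) by z⁻¹. The order of the factors matters, since qdet T(u) is not yet known to be
central. -/
theorem T_mul_shift_qdet (hn : 0 < n) (l j : Fin n) :
    T n l j * shift (-1) (qdet n) = qdet n * z n * T n l j := by
  obtain ⟨m, rfl⟩ : ∃ m, n = m + 1 := ⟨n - 1, by omega⟩
  have e1 : ∑ k, (∑ i, T (m + 1) i j * (shift (-1) (qdet (m + 1)) *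
      shift (-((m + 1 : ℕ) : ℂ)) (Tinv (m + 1) k i))) * T (m + 1) l k =
      qdet (m + 1) * T (m + 1) l j := by
    simp only [sum_T_qdet_Tinv]
    simp
  have e2 : ∑ k, (∑ i, T (m + 1) i j * (shift (-1) (qdet (m + 1)) *
      shift (-((m + 1 : ℕ) : ℂ)) (Tinv (m + 1) k i))) * T (m + 1) l k =
      T (m + 1) l j * shift (-1) (qdet (m + 1)) * zInv (m + 1) := by
    simp only [Finset.sum_mul]
    rw [Finset.sum_comm]
    simp only [mul_assoc, ← Finset.mul_sum, sum_Tinv_shift_mul_T_eq hn]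
    simp
  have hz := commute_of_coeff_mem_center (z_mem_center hn) (T (m + 1) l j)
  rw [mul_assoc, hz, ← mul_assoc, ← e1, e2, mul_assoc _ (zInv _), zInv_mul_z hn, mul_one]

/-- The elements t_ij⁽¹⁾ act on T(u) by the adjoint action of gl_n, in which the identity matrix
acts by zero. -/
theorem sum_t_one_mem_center : ∑ i : Fin n, t i i 1 ∈ Subalgebra.center ℂ (Yangian n) := by
  refine mem_center_of_t fun k l s => ?_
  have h : ∀ i : Fin n, t i i 1 * t k l s - t k l s * t i i 1 =
      (if k = i then t i l s else 0) - if i = l then t k i s else 0 := by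
    intro i
    have := t_rel i i k l 0 s
    simp only [t_zero, zero_add] at this
    simp only [if_true, one_mul, mul_one, sub_self, sub_zero] at this
    rw [this]
    split_ifs <;> simp
  have h2 := Finset.sum_congr (rfl : Finset.univ = Finset.univ) fun i _ => h i
  rw [Finset.sum_sub_distrib, Finset.sum_sub_distrib, ← Finset.sum_mul, ← Finset.mul_sum] at h2
  simp only [Finset.sum_ite_eq, Finset.sum_ite_eq', Finset.mem_univ, if_true, sub_self] at h2
  exact (sub_eq_zero.1 h2).symm

/-- The defect of the Liouville formula, as long as the leading coefficients are central. -/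
theorem liouville_defect (hn : 0 < n) {r : ℕ}
    (hr : ∀ q < r, coeff q (qdet n) ∈ Subalgebra.center ℂ (Yangian n)) :
    (∀ m ≤ r, coeff m (shift (-1) (qdet n) - qdet n * z n) = 0) ∧
      ∀ i : Fin n, coeff (r + 1) (shift (-1) (qdet n) - qdet n * z n) =
        coeff r (shift (-1) (qdet n)) * t i i 1 - t i i 1 * coeff r (shift (-1) (qdet n)) := by
  set e := shift (-1) (qdet n) with he
  have hZ : ∀ q < r, coeff q e ∈ Subalgebra.center ℂ (Yangian n) := by
    intro q hq
    rw [he, coeff_shift]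
    refine Subalgebra.sum_mem _ fun s hs => Subalgebra.smul_mem _ (hr s ?_) _
    rw [Finset.mem_range] at hs
    omega
  -- On the diagonal `T_mul_shift_qdet` reads t_ii e = qdet z t_ii; dividing by the invertible t_ii
  -- turns the defect into a commutator.
  have key : ∀ i : Fin n, ∃ y, constantCoeff y = 1 ∧
      e - qdet n * z n = (e * T n i i - T n i i * e) * y := by
    intro i
    refine ⟨Ring.inverse (T n i i), ?_, ?_⟩
    · have := congrArg constantCoeff (Ring.mul_inverse_cancel _ (isUnit_T_diag i))
      have h2 := congrFun (congrFun (T_map_constantCoeff n) i) i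
      rw [Matrix.map_apply, Matrix.one_apply_eq] at h2
      rwa [map_mul, h2, one_mul, map_one] at this
    · rw [T_mul_shift_qdet hn, ← sub_mul, mul_assoc, Ring.mul_inverse_cancel _ (isUnit_T_diag i),
        mul_one]
  have hg : ∀ (i : Fin n) (m : ℕ), coeff m (e * T n i i - T n i i * e) =
      ∑ p ∈ Finset.HasAntidiagonal.antidiagonal m,
        (coeff p.1 e * t i i p.2 - t i i p.2 * coeff p.1 e) := by
    intro i m
    rw [map_sub, coeff_mul, coeff_mul, ← Finset.Nat.sum_antidiagonal_swap,
      ← Finset.sum_sub_distrib]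
    simp only [coeff_T, Prod.fst_swap, Prod.snd_swap]
    rw [← Finset.Nat.sum_antidiagonal_swap]
    simp
  have hzero : ∀ (i : Fin n) (p : ℕ × ℕ), p.1 < r ∨ p.2 = 0 →
      coeff p.1 e * t i i p.2 - t i i p.2 * coeff p.1 e = 0 := by
    rintro i ⟨p, q⟩ (h | h)
    · rw [Subalgebra.mem_center_iff.1 (hZ p h), sub_self]
    · simp only at h
      rw [h, t_zero]; simp
  have hg0 : ∀ (i : Fin n) (m : ℕ), m ≤ r → coeff m (e * T n i i - T n i i * e) = 0 := by
    intro i m hm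
    rw [hg]
    refine Finset.sum_eq_zero fun p hp => hzero i p ?_
    rw [Finset.HasAntidiagonal.mem_antidiagonal] at hp
    omega
  constructor
  · intro m hm
    obtain ⟨y, _, h⟩ := key ⟨0, hn⟩
    rw [h, coeff_mul]
    refine Finset.sum_eq_zero fun p hp => ?_
    rw [Finset.HasAntidiagonal.mem_antidiagonal] at hp
    rw [hg0 _ _ (by omega), zero_mul]
  · intro i
    obtain ⟨y, hy, h⟩ := key i
    rw [h, coeff_mul, Finset.sum_eq_single (r + 1, 0)]
    · rw [coeff_zero_eq_constantCoeff_apply, hy, mul_one, hg, Finset.sum_eq_single (r, 1)]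
      · intro p hp hne
        rw [Finset.HasAntidiagonal.mem_antidiagonal] at hp
        refine hzero i p ?_
        by_contra hcon
        exact hne (Prod.ext (by simp only; omega) (by simp only; omega))
      · simp
    · intro p hp hne
      rw [Finset.HasAntidiagonal.mem_antidiagonal] at hp
      rw [hg0 _ _, zero_mul]
      by_contra hcon
      exact hne (Prod.ext (by simp only; omega) (by simp only; omega))
    · simp

/-- In degree 1 the defect vanishes because the constant coefficient of qdet is 1, and a shift does
not change the coefficient of u⁻¹. -/
theorem coeff_one_z (hn : 0 < n) : coeff 1 (z n) = 0 := by
  have h := (liouville_defect hn (r := 1) (fun q hq => by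
    have : q = 0 := by omega
    rw [this, coeff_zero_eq_constantCoeff_apply, constantCoeff_qdet]
    exact one_mem _)).1 1 le_rfl
  rw [map_sub, coeff_one_shift, coeff_mul, Finset.Nat.sum_antidiagonal_succ] at h
  simpa [constantCoeff_qdet, constantCoeff_z hn] using h

theorem coeff_succ_qdet_mul_z (hn : 0 < n) (r : ℕ) : coeff (r + 1) (qdet n * z n) =
    coeff (r + 1) (qdet n) +
      ∑ p ∈ Finset.range r, coeff p (qdet n) * coeff (r + 1 - p) (z n) := by
  rw [coeff_mul, Finset.Nat.sum_antidiagonal_eq_sum_range_succ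
    (fun p q => coeff p (qdet n) * coeff q (z n)), Finset.sum_range_succ, Finset.sum_range_succ]
  simp [constantCoeff_z hn, coeff_one_z hn, add_comm]

/-- In degree r + 1 the coefficient d_{r+1} cancels, and d_r remains only on the left, with factor
r, because z has no u⁻¹ term. The subalgebra is arbitrary so that the recursion serves both for the
center and for the algebra generated by the coefficients of z. -/
theorem coeff_qdet_mem (hn : 0 < n) (S : Subalgebra ℂ (Yangian n)) (hz : ∀ r, coeff r (z n) ∈ S)
    {r : ℕ} (hr : 0 < r) (ih : ∀ q < r, coeff q (qdet n) ∈ S)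
    (h : coeff (r + 1) (shift (-1) (qdet n)) = coeff (r + 1) (qdet n * z n)) :
    coeff r (qdet n) ∈ S := by
  rw [coeff_shift_succ, coeff_succ_qdet_mul_z hn, add_comm (coeff (r + 1) (qdet n)),
    add_left_inj] at h
  have h5 : (r : ℂ) • coeff r (qdet n) =
      ∑ p ∈ Finset.range r, coeff p (qdet n) * coeff (r + 1 - p) (z n) -
      ∑ q ∈ Finset.range r, coeff (r + 1) (invShift (-1) ^ q) • coeff q (qdet n) := by
    rw [← h]
    simp
  have h6 : coeff r (qdet n) = (r : ℂ)⁻¹ • ((r : ℂ) • coeff r (qdet n)) := by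
    rw [smul_smul, inv_mul_cancel₀ (by exact_mod_cast hr.ne'), one_smul]
  rw [h6, h5]
  exact S.smul_mem (sub_mem
    (S.sum_mem fun p hp => mul_mem (ih p (Finset.mem_range.1 hp)) (hz _))
    (S.sum_mem fun p hp => S.smul_mem (ih p (Finset.mem_range.1 hp)) _)) _

/-- Under the induction hypothesis the defect in degree r + 1 is a commutator with t_ii⁽¹⁾ whatever
i is. Hence n times the defect is a commutator with the central element ∑ t_ii⁽¹⁾, and
`coeff_qdet_mem` applies. -/
theorem qdet_mem_center (hn : 0 < n) (r : ℕ) :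
    coeff r (qdet n) ∈ Subalgebra.center ℂ (Yangian n) := by
  induction r using Nat.strong_induction_on with
  | _ r ih =>
    rcases Nat.eq_zero_or_pos r with rfl | hr
    · rw [coeff_zero_eq_constantCoeff_apply, constantCoeff_qdet]
      exact one_mem _
    have h1 := (liouville_defect hn ih).2
    have hn' : (n : ℂ) ≠ 0 := by exact_mod_cast hn.ne'
    have h2 : coeff (r + 1) (shift (-1) (qdet n) - qdet n * z n) = 0 := by
      have h3 : (n : ℂ) • coeff (r + 1) (shift (-1) (qdet n) - qdet n * z n) = 0 := by
        have h4 := Finset.sum_congr (rfl : (Finset.univ : Finset (Fin n)) = Finset.univ)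
          fun i _ => h1 i
        rw [Finset.sum_const, Finset.card_univ, Fintype.card_fin, Finset.sum_sub_distrib,
          ← Finset.mul_sum, ← Finset.sum_mul,
          Subalgebra.mem_center_iff.1 sum_t_one_mem_center, sub_self] at h4
        rwa [Nat.cast_smul_eq_nsmul]
      have := congrArg (fun x => (n : ℂ)⁻¹ • x) h3
      simpa [smul_smul, inv_mul_cancel₀ hn'] using this
    rw [map_sub, sub_eq_zero] at h2
    exact coeff_qdet_mem hn _ (z_mem_center hn) hr ih h2

theorem shift_qdet (hn : 0 < n) : shift (-1) (qdet n) = qdet n * z n := by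
  rw [← sub_eq_zero]
  ext m
  rw [(liouville_defect hn (r := m) fun q _ => qdet_mem_center hn q).1 m le_rfl, map_zero]

theorem isUnit_qdet (n : ℕ) : IsUnit (qdet n) := by
  rw [PowerSeries.isUnit_iff_constantCoeff, constantCoeff_qdet]
  exact isUnit_one

theorem z_eq_inverse_mul (hn : 0 < n) : z n = Ring.inverse (qdet n) * shift (-1) (qdet n) := by
  rw [shift_qdet hn, ← mul_assoc, Ring.inverse_mul_cancel _ (isUnit_qdet n), one_mul]

theorem z_eq_mul_inverse (hn : 0 < n) : z n = shift (-1) (qdet n) * Ring.inverse (qdet n) := by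
  rw [shift_qdet hn, ← commute_of_coeff_mem_center (z_mem_center hn), mul_assoc,
    Ring.mul_inverse_cancel _ (isUnit_qdet n), mul_one]

/-- The coefficients of the quantum determinant are polynomials in `z₂, z₃, …`. -/
theorem qdet_mem_adjoin (hn : 0 < n) (r : ℕ) : coeff r (qdet n) ∈
    Algebra.adjoin ℂ (Set.range fun r => coeff (r + 2) (z n)) := by
  induction r using Nat.strong_induction_on with
  | _ r ih =>
    rcases Nat.eq_zero_or_pos r with rfl | hr
    · rw [coeff_zero_eq_constantCoeff_apply, constantCoeff_qdet]
      exact one_mem _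
    refine coeff_qdet_mem hn _ (fun q => ?_) hr ih (congrArg (coeff (r + 1)) (shift_qdet hn))
    rcases q with _ | _ | q
    · rw [coeff_zero_eq_constantCoeff_apply, constantCoeff_z hn]
      exact one_mem _
    · rw [zero_add, coeff_one_z hn]
      exact zero_mem _
    · exact Algebra.subset_adjoin ⟨q, rfl⟩

end Liouville

/-! ### The filtration of the Yangian by weight -/

section Filtration

variable {n : ℕ}

/-- The generator `t_{ij}^{(r+1)}`. -/
def gen (g : Fin n × Fin n × ℕ) : Yangian n := t g.1 g.2.1 (g.2.2 + 1)

/-- The weight `2r + 1` of `t_{ij}^{(r+1)}`. With these weights the leading part of a commutator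
is the bracket of the polynomial current algebra. -/
def wt (g : Fin n × Fin n × ℕ) : ℕ := 2 * g.2.2 + 1

/-- The weight of a word. -/
def wtL (L : List (Fin n × Fin n × ℕ)) : ℕ := (L.map wt).sum

/-- The product of generators along a word. -/
def prodL (L : List (Fin n × Fin n × ℕ)) : Yangian n := (L.map gen).prod

/-- The span of the words of weight less than `w`. -/
def Flt (n w : ℕ) : Submodule ℂ (Yangian n) :=
  Submodule.span ℂ {x | ∃ L : List (Fin n × Fin n × ℕ), wtL L < w ∧ prodL L = x}

@[simp] theorem wtL_nil : wtL ([] : List (Fin n × Fin n × ℕ)) = 0 := rfl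

@[simp] theorem wtL_cons (a : Fin n × Fin n × ℕ) (L) : wtL (a :: L) = wt a + wtL L := by simp [wtL]

theorem wtL_append (L L' : List (Fin n × Fin n × ℕ)) : wtL (L ++ L') = wtL L + wtL L' := by
  simp [wtL]

@[simp] theorem prodL_nil : prodL ([] : List (Fin n × Fin n × ℕ)) = 1 := rfl

@[simp] theorem prodL_cons (a : Fin n × Fin n × ℕ) (L) : prodL (a :: L) = gen a * prodL L := by
  simp [prodL]

theorem prodL_append (L L' : List (Fin n × Fin n × ℕ)) : prodL (L ++ L') = prodL L * prodL L' := by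
  simp [prodL]

theorem prodL_mem {L : List (Fin n × Fin n × ℕ)} {w : ℕ} (h : wtL L < w) : prodL L ∈ Flt n w :=
  Submodule.subset_span ⟨L, h, rfl⟩

theorem Flt_mono {v w : ℕ} (h : v ≤ w) : Flt n v ≤ Flt n w :=
  Submodule.span_mono fun _ ⟨L, hL, e⟩ => ⟨L, by omega, e⟩

theorem Flt_zero : Flt n 0 = ⊥ := by
  rw [Flt, Submodule.span_eq_bot]
  rintro _ ⟨L, hL, rfl⟩
  omega

theorem Flt_induction {w : ℕ} {p : Yangian n → Prop} (h0 : p 0) (hadd : ∀ x y, p x → p y → p (x + y))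
    (hsmul : ∀ (c : ℂ) x, p x → p (c • x)) (hL : ∀ L, wtL L < w → p (prodL L)) {x : Yangian n}
    (hx : x ∈ Flt n w) : p x := by
  induction hx using Submodule.span_induction with
  | mem x h => obtain ⟨L, h, rfl⟩ := h; exact hL L h
  | zero => exact h0
  | add x y _ _ hx hy => exact hadd x y hx hy
  | smul c x _ hx => exact hsmul c x hx

theorem mul_mem_of_words {u v w : ℕ} (h : ∀ a b, a < u → b < v → a + b < w) {x y : Yangian n}
    (hx : x ∈ Flt n u) (hy : y ∈ Flt n v) : x * y ∈ Flt n w := by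
  refine Flt_induction (p := fun x => x * y ∈ Flt n w) (by simp)
    (fun x x' h h' => by rw [add_mul]; exact add_mem h h')
    (fun c x h => by rw [smul_mul_assoc]; exact Submodule.smul_mem _ _ h) (fun L hL => ?_) hx
  refine Flt_induction (p := fun y => prodL L * y ∈ Flt n w) (by simp)
    (fun x x' h h' => by rw [mul_add]; exact add_mem h h')
    (fun c x h => by rw [mul_smul_comm]; exact Submodule.smul_mem _ _ h) (fun L' hL' => ?_) hy
  rw [← prodL_append]
  exact prodL_mem (by rw [wtL_append]; exact h _ _ hL hL')

theorem mul_mem_left {a b : ℕ} {x y : Yangian n} (hx : x ∈ Flt n (a + 1)) (hy : y ∈ Flt n b) :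
    x * y ∈ Flt n (a + b) := mul_mem_of_words (by intros; omega) hx hy

theorem mul_mem_right {a b : ℕ} {x y : Yangian n} (hx : x ∈ Flt n a) (hy : y ∈ Flt n (b + 1)) :
    x * y ∈ Flt n (a + b) := mul_mem_of_words (by intros; omega) hx hy

theorem gen_mem (g : Fin n × Fin n × ℕ) : gen g ∈ Flt n (wt g + 1) := by
  have := prodL_mem (L := [g]) (w := wt g + 1) (by simp)
  simpa using this

theorem one_mem_Flt {w : ℕ} (h : 0 < w) : (1 : Yangian n) ∈ Flt n w :=
  prodL_mem (L := []) (by simpa)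

theorem exists_mem_Flt (x : Yangian n) : ∃ w, x ∈ Flt n w := by
  let S : Subalgebra ℂ (Yangian n) :=
    { carrier := {x | ∃ w, x ∈ Flt n w}
      mul_mem' := by
        rintro a b ⟨u, hu⟩ ⟨v, hv⟩
        exact ⟨u + v, mul_mem_of_words (by intros; omega) hu hv⟩
      add_mem' := by
        rintro a b ⟨u, hu⟩ ⟨v, hv⟩
        exact ⟨u + v, add_mem (Flt_mono (by omega) hu) (Flt_mono (by omega) hv)⟩
      algebraMap_mem' := fun c => ⟨1, by
        rw [Algebra.algebraMap_eq_smul_one]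
        exact Submodule.smul_mem _ _ (one_mem_Flt one_pos)⟩ }
  refine t_induction S (fun i j r => ?_) x
  rcases r with _ | r
  · rw [t_zero]
    split_ifs
    · exact one_mem S
    · exact zero_mem S
  · exact ⟨_, gen_mem (i, j, r)⟩

/-- The leading part of the commutator of two generators. -/
theorem t_commutator (i j k l : Fin n) (r s : ℕ) :
    t i j (r + 1) * t k l (s + 1) - t k l (s + 1) * t i j (r + 1) -
      ((if k = j then t i l (r + s + 1) else 0) - if i = l then t k j (r + s + 1) else 0) ∈
    Flt n (2 * (r + s) + 1) := by
  induction r generalizing s with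
  | zero =>
    have := t_rel i j k l 0 (s + 1)
    simp only [t_zero, zero_add] at this
    have h : t i j 1 * t k l (s + 1) - t k l (s + 1) * t i j 1 -
      ((if k = j then t i l (s + 1) else 0) - if i = l then t k j (s + 1) else 0) = 0 := by
      have h2 : (if i = j then (1 : Yangian n) else 0) * t k l (s + 1 + 1) -
        t k l (s + 1 + 1) * (if i = j then 1 else 0) = 0 := by split_ifs <;> simp
      rw [h2, sub_zero] at this
      rw [this]
      split_ifs <;> simp
    simp only [zero_add]
    rw [h]
    exact zero_mem _
  | succ r ih =>
    have h := ih (s + 1)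
    have h2 := t_rel i j k l (r + 1) (s + 1)
    -- The quadratic terms of the relation have weight 2(r + 1 + s), one less than the linear
    -- leading term. They are therefore absorbed when one unit of the superscript is moved from the
    -- first generator to the second.
    have h3 : ∀ a b c d : Fin n, t a b (r + 1) * t c d (s + 1) ∈ Flt n (2 * (r + 1 + s) + 1) := by
      intro a b c d
      have := prodL_mem (L := [(a, b, r), (c, d, s)]) (w := 2 * (r + 1 + s) + 1)
        (by simp only [wtL_cons, wtL_nil, wt]; omega)
      simpa [gen] using this
    have h3' : ∀ a b c d : Fin n, t a b (s + 1) * t c d (r + 1) ∈ Flt n (2 * (r + 1 + s) + 1) := by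
      intro a b c d
      have := prodL_mem (L := [(a, b, s), (c, d, r)]) (w := 2 * (r + 1 + s) + 1)
        (by simp only [wtL_cons, wtL_nil, wt]; omega)
      simpa [gen] using this
    rw [show r + (s + 1) = r + 1 + s by ring] at h
    have h4 := add_mem h (sub_mem (h3 k j i l) (h3' k j i l))
    rw [← h2] at h4
    convert h4 using 1
    abel

theorem gen_comm_mem (a b : Fin n × Fin n × ℕ) :
    gen a * gen b - gen b * gen a ∈ Flt n (wt a + wt b) := by
  obtain ⟨i, j, r⟩ := a
  obtain ⟨k, l, s⟩ := b
  have h := Flt_mono (n := n) (show 2 * (r + s) + 1 ≤ wt (i, j, r) + wt (k, l, s) by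
    simp only [wt]; omega) (t_commutator i j k l r s)
  have h2 : ∀ a b : Fin n, t a b (r + s + 1) ∈ Flt n (wt (i, j, r) + wt (k, l, s)) := by
    intro a b
    exact Flt_mono (by simp only [wt]; omega) (gen_mem (a, b, r + s))
  have h3 : (if k = j then t i l (r + s + 1) else 0) - (if i = l then t k j (r + s + 1) else 0) ∈
      Flt n (wt (i, j, r) + wt (k, l, s)) := by
    refine sub_mem ?_ ?_ <;> split_ifs <;> first | exact h2 _ _ | exact zero_mem _
  have := add_mem h h3
  rwa [sub_add_cancel] at this

theorem prodL_perm {L L' : List (Fin n × Fin n × ℕ)} (h : L.Perm L') :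
    prodL L - prodL L' ∈ Flt n (wtL L) ∧ wtL L = wtL L' := by
  induction h with
  | nil => simp
  | cons a _ ih =>
    simp only [prodL_cons, wtL_cons, ← mul_sub]
    exact ⟨mul_mem_left (gen_mem a) ih.1, by rw [ih.2]⟩
  | swap a b L =>
    simp only [prodL_cons, wtL_cons, ← mul_assoc, ← sub_mul, ← add_assoc]
    refine ⟨mul_mem_right (gen_comm_mem b a) (prodL_mem (Nat.lt_succ_self _)), by ring⟩
  | trans _ _ h1 h2 =>
    refine ⟨?_, h1.2.trans h2.2⟩
    have := add_mem h1.1 (h1.2 ▸ h2.1)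
    simpa using this

/-! ### Symbols -/

/-- The monomial of a word. -/
def mon (L : List (Fin n × Fin n × ℕ)) : MvPolynomial (Fin n × Fin n × ℕ) ℂ :=
  (L.map MvPolynomial.X).prod

@[simp] theorem mon_nil : mon ([] : List (Fin n × Fin n × ℕ)) = 1 := rfl

@[simp] theorem mon_cons (a : Fin n × Fin n × ℕ) (L) :
    mon (a :: L) = MvPolynomial.X a * mon L := by simp [mon]

/-- The polynomials that are homogeneous of weight `w`. -/
def Hom (n w : ℕ) : Submodule ℂ (MvPolynomial (Fin n × Fin n × ℕ) ℂ) :=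
  Submodule.span ℂ {x | ∃ L : List (Fin n × Fin n × ℕ), wtL L = w ∧ mon L = x}

theorem mon_mem {L : List (Fin n × Fin n × ℕ)} {w : ℕ} (h : wtL L = w) : mon L ∈ Hom n w :=
  Submodule.subset_span ⟨L, h, rfl⟩

theorem Hom_induction {w : ℕ} {p : MvPolynomial (Fin n × Fin n × ℕ) ℂ → Prop} (h0 : p 0)
    (hadd : ∀ x y, p x → p y → p (x + y)) (hsmul : ∀ (c : ℂ) x, p x → p (c • x))
    (hL : ∀ L, wtL L = w → p (mon L)) {x} (hx : x ∈ Hom n w) : p x := by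
  induction hx using Submodule.span_induction with
  | mem x h => obtain ⟨L, h, rfl⟩ := h; exact hL L h
  | zero => exact h0
  | add x y _ _ hx hy => exact hadd x y hx hy
  | smul c x _ hx => exact hsmul c x hx

theorem X_mul_mem (a : Fin n × Fin n × ℕ) {w : ℕ} {p} (hp : p ∈ Hom n w) :
    MvPolynomial.X a * p ∈ Hom n (wt a + w) := by
  refine Hom_induction (p := fun p => MvPolynomial.X a * p ∈ Hom n (wt a + w)) (by simp)
    (fun x x' h h' => by rw [mul_add]; exact add_mem h h')
    (fun c x h => by rw [mul_smul_comm]; exact Submodule.smul_mem _ _ h) (fun L hL => ?_) hp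
  rw [← mon_cons]
  exact mon_mem (by rw [wtL_cons, hL])

/-- A linear section of the passage to symbols: a monomial is sent to the product of its factors
in some order. -/
def theta (n : ℕ) : MvPolynomial (Fin n × Fin n × ℕ) ℂ →ₗ[ℂ] Yangian n :=
  (MvPolynomial.basisMonomials _ ℂ).constr ℂ fun s => prodL (Finsupp.toMultiset s).toList

/-- The two words differ by a permutation of letters, and each transposition costs a commutator of
lower weight. Hence the arbitrary order chosen in `theta` is immaterial for leading terms. -/
theorem theta_mon (L : List (Fin n × Fin n × ℕ)) :
    prodL L - theta n (mon L) ∈ Flt n (wtL L) := by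
  classical
  have h1 : mon L = MvPolynomial.basisMonomials _ ℂ (Multiset.toFinsupp (L : Multiset _)) := by
    rw [MvPolynomial.coe_basisMonomials]
    induction L with
    | nil => simp [mon]
    | cons a L ih =>
      rw [mon_cons, ih, ← Multiset.cons_coe, ← Multiset.singleton_add, map_add,
        Multiset.toFinsupp_singleton, MvPolynomial.X, MvPolynomial.monomial_mul, one_mul]
  rw [h1, theta, Module.Basis.constr_basis]
  refine (prodL_perm ?_).1
  rw [← Multiset.coe_eq_coe, Multiset.coe_toList, Multiset.toFinsupp_toMultiset]

theorem theta_mem {w : ℕ} {p} (hp : p ∈ Hom n w) : theta n p ∈ Flt n (w + 1) := by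
  refine Hom_induction (p := fun p => theta n p ∈ Flt n (w + 1)) (by simp)
    (fun x x' h h' => by rw [map_add]; exact add_mem h h')
    (fun c x h => by rw [map_smul]; exact Submodule.smul_mem _ _ h) (fun L hL => ?_) hp
  have := sub_mem (prodL_mem (show wtL L < w + 1 by omega))
    (Flt_mono (by omega) (theta_mon L))
  simpa using this

theorem exists_symbol {w : ℕ} {x : Yangian n} (hx : x ∈ Flt n (w + 1)) :
    ∃ p ∈ Hom n w, x - theta n p ∈ Flt n w := by
  refine Flt_induction (p := fun x => ∃ p ∈ Hom n w, x - theta n p ∈ Flt n w)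
    ⟨0, zero_mem _, by simp⟩ ?_ ?_ (fun L hL => ?_) hx
  · rintro x y ⟨p, hp, hx⟩ ⟨q, hq, hy⟩
    refine ⟨p + q, add_mem hp hq, ?_⟩
    rw [map_add, add_sub_add_comm]
    exact add_mem hx hy
  · rintro c x ⟨p, hp, hx⟩
    refine ⟨c • p, Submodule.smul_mem _ _ hp, ?_⟩
    rw [map_smul, ← smul_sub]
    exact Submodule.smul_mem _ _ hx
  · by_cases h : wtL L = w
    · exact ⟨mon L, mon_mem h, h ▸ theta_mon L⟩
    · exact ⟨0, zero_mem _, by simpa using prodL_mem (by omega)⟩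

theorem theta_X_mul (a : Fin n × Fin n × ℕ) {w : ℕ} {p} (hp : p ∈ Hom n w) :
    gen a * theta n p - theta n (MvPolynomial.X a * p) ∈ Flt n (wt a + w) := by
  refine Hom_induction (p := fun p => gen a * theta n p - theta n (MvPolynomial.X a * p) ∈
    Flt n (wt a + w)) (by simp) ?_ ?_ (fun L hL => ?_) hp
  · intro x y hx hy
    rw [map_add, mul_add, mul_add, map_add, add_sub_add_comm]
    exact add_mem hx hy
  · intro c x hx
    rw [map_smul, mul_smul_comm, mul_smul_comm, map_smul, ← smul_sub]
    exact Submodule.smul_mem _ _ hx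
  · have h1 := theta_mon (a :: L)
    have h2 := mul_mem_left (gen_mem a) (theta_mon L)
    rw [prodL_cons, mon_cons, wtL_cons, hL] at h1
    rw [hL] at h2
    have := sub_mem h1 h2
    convert this using 1
    rw [mul_sub]
    abel

/-- The bracket with `t_{ij}^{(s+1)}` on symbols. -/
def bracket (g : Fin n × Fin n × ℕ) :
    Derivation ℂ (MvPolynomial (Fin n × Fin n × ℕ) ℂ) (MvPolynomial (Fin n × Fin n × ℕ) ℂ) :=
  MvPolynomial.mkDerivation ℂ fun h =>
    (if h.1 = g.2.1 then MvPolynomial.X (g.1, h.2.1, g.2.2 + h.2.2) else 0) -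
      if g.1 = h.2.1 then MvPolynomial.X (h.1, g.2.1, g.2.2 + h.2.2) else 0

theorem bracket_X (i j k l : Fin n) (s r : ℕ) :
    bracket (i, j, s) (MvPolynomial.X (k, l, r)) =
    (if k = j then MvPolynomial.X (i, l, s + r) else 0) -
      if i = l then MvPolynomial.X (k, j, s + r) else 0 := by
  rw [bracket, MvPolynomial.mkDerivation_X]

theorem ite_X_mul_mem (P : Prop) [Decidable P] (a : Fin n × Fin n × ℕ) {w v : ℕ} {p}
    (hp : p ∈ Hom n w) (hv : wt a + w = v) :
    (if P then MvPolynomial.X a else 0) * p ∈ Hom n v := by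
  split_ifs
  · exact hv ▸ X_mul_mem a hp
  · rw [zero_mul]; exact zero_mem _

theorem theta_ite_X_mul (P : Prop) [Decidable P] (a : Fin n × Fin n × ℕ) {w v : ℕ} {p}
    (hp : p ∈ Hom n w) (hv : wt a + w = v) :
    (if P then gen a else 0) * theta n p - theta n ((if P then MvPolynomial.X a else 0) * p) ∈
      Flt n v := by
  split_ifs
  · exact hv ▸ theta_X_mul a hp
  · simp

/-- The commutator with a generator and the derivation `bracket` obey the same Leibniz rule and
agree to leading order on generators by `t_commutator`. The weight rises by 2s, one less than the
weight of the generator. -/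
theorem bracket_mon (i j : Fin n) (s : ℕ) (L : List (Fin n × Fin n × ℕ)) :
    bracket (i, j, s) (mon L) ∈ Hom n (wtL L + 2 * s) ∧
    gen (i, j, s) * prodL L - prodL L * gen (i, j, s) - theta n (bracket (i, j, s) (mon L)) ∈
      Flt n (wtL L + 2 * s) := by
  induction L with
  | nil => simp
  | cons a L ih =>
    obtain ⟨k, l, r⟩ := a
    obtain ⟨ih1, ih2⟩ := ih
    have hw : ∀ x y : Fin n, wt (x, y, s + r) + wtL L = wtL ((k, l, r) :: L) + 2 * s := by
      intro x y; simp only [wt, wtL_cons]; ring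
    have hw2 : wtL ((k, l, r) :: L) + 2 * s = wt (k, l, r) + (wtL L + 2 * s) := by
      rw [wtL_cons, add_assoc]
    have hL := mon_mem (rfl : wtL L = wtL L)
    rw [mon_cons, Derivation.leibniz, smul_eq_mul, smul_eq_mul, bracket_X, mul_comm (mon L)]
    constructor
    · rw [sub_mul]
      refine add_mem (hw2 ▸ X_mul_mem _ ih1) (sub_mem ?_ ?_)
      · exact ite_X_mul_mem _ _ hL (hw _ _)
      · exact ite_X_mul_mem _ _ hL (hw _ _)
    · have e1 := mul_mem_right (t_commutator i j k l s r) (prodL_mem (Nat.lt_succ_self (wtL L)))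
      have e2 := theta_ite_X_mul (k = j) (i, l, s + r) hL (hw _ _)
      have e3 := theta_ite_X_mul (i = l) (k, j, s + r) hL (hw _ _)
      have e4 := mul_mem_left (gen_mem (k, l, r)) ih2
      have e5 := theta_X_mul (k, l, r) ih1
      have e6 : ∀ x y : Fin n, ∀ P : Prop, [Decidable P] → (if P then gen (x, y, s + r) else 0) *
          (prodL L - theta n (mon L)) ∈ Flt n (wtL ((k, l, r) :: L) + 2 * s) := by
        intro x y P _
        split_ifs
        · have := mul_mem_left (gen_mem (x, y, s + r)) (theta_mon L)
          rwa [hw] at this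
        · rw [zero_mul]; exact zero_mem _
      have e7 := e6 i l (k = j)
      have e8 := e6 k j (i = l)
      rw [← hw2] at e4 e5
      rw [show 2 * (s + r) + 1 + wtL L = wtL ((k, l, r) :: L) + 2 * s by
        simp only [wt, wtL_cons]; ring] at e1
      have := add_mem (add_mem (add_mem e1 (sub_mem e2 e3)) (add_mem e4 e5)) (sub_mem e7 e8)
      convert this using 1
      rw [prodL_cons, map_add, sub_mul, map_sub]
      simp only [gen, mul_sub, sub_mul, mul_assoc]
      abel

theorem gen_commutator_mem (i j : Fin n) (s : ℕ) {w : ℕ} {x : Yangian n} (hx : x ∈ Flt n w) :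
    gen (i, j, s) * x - x * gen (i, j, s) ∈ Flt n (w + 2 * s) := by
  refine Flt_induction (p := fun x => gen (i, j, s) * x - x * gen (i, j, s) ∈
    Flt n (w + 2 * s)) (by simp) ?_ ?_ (fun L hL => ?_) hx
  · intro x y h1 h2
    convert add_mem h1 h2 using 1
    rw [mul_add, add_mul]
    abel
  · intro c x h
    convert Submodule.smul_mem _ c h using 1
    rw [mul_smul_comm, smul_mul_assoc, smul_sub]
  · obtain ⟨h1, h2⟩ := bracket_mon i j s L
    have := add_mem (Flt_mono (show _ ≤ w + 2 * s by omega) h2)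
      (Flt_mono (show _ ≤ w + 2 * s by omega) (theta_mem h1))
    simpa using this

theorem bracket_theta (i j : Fin n) (s : ℕ) {w : ℕ} {p} (hp : p ∈ Hom n w) :
    bracket (i, j, s) p ∈ Hom n (w + 2 * s) ∧
    gen (i, j, s) * theta n p - theta n p * gen (i, j, s) - theta n (bracket (i, j, s) p) ∈
      Flt n (w + 2 * s) := by
  refine Hom_induction (p := fun p => bracket (i, j, s) p ∈ Hom n (w + 2 * s) ∧
    gen (i, j, s) * theta n p - theta n p * gen (i, j, s) - theta n (bracket (i, j, s) p) ∈
      Flt n (w + 2 * s)) (by simp) ?_ ?_ (fun L hL => ?_) hp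
  · rintro x y ⟨h1, h2⟩ ⟨h3, h4⟩
    refine ⟨by rw [map_add]; exact add_mem h1 h3, ?_⟩
    convert add_mem h2 h4 using 1
    simp only [map_add, mul_add, add_mul]
    abel
  · rintro c x ⟨h1, h2⟩
    refine ⟨by rw [Derivation.map_smul]; exact Submodule.smul_mem _ _ h1, ?_⟩
    convert Submodule.smul_mem _ c h2 using 1
    rw [Derivation.map_smul, map_smul, map_smul, mul_smul_comm, smul_mul_assoc, smul_sub, smul_sub]
  · obtain ⟨h1, h2⟩ := bracket_mon i j s L
    rw [hL] at h1 h2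
    refine ⟨h1, ?_⟩
    have h3 := gen_commutator_mem i j s (theta_mon L)
    rw [hL] at h3
    convert sub_mem h2 h3 using 1
    rw [mul_sub, sub_mul]
    abel

end Filtration

/-! ### Representations by differential operators -/

section Evaluation

variable {n : ℕ} {A : Type*} [Ring A]

/-- The matrix `1 + E (u - a)⁻¹`. -/
def lax (E : Fin n → Fin n → A) (a : A) : Matrix (Fin n) (Fin n) A⟦X⟧ :=
  Matrix.of fun i j => PowerSeries.mk fun
    | 0 => if i = j then 1 else 0
    | r + 1 => a ^ r * E i j

theorem coeff_zero_lax (E : Fin n → Fin n → A) (a : A) (i j : Fin n) :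
    coeff 0 (lax E a i j) = if i = j then 1 else 0 := by
  rw [lax, Matrix.of_apply, coeff_mk]

theorem coeff_succ_lax (E : Fin n → Fin n → A) (a : A) (i j : Fin n) (r : ℕ) :
    coeff (r + 1) (lax E a i j) = a ^ r * E i j := by
  rw [lax, Matrix.of_apply, coeff_mk]

theorem lax_constantCoeff (E : Fin n → Fin n → A) (a : A) :
    (lax E a).map PowerSeries.constantCoeff = 1 := by
  ext i j
  rw [Matrix.map_apply, ← coeff_zero_eq_constantCoeff_apply, coeff_zero_lax, Matrix.one_apply]

/-- The evaluation homomorphism at a. If r and s are both positive, the two sides of the coefficient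
relation vanish because only r + s enters the power of a; if exactly one is zero, the relation is
that of gl_n. -/
theorem rtt_lax {E : Fin n → Fin n → A} {a : A} (ha : ∀ x, Commute a x)
    (hE : ∀ i j k l, E i j * E k l - E k l * E i j =
      (if k = j then E i l else 0) - if i = l then E k j else 0) :
    RTT (dd A) (ee A) ((lax E a).map inU) ((lax E a).map inV) := by
  rw [← coeffRel_iff _ (lax_constantCoeff E a)]
  have hp : ∀ i j k l p q, a ^ p * E i j * (a ^ q * E k l) = a ^ (p + q) * (E i j * E k l) := by
    intro i j k l p q
    rw [pow_add, mul_assoc, ← mul_assoc (E i j), ← ((ha (E i j)).pow_left q).eq]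
    simp only [mul_assoc]
  intro i j k l r s
  rcases r with _ | r <;> rcases s with _ | s <;>
    simp only [coeff_zero_lax, coeff_succ_lax, hp]
  · split_ifs <;> simp
  · rw [zero_add, add_zero, ← mul_sub, hE, mul_sub]
    split_ifs <;> simp
  · rw [zero_add, add_zero, ← mul_sub, hE, mul_sub]
    split_ifs <;> simp
  · rw [show r + 1 + s = r + (s + 1) by ring, show s + (r + 1) = r + (s + 1) by ring,
      show s + 1 + r = r + (s + 1) by ring, add_comm s r, ← mul_sub, ← mul_sub, hE, sub_self,
      sub_self, mul_zero]

/-- The quadratic operators `x_i D_j` in a Weyl algebra satisfy the relations of `gl_n`. -/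
theorem weyl_gl {x D : Fin n → A} (hx : ∀ i j, x i * x j = x j * x i)
    (hD : ∀ i j, D i * D j = D j * D i)
    (hDx : ∀ i j, D i * x j = x j * D i + if i = j then 1 else 0) (i j k l : Fin n) :
    x i * D j * (x k * D l) - x k * D l * (x i * D j) =
      (if k = j then x i * D l else 0) - if i = l then x k * D j else 0 := by
  have h1 : x i * D j * (x k * D l) = x i * x k * (D j * D l) +
      if k = j then x i * D l else 0 := by
    rw [mul_assoc, ← mul_assoc (D j), hDx, add_mul, mul_add, mul_assoc, mul_assoc]
    by_cases h : k = j
    · simp [h]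
    · simp [h, Ne.symm h]
  have h2 : x k * D l * (x i * D j) = x i * x k * (D j * D l) +
      if i = l then x k * D j else 0 := by
    rw [mul_assoc, ← mul_assoc (D l), hDx, add_mul, mul_add, hx i k, hD j l, mul_assoc, mul_assoc]
    by_cases h : i = l
    · simp [h]
    · simp [h, Ne.symm h]
  rw [h1, h2, add_sub_add_left_eq_sub]

variable {K : Type*}

/-- The product of the matrices `1 + E_k (u - a_k)⁻¹` over a list. -/
def laxProd (E : K → Fin n → Fin n → A) (a : K → A) (l : List K) : Matrix (Fin n) (Fin n) A⟦X⟧ :=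
  (l.map fun k => lax (E k) (a k)).prod

theorem laxProd_constantCoeff (E : K → Fin n → Fin n → A) (a : K → A) (l : List K) :
    (laxProd E a l).map PowerSeries.constantCoeff = 1 := by
  induction l with
  | nil => exact Matrix.map_one _ (map_zero _) (map_one _)
  | cons k l ih =>
    rw [laxProd, List.map_cons, List.prod_cons, Matrix.map_mul, lax_constantCoeff, one_mul]
    exact ih

theorem commute_coeff_laxProd {E : K → Fin n → Fin n → A} {a : K → A} {l : List K} {y : A}
    (ha : ∀ k, Commute (a k) y) (h : ∀ k ∈ l, ∀ i j, Commute (E k i j) y) (i j : Fin n) (r : ℕ) :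
    Commute (coeff r (laxProd E a l i j)) y := by
  have hlax : ∀ k, (∀ i j, Commute (E k i j) y) → ∀ i j r,
      Commute (coeff r (lax (E k) (a k) i j)) y := by
    intro k hk i j r
    rcases r with _ | r
    · rw [coeff_zero_lax]
      split_ifs
      · exact Commute.one_left _
      · exact Commute.zero_left _
    · rw [coeff_succ_lax]
      exact ((ha k).pow_left r).mul_left (hk i j)
  induction l generalizing i j r with
  | nil =>
    simp only [laxProd, List.map_nil, List.prod_nil, Matrix.one_apply]
    split_ifs
    · rw [coeff_one]
      split_ifs
      · exact Commute.one_left _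
      · exact Commute.zero_left _
    · simp
  | cons k l ih =>
    rw [laxProd, List.map_cons, List.prod_cons, Matrix.mul_apply, map_sum]
    refine Commute.sum_left _ _ _ fun b _ => ?_
    rw [coeff_mul]
    refine Commute.sum_left _ _ _ fun p _ => Commute.mul_left ?_ ?_
    · exact hlax k (h k (List.mem_cons_self ..)) _ _ _
    · exact ih (fun k hk => h k (List.mem_cons_of_mem _ hk)) _ _ _

theorem rtt_laxProd {E : K → Fin n → Fin n → A} {a : K → A} (ha : ∀ k x, Commute (a k) x)
    (hE : ∀ c i j k l, E c i j * E c k l - E c k l * E c i j =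
      (if k = j then E c i l else 0) - if i = l then E c k j else 0)
    (hcomm : ∀ c d, c ≠ d → ∀ i j k l, Commute (E c i j) (E d k l)) {l : List K} (hl : l.Nodup) :
    RTT (dd A) (ee A) ((laxProd E a l).map inU) ((laxProd E a l).map inV) := by
  induction l with
  | nil =>
    intro i j k l
    simp only [laxProd, List.map_nil, List.prod_nil, Matrix.map_apply, Matrix.one_apply]
    split_ifs <;> simp
  | cons c l ih =>
    rw [List.nodup_cons] at hl
    have hc : ∀ i j k l' p q,
        Commute (coeff p (laxProd E a l i j)) (coeff q (lax (E c) (a c) k l')) := by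
      intro i j k l' p q
      refine commute_coeff_laxProd (fun d => ha d _) (fun d hd i j => ?_) i j p
      rcases q with _ | q
      · rw [coeff_zero_lax]
        split_ifs
        · exact Commute.one_right _
        · exact Commute.zero_right _
      · rw [coeff_succ_lax]
        refine (((ha c _).symm).pow_right q).mul_right (hcomm d c ?_ _ _ _ _)
        rintro rfl
        exact hl.1 hd
    rw [laxProd, List.map_cons, List.prod_cons, Matrix.map_mul, Matrix.map_mul]
    refine RTT.mul dd_comm ee_comm (rtt_lax (ha c) (hE c)) (ih hl.2) ?_ ?_
    · intro i j k l'
      ext q p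
      simp only [Matrix.map_apply, coeff_uv, coeff_vu]
      exact hc _ _ _ _ _ _
    · intro i j k l'
      ext q p
      simp only [Matrix.map_apply, coeff_uv, coeff_vu]
      exact (hc _ _ _ _ _ _).symm

end Evaluation

/-! ### Top degrees in products of evaluation matrices -/

section LeadingTerms

variable {n : ℕ} {B K : Type*} [Ring B]

/-- `f` has degree at most `d`, with coefficient `b` in degree `d`. -/
def HasTop (f : Polynomial B) (d : ℕ) (b : B) : Prop := f.natDegree ≤ d ∧ f.coeff d = b

theorem HasTop.mul {f g : Polynomial B} {d e : ℕ} {b c : B} (hf : HasTop f d b)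
    (hg : HasTop g e c) : HasTop (f * g) (d + e) (b * c) :=
  ⟨Polynomial.natDegree_mul_le_of_le hf.1 hg.1, by
    rw [Polynomial.coeff_mul_add_eq_of_natDegree_le hf.1 hg.1, hf.2, hg.2]⟩

theorem HasTop.add {f g : Polynomial B} {d : ℕ} {b c : B} (hf : HasTop f d b)
    (hg : HasTop g d c) : HasTop (f + g) d (b + c) :=
  ⟨Polynomial.natDegree_add_le_of_degree_le hf.1 hg.1, by rw [Polynomial.coeff_add, hf.2, hg.2]⟩

theorem HasTop.zero (d : ℕ) : HasTop (0 : Polynomial B) d 0 := by simp [HasTop]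

theorem HasTop.of_lt {f : Polynomial B} {d : ℕ} (h : f.natDegree < d) : HasTop f d 0 :=
  ⟨h.le, Polynomial.coeff_eq_zero_of_natDegree_lt h⟩

/-- A mixed term with positive orders p + q = r + 1 has degree at most (2p − 1) + (2q − 1) = 2r. In
degree 2r + 1 only the terms linear in the factors survive, so the top coefficient is additive. -/
theorem hasTop_laxProd {E : K → Fin n → Fin n → Polynomial B} {a : K → Polynomial B}
    {e : K → Fin n → Fin n → B} {α : K → B} (hE : ∀ k i j, HasTop (E k i j) 1 (e k i j))
    (ha : ∀ k, HasTop (a k) 2 (α k)) (l : List K) (i j : Fin n) (r : ℕ) :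
    HasTop (coeff (r + 1) (laxProd E a l i j)) (2 * r + 1)
      (l.map fun k => α k ^ r * e k i j).sum := by
  have hlax : ∀ k i j r, HasTop (coeff (r + 1) (lax (E k) (a k) i j)) (2 * r + 1)
      (α k ^ r * e k i j) := by
    intro k i j r
    rw [coeff_succ_lax]
    refine HasTop.mul ?_ (hE k i j)
    induction r with
    | zero => simp [HasTop]
    | succ r ih =>
      rw [pow_succ, pow_succ, show 2 * (r + 1) = 2 * r + 2 by ring]
      exact ih.mul (ha k)
  induction l generalizing i j r with
  | nil =>
    simp only [laxProd, List.map_nil, List.prod_nil, Matrix.one_apply, List.sum_nil]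
    split_ifs
    · rw [coeff_one, if_neg (by omega)]; exact HasTop.zero _
    · rw [map_zero]; exact HasTop.zero _
  | cons k l ih =>
    have h0 : ∀ i j, coeff 0 (laxProd E a l i j) = if i = j then 1 else 0 := by
      intro i j
      have := congrFun (congrFun (laxProd_constantCoeff E a l) i) j
      rwa [Matrix.map_apply, Matrix.one_apply, ← coeff_zero_eq_constantCoeff_apply] at this
    have key : coeff (r + 1) (laxProd E a (k :: l) i j) =
        coeff (r + 1) (lax (E k) (a k) i j) + (coeff (r + 1) (laxProd E a l i j) +
        ∑ b, ∑ p ∈ Finset.HasAntidiagonal.antidiagonal (r + 1) with p.1 ≠ 0 ∧ p.2 ≠ 0,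
          coeff p.1 (lax (E k) (a k) i b) * coeff p.2 (laxProd E a l b j)) := by
      have h1 : ∀ b, coeff (r + 1) (lax (E k) (a k) i b * laxProd E a l b j) =
          coeff (r + 1) (lax (E k) (a k) i b) * (if b = j then 1 else 0) +
          ((if i = b then 1 else 0) * coeff (r + 1) (laxProd E a l b j) +
          ∑ p ∈ Finset.HasAntidiagonal.antidiagonal (r + 1) with p.1 ≠ 0 ∧ p.2 ≠ 0,
          coeff p.1 (lax (E k) (a k) i b) * coeff p.2 (laxProd E a l b j)) := by
        intro b
        have hs : Finset.HasAntidiagonal.antidiagonal (r + 1) =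
            insert (r + 1, 0) (insert (0, r + 1)
              ((Finset.HasAntidiagonal.antidiagonal (r + 1)).filter
                fun p => p.1 ≠ 0 ∧ p.2 ≠ 0)) := by
          ext ⟨p, q⟩
          simp only [Finset.mem_insert, Finset.mem_filter,
            Finset.HasAntidiagonal.mem_antidiagonal, Prod.mk.injEq]
          omega
        rw [coeff_mul, hs, Finset.sum_insert (by simp), Finset.sum_insert (by simp), h0,
          coeff_zero_lax, ← hs]
      have h2 : laxProd E a (k :: l) i j = ∑ b, lax (E k) (a k) i b * laxProd E a l b j := by
        rw [laxProd, List.map_cons, List.prod_cons, Matrix.mul_apply]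
        rfl
      rw [h2, map_sum, Finset.sum_congr rfl fun b _ => h1 b, Finset.sum_add_distrib,
        Finset.sum_add_distrib]
      simp
    rw [key, List.map_cons, List.sum_cons]
    refine (hlax k i j r).add ?_
    rw [← add_zero (List.sum _)]
    refine (ih i j r).add (HasTop.of_lt ?_)
    refine lt_of_le_of_lt (Polynomial.natDegree_sum_le_of_forall_le (n := 2 * r) _ _ fun b _ =>
      Polynomial.natDegree_sum_le_of_forall_le _ _ fun p hp => ?_) (Nat.lt_succ_self _)
    obtain ⟨p, q⟩ := p
    simp only [Finset.mem_filter, Finset.HasAntidiagonal.mem_antidiagonal] at hp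
    obtain ⟨p, rfl⟩ := Nat.exists_eq_succ_of_ne_zero hp.2.1
    obtain ⟨q, rfl⟩ := Nat.exists_eq_succ_of_ne_zero hp.2.2
    refine (((hlax k i b p).mul (ih b j q)).1).trans ?_
    omega

end LeadingTerms

/-! ### Independence of the symbols -/

/-- The homomorphism out of the Yangian that sends `T(u)` to the matrix `M`. -/
def liftMat {n : ℕ} {A : Type*} [Ring A] [Algebra ℂ A] (M : Matrix (Fin n) (Fin n) A⟦X⟧)
    (h0 : M.map PowerSeries.constantCoeff = 1)
    (h : RTT (dd A) (ee A) (M.map inU) (M.map inV)) : Yangian n →ₐ[ℂ] A :=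
  lift (fun i j r => coeff r (M i j))
    (fun i j => by
      have := congrFun (congrFun h0 i) j
      rwa [Matrix.map_apply, Matrix.one_apply, ← coeff_zero_eq_constantCoeff_apply] at this)
    ((coeffRel_iff M h0).2 h)

theorem liftMat_t {n : ℕ} {A : Type*} [Ring A] [Algebra ℂ A] (M : Matrix (Fin n) (Fin n) A⟦X⟧)
    (h0) (h) (i j : Fin n) (r : ℕ) : liftMat M h0 h (t i j r) = coeff r (M i j) :=
  lift_t _ _ _ _ _ _

/-! ### Multiplication and differentiation operators on polynomials -/

section Operators

variable {σ : Type*}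

/-- The operator of multiplication by a polynomial. -/
def mulEnd : MvPolynomial σ ℂ →ₐ[ℂ] Module.End ℂ (MvPolynomial σ ℂ) := Algebra.lmul ℂ _

theorem mulEnd_apply (p q : MvPolynomial σ ℂ) : mulEnd p q = p * q := rfl

/-- The operator of partial differentiation. -/
def derEnd (a : σ) : Module.End ℂ (MvPolynomial σ ℂ) :=
  (MvPolynomial.pderiv a : Derivation ℂ (MvPolynomial σ ℂ) (MvPolynomial σ ℂ)).toLinearMap

theorem derEnd_apply (a : σ) (p : MvPolynomial σ ℂ) : derEnd a p = MvPolynomial.pderiv a p := rfl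

theorem mulEnd_comm (p q : MvPolynomial σ ℂ) : Commute (mulEnd p) (mulEnd q) :=
  (Commute.all p q).map mulEnd

theorem pderiv_pderiv (a b : σ) (p : MvPolynomial σ ℂ) :
    MvPolynomial.pderiv a (MvPolynomial.pderiv b p) =
      MvPolynomial.pderiv b (MvPolynomial.pderiv a p) := by
  classical
  have h : ⁅(MvPolynomial.pderiv a : Derivation ℂ (MvPolynomial σ ℂ) (MvPolynomial σ ℂ)),
      (MvPolynomial.pderiv b : Derivation ℂ (MvPolynomial σ ℂ) (MvPolynomial σ ℂ))⁆ = 0 := by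
    apply MvPolynomial.derivation_ext
    intro i
    rw [Derivation.commutator_apply, MvPolynomial.pderiv_X, MvPolynomial.pderiv_X]
    simp only [Pi.single_apply]
    split_ifs <;> simp
  have h := DFunLike.congr_fun h p
  rw [Derivation.commutator_apply] at h
  exact sub_eq_zero.1 h

theorem derEnd_comm (a b : σ) : Commute (derEnd a) (derEnd b) :=
  LinearMap.ext fun p => pderiv_pderiv a b p

theorem derEnd_mulEnd_X [DecidableEq σ] (a b : σ) :
    derEnd a * mulEnd (MvPolynomial.X b) = mulEnd (MvPolynomial.X b) * derEnd a +
      if a = b then 1 else 0 := by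
  refine LinearMap.ext fun p => ?_
  rw [LinearMap.add_apply, Module.End.mul_apply, Module.End.mul_apply, mulEnd_apply, mulEnd_apply,
    derEnd_apply, derEnd_apply, MvPolynomial.pderiv_mul, MvPolynomial.pderiv_X, add_comm,
    Pi.single_apply]
  congr 1
  by_cases h : a = b
  · simp [h]
  · simp [h, Ne.symm h]

end Operators

/-! ### A family of representations separating symbols -/

section Faithful

/-- The indices of the tensor factors of the representation. -/
abbrev Legs (n R : ℕ) : Type := Fin n × Fin n × Fin R

/-- The polynomial functions on which the representation acts. -/
abbrev Fock (n R : ℕ) : Type := MvPolynomial (Legs n R × Fin n) ℂ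

variable (n R : ℕ)

/-- The operator of multiplication by a variable. -/
def mulOp (k : Legs n R) (i : Fin n) : Polynomial (Module.End ℂ (Fock n R)) :=
  Polynomial.C (mulEnd (MvPolynomial.X (k, i)))

/-- A partial derivative, translated by the deformation parameter for one index. -/
def derOp (k : Legs n R) (j : Fin n) : Polynomial (Module.End ℂ (Fock n R)) :=
  Polynomial.C (derEnd (k, j)) + if j = k.2.1 then Polynomial.X else 0

/-- The evaluation points of the representation. -/
def evalPt (k : Legs n R) : Polynomial (Module.End ℂ (Fock n R)) :=
  Polynomial.C (algebraMap ℂ _ ((k.2.2 : ℕ) : ℂ)) * Polynomial.X ^ 2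

theorem mulOp_comm (k l : Legs n R) (i j : Fin n) : Commute (mulOp n R k i) (mulOp n R l j) :=
  (mulEnd_comm _ _).map Polynomial.C

theorem commute_ite_X {A : Type*} [Ring A] (P : Prop) [Decidable P] (f : Polynomial A) :
    Commute (if P then Polynomial.X else 0) f := by
  split_ifs
  · exact Polynomial.commute_X f
  · exact Commute.zero_left _

theorem derOp_comm (k l : Legs n R) (i j : Fin n) : Commute (derOp n R k i) (derOp n R l j) :=
  Commute.add_left (Commute.add_right ((derEnd_comm _ _).map Polynomial.C)
    (commute_ite_X _ _).symm) (commute_ite_X _ _)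

theorem derOp_mulOp (k l : Legs n R) (i j : Fin n) :
    derOp n R k i * mulOp n R l j = mulOp n R l j * derOp n R k i +
      if (k, i) = (l, j) then 1 else 0 := by
  rw [derOp, mulOp, add_mul, mul_add, ← Polynomial.C_mul, ← Polynomial.C_mul, derEnd_mulEnd_X,
    (commute_ite_X _ _).eq, Polynomial.C_add, add_right_comm]
  congr 1
  split_ifs
  · exact Polynomial.C_1
  · exact Polynomial.C_0

theorem evalPt_comm (k : Legs n R) (f) : Commute (evalPt n R k) f :=
  Commute.mul_left (Algebra.commutes ((k.2.2 : ℕ) : ℂ) f) ((Polynomial.commute_X f).pow_left 2)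

/-- The operators `x_i (∂_j + λ δ_{jb})`. -/
def glOp (k : Legs n R) (i j : Fin n) : Polynomial (Module.End ℂ (Fock n R)) :=
  mulOp n R k i * derOp n R k j

theorem glOp_rel (c : Legs n R) (i j k l : Fin n) :
    glOp n R c i j * glOp n R c k l - glOp n R c k l * glOp n R c i j =
      (if k = j then glOp n R c i l else 0) - if i = l then glOp n R c k j else 0 := by
  have h : ∀ i j, derOp n R c i * mulOp n R c j = mulOp n R c j * derOp n R c i +
      if i = j then 1 else 0 := fun i j => by simp [derOp_mulOp]
  exact weyl_gl (A := Polynomial (Module.End ℂ (Fock n R))) (x := mulOp n R c) (D := derOp n R c)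
    (fun i j => (mulOp_comm n R c c i j).eq) (fun i j => (derOp_comm n R c c i j).eq) h i j k l

theorem glOp_comm (c d : Legs n R) (hcd : c ≠ d) (i j k l : Fin n) :
    Commute (glOp n R c i j) (glOp n R d k l) := by
  have h : ∀ c d, c ≠ d → ∀ i j, Commute (derOp n R c i) (mulOp n R d j) := by
    intro c d hcd i j
    rw [Commute, SemiconjBy, derOp_mulOp, if_neg (by simp [hcd]), add_zero]
  exact ((mulOp_comm n R _ _ _ _).mul_right (h d c hcd.symm _ _).symm).mul_left
    ((h c d hcd _ _).mul_right (derOp_comm n R _ _ _ _))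

/-- The matrix of the generating series in the representation. -/
def repMat : Matrix (Fin n) (Fin n) (Polynomial (Module.End ℂ (Fock n R)))⟦X⟧ :=
  laxProd (glOp n R) (evalPt n R) Finset.univ.toList

theorem repMat_constantCoeff : (repMat n R).map PowerSeries.constantCoeff = 1 :=
  laxProd_constantCoeff _ _ _

theorem rtt_repMat : RTT (dd _) (ee _) ((repMat n R).map inU) ((repMat n R).map inV) :=
  rtt_laxProd (evalPt_comm n R) (glOp_rel n R) (glOp_comm n R) (Finset.nodup_toList _)

/-- The product of evaluation representations of the Yangian. -/
def rep : Yangian n →ₐ[ℂ] Polynomial (Module.End ℂ (Fock n R)) :=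
  liftMat (repMat n R) (repMat_constantCoeff n R) (rtt_repMat n R)

/-- The leading symbols of the generators in the representation. -/
def topSym (g : Fin n × Fin n × ℕ) : Fock n R :=
  ∑ k : Legs n R, (((k.2.2 : ℕ) : ℂ) ^ g.2.2) •
    if g.2.1 = k.2.1 then MvPolynomial.X (k, g.1) else 0

/-- In top degree in the deformation parameter λ, x_i(∂_j + λδ_jb) becomes multiplication by δ_jb
x_i, and the evaluation point lλ² contributes l to the power r in degree 2r. The degree is thus the
weight 2r + 1, and the leading operators are commuting multiplications. -/
theorem hasTop_rep_gen (g : Fin n × Fin n × ℕ) :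
    HasTop (rep n R (gen g)) (wt g) (mulEnd (topSym n R g)) := by
  obtain ⟨i, j, r⟩ := g
  rw [gen, rep, liftMat_t, repMat]
  have h := hasTop_laxProd (E := glOp n R) (a := evalPt n R)
    (e := fun k i j => mulEnd (if j = k.2.1 then MvPolynomial.X (k, i) else 0))
    (α := fun k => algebraMap ℂ (Module.End ℂ (Fock n R)) ((k.2.2 : ℕ) : ℂ)) ?_ ?_
    Finset.univ.toList i j r
  · convert h using 1
    · rfl
    rw [Finset.sum_map_toList, topSym, map_sum]
    refine Finset.sum_congr rfl fun k _ => ?_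
    rw [map_smul, ← map_pow, Algebra.smul_def]
  · intro k i j
    have h1 : HasTop (mulOp n R k i) 0 (mulEnd (MvPolynomial.X (k, i))) :=
      ⟨(Polynomial.natDegree_C _).le, Polynomial.coeff_C_zero⟩
    have h2 : HasTop (derOp n R k j) 1 (if j = k.2.1 then 1 else 0) := by
      rw [← zero_add (if j = k.2.1 then (1 : Module.End ℂ (Fock n R)) else 0)]
      refine HasTop.add (HasTop.of_lt (by simp)) ?_
      split_ifs
      · exact ⟨Polynomial.natDegree_X_le, Polynomial.coeff_X_one⟩
      · exact HasTop.zero _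
    have h3 := h1.mul h2
    rw [zero_add] at h3
    convert h3 using 1
    · rfl
    split_ifs <;> simp
  · intro k
    have h1 : HasTop (Polynomial.C (algebraMap ℂ (Module.End ℂ (Fock n R)) ((k.2.2 : ℕ) : ℂ))) 0
        (algebraMap ℂ (Module.End ℂ (Fock n R)) ((k.2.2 : ℕ) : ℂ)) :=
      ⟨(Polynomial.natDegree_C _).le, Polynomial.coeff_C_zero⟩
    have h2 : HasTop (Polynomial.X ^ 2 : Polynomial (Module.End ℂ (Fock n R))) 2 1 :=
      ⟨Polynomial.natDegree_X_pow_le 2, by simp⟩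
    have h3 := h1.mul h2
    rwa [zero_add, mul_one] at h3

theorem hasTop_rep_prodL (L : List (Fin n × Fin n × ℕ)) :
    HasTop (rep n R (prodL L)) (wtL L)
      (mulEnd (MvPolynomial.aeval (topSym n R) (mon L))) := by
  induction L with
  | nil => simp [HasTop]
  | cons g L ih =>
    rw [prodL_cons, wtL_cons, mon_cons, map_mul, map_mul, map_mul, MvPolynomial.aeval_X]
    exact (hasTop_rep_gen n R g).mul ih

theorem coeff_rep_of_mem {w : ℕ} {x : Yangian n} (hx : x ∈ Flt n w) :
    (rep n R x).coeff w = 0 := by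
  refine Flt_induction (p := fun x => (rep n R x).coeff w = 0) (by simp)
    (fun x y hx hy => by rw [map_add, Polynomial.coeff_add, hx, hy, add_zero])
    (fun c x hx => by rw [map_smul, Polynomial.coeff_smul, hx, smul_zero]) (fun L hL => ?_) hx
  exact Polynomial.coeff_eq_zero_of_natDegree_lt ((hasTop_rep_prodL n R L).1.trans_lt hL)

theorem coeff_rep_theta {w : ℕ} {p} (hp : p ∈ Hom n w) :
    (rep n R (theta n p)).coeff w =
      mulEnd (MvPolynomial.aeval (topSym n R) p) := by
  refine Hom_induction (p := fun p => (rep n R (theta n p)).coeff w =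
      mulEnd (MvPolynomial.aeval (topSym n R) p)) (by simp)
    (fun x y hx hy => by rw [map_add, map_add, Polynomial.coeff_add, hx, hy, map_add, map_add])
    (fun c x hx => by rw [map_smul, map_smul, Polynomial.coeff_smul, hx, map_smul, map_smul])
    (fun L hL => ?_) hp
  have h := coeff_rep_of_mem n R (theta_mon L)
  rw [map_sub, Polynomial.coeff_sub, (hasTop_rep_prodL n R L).2, sub_eq_zero, hL] at h
  exact h.symm

variable {n}

/-- For fixed (i, j) the leading symbols are power moments over the points l < R, and the
Vandermonde matrix is invertible. The point y is supported where the variable index equals the first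
index of the leg, so that each pair (i, j) has its own free values. -/
theorem exists_eval_topSym (v : Fin n × Fin n × ℕ → ℂ) :
    ∃ y : Legs n R × Fin n → ℂ, ∀ g : Fin n × Fin n × ℕ, g.2.2 < R →
      MvPolynomial.eval y (topSym n R g) = v g := by
  let V : Matrix (Fin R) (Fin R) ℂ := (Matrix.vandermonde fun l : Fin R => ((l : ℕ) : ℂ)).transpose
  have hV : IsUnit V.det := by
    rw [Matrix.det_transpose, isUnit_iff_ne_zero, Matrix.det_vandermonde_ne_zero_iff]
    intro a b h
    exact Fin.ext (Nat.cast_injective (R := ℂ) h)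
  let c : Fin n → Fin n → Fin R → ℂ := fun i j => V⁻¹.mulVec fun r => v (i, j, r)
  refine ⟨fun q => if q.2 = q.1.1 then c q.1.1 q.1.2.1 q.1.2.2 else 0, ?_⟩
  rintro ⟨i, j, r⟩ hr
  have h1 : V.mulVec (c i j) ⟨r, hr⟩ = v (i, j, r) := by
    rw [Matrix.mulVec_mulVec, Matrix.mul_nonsing_inv _ hV, Matrix.one_mulVec]
  rw [← h1, topSym, map_sum]
  simp only [Fintype.sum_prod_type, MvPolynomial.smul_eval, Matrix.mulVec, dotProduct]
  rw [Finset.sum_eq_single i, Finset.sum_eq_single j]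
  · refine Finset.sum_congr rfl fun l _ => ?_
    simp [V, Matrix.vandermonde_apply]
  · intro b _ hb
    simp [hb.symm]
  · simp
  · intro a _ ha
    refine Finset.sum_eq_zero fun b _ => Finset.sum_eq_zero fun l _ => ?_
    split_ifs <;> simp [ha.symm]
  · simp

/-- The Poincaré–Birkhoff–Witt property. The coefficient of λʷ in the representation kills lower
weight and sends the lift of p to multiplication by p at the leading symbols. For R beyond the
superscripts occurring in p these symbols take arbitrary values, so p vanishes as a function. -/
theorem eq_zero_of_theta_mem {w : ℕ} {p} (hp : p ∈ Hom n w) (h : theta n p ∈ Flt n w) :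
    p = 0 := by
  apply MvPolynomial.funext
  intro v
  obtain ⟨R, hR⟩ : ∃ R, ∀ g ∈ p.vars, g.2.2 < R :=
    ⟨p.vars.sup (fun g => g.2.2) + 1, fun g hg =>
      Nat.lt_succ_of_le (Finset.le_sup (f := fun g : Fin n × Fin n × ℕ => g.2.2) hg)⟩
  have h1 : MvPolynomial.aeval (topSym n R) p = 0 := by
    have := DFunLike.congr_fun ((coeff_rep_theta n R hp).symm.trans (coeff_rep_of_mem n R h)) 1
    rwa [mulEnd_apply, mul_one] at this
  obtain ⟨y, hy⟩ := exists_eval_topSym R v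
  rw [map_zero, ← map_zero (MvPolynomial.eval y), ← h1]
  refine MvPolynomial.hom_congr_vars (f₁ := MvPolynomial.eval v)
    (f₂ := (MvPolynomial.eval y).comp (MvPolynomial.aeval (topSym n R)).toRingHom) ?_ ?_ rfl
  · ext c; simp
  · intro g hg _
    simpa using (hy g (hR g hg)).symm

end Faithful

/-! ### The Poisson center of the symbols -/

section PoissonCenter

/-- The chain rule for a polynomial curve. -/
theorem derivative_algHom {σ : Type*} (φ : MvPolynomial σ ℂ →ₐ[ℂ] Polynomial ℂ)
    (p : MvPolynomial σ ℂ) : ∃ S : Finset σ, ∀ S', S ⊆ S' → Polynomial.derivative (φ p) =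
      ∑ a ∈ S', φ (MvPolynomial.pderiv a p) * Polynomial.derivative (φ (MvPolynomial.X a)) := by
  classical
  induction p using MvPolynomial.induction_on with
  | C c =>
    refine ⟨∅, fun S' _ => ?_⟩
    rw [← MvPolynomial.algebraMap_eq, AlgHom.commutes]
    simp
  | add p q hp hq =>
    obtain ⟨S, hS⟩ := hp
    obtain ⟨T, hT⟩ := hq
    refine ⟨S ∪ T, fun S' h => ?_⟩
    rw [map_add, Polynomial.derivative_add, hS S' (Finset.union_subset_left h),
      hT S' (Finset.union_subset_right h), ← Finset.sum_add_distrib]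
    exact Finset.sum_congr rfl fun a _ => by rw [map_add, map_add, add_mul]
  | mul_X p b hp =>
    obtain ⟨S, hS⟩ := hp
    refine ⟨insert b S, fun S' h => ?_⟩
    rw [map_mul, Polynomial.derivative_mul, hS S' ((Finset.subset_insert _ _).trans h)]
    have hb : b ∈ S' := h (Finset.mem_insert_self _ _)
    simp only [MvPolynomial.pderiv_mul, map_add, map_mul, add_mul, Finset.sum_add_distrib]
    congr 1
    · rw [Finset.sum_mul]
      exact Finset.sum_congr rfl fun a _ => by ring
    · rw [Finset.sum_eq_single_of_mem b hb]
      · simp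
      · intro a _ hab
        rw [MvPolynomial.pderiv_X_of_ne hab.symm]
        simp

variable {n : ℕ} {p : MvPolynomial (Fin n × Fin n × ℕ) ℂ}

/-- Take s above every superscript in p, so that ∂_(a,b,s+r) kills p. Its commutator with `bracket
(i, j, s)` therefore kills p too, and this commutator is δ_ia ∂_(j,b,r) − δ_jb ∂_(a,i,r).
Consequently off-diagonal partials of p vanish and diagonal ones depend only on r. -/
theorem pderiv_eq_of_bracket (hp : ∀ g, bracket g p = 0) (i j a b : Fin n) (r : ℕ) :
    (if i = a then MvPolynomial.pderiv (j, b, r) p else 0) =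
      if j = b then MvPolynomial.pderiv (a, i, r) p else 0 := by
  classical
  obtain ⟨s, hs⟩ : ∃ s, ∀ g ∈ p.vars, g.2.2 < s :=
    ⟨p.vars.sup (fun g => g.2.2) + 1, fun g hg =>
      Nat.lt_succ_of_le (Finset.le_sup (f := fun g : Fin n × Fin n × ℕ => g.2.2) hg)⟩
  have h0 : MvPolynomial.pderiv (a, b, s + r) p = 0 := by
    apply MvPolynomial.pderiv_eq_zero_of_notMem_vars
    intro h
    have := hs _ h
    simp at this
  have h1 : ⁅(MvPolynomial.pderiv (a, b, s + r) : Derivation ℂ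
      (MvPolynomial (Fin n × Fin n × ℕ) ℂ) (MvPolynomial (Fin n × Fin n × ℕ) ℂ)),
      bracket (i, j, s)⁆ = (if i = a then MvPolynomial.pderiv (j, b, r) else 0) -
        if j = b then MvPolynomial.pderiv (a, i, r) else 0 := by
    apply MvPolynomial.derivation_ext
    rintro ⟨k, l, m⟩
    have h2 : bracket (i, j, s) (MvPolynomial.pderiv (a, b, s + r)
        (MvPolynomial.X (R := ℂ) (k, l, m))) = 0 := by
      rw [MvPolynomial.pderiv_X, Pi.single_apply]
      split_ifs <;> simp
    rw [Derivation.commutator_apply, h2, bracket_X, sub_zero, map_sub, Derivation.sub_apply]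
    congr 1
    · by_cases h3 : k = j
      · by_cases h4 : i = a
        · subst h3 h4
          simp [MvPolynomial.pderiv_X, Pi.single_apply]
        · simp [h3, h4, MvPolynomial.pderiv_X]
      · by_cases h4 : i = a
        · simp [h3, h4, MvPolynomial.pderiv_X]
        · simp [h3, h4]
    · by_cases h3 : i = l
      · by_cases h4 : j = b
        · subst h3 h4
          simp [MvPolynomial.pderiv_X, Pi.single_apply]
        · simp [h3, h4, MvPolynomial.pderiv_X]
      · by_cases h4 : j = b
        · simp [h3, Ne.symm h3, h4, MvPolynomial.pderiv_X]
        · simp [h3, h4]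
  have h3 := DFunLike.congr_fun h1 p
  rw [Derivation.commutator_apply, hp, h0, map_zero, map_zero, sub_zero, Derivation.sub_apply] at h3
  have h4 := sub_eq_zero.1 h3.symm
  split_ifs at h4 ⊢ <;> exact h4

/-- The substitution that keeps only the traces of the generators. -/
def average (n : ℕ) :
    MvPolynomial (Fin n × Fin n × ℕ) ℂ →ₐ[ℂ] MvPolynomial (Fin n × Fin n × ℕ) ℂ :=
  MvPolynomial.aeval fun g =>
    if g.1 = g.2.1 then (1 / n : ℂ) • ∑ j, MvPolynomial.X (j, j, g.2.2) else 0

theorem average_X (g : Fin n × Fin n × ℕ) : average n (MvPolynomial.X g) =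
    if g.1 = g.2.1 then (1 / n : ℂ) • ∑ j, MvPolynomial.X (j, j, g.2.2) else 0 := by
  rw [average, MvPolynomial.aeval_X]

/-- Join a point v to its average v' by a segment. By `pderiv_eq_of_bracket` the derivative of p
along it involves only the differences of the traces of v' and v, which are zero, so p(v) = p(v').
-/
theorem average_eq_self (hn : 0 < n) (hp : ∀ g, bracket g p = 0) : average n p = p := by
  classical
  apply MvPolynomial.funext
  intro v
  set v' : Fin n × Fin n × ℕ → ℂ := fun g =>
    if g.1 = g.2.1 then (1 / n : ℂ) * ∑ j, v (j, j, g.2.2) else 0 with hv'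
  let φ : MvPolynomial (Fin n × Fin n × ℕ) ℂ →ₐ[ℂ] Polynomial ℂ :=
    MvPolynomial.aeval fun g => Polynomial.C (v g) + Polynomial.C (v' g - v g) * Polynomial.X
  have hφX : ∀ g, Polynomial.derivative (φ (MvPolynomial.X g)) = Polynomial.C (v' g - v g) := by
    intro g
    simp [φ]
  have hd : Polynomial.derivative (φ p) = 0 := by
    obtain ⟨S, hS⟩ := derivative_algHom φ p
    obtain ⟨R, hR⟩ : ∃ R, ∀ g ∈ S, g.2.2 < R :=
      ⟨S.sup (fun g => g.2.2) + 1, fun g hg =>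
        Nat.lt_succ_of_le (Finset.le_sup (f := fun g : Fin n × Fin n × ℕ => g.2.2) hg)⟩
    rw [hS (Finset.univ ×ˢ Finset.univ ×ˢ Finset.range R) fun g hg => by simp [hR g hg]]
    simp only [Finset.sum_product, hφX]
    have h1 : ∀ i j r, φ (MvPolynomial.pderiv (i, j, r) p) * Polynomial.C (v' (i, j, r) - v (i, j, r))
        = if i = j then φ (MvPolynomial.pderiv (⟨0, hn⟩, ⟨0, hn⟩, r) p) *
          Polynomial.C (v' (i, i, r) - v (i, i, r)) else 0 := by
      intro i j r
      by_cases h : i = j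
      · subst h
        have := pderiv_eq_of_bracket hp i ⟨0, hn⟩ i ⟨0, hn⟩ r
        rw [if_pos rfl, if_pos rfl] at this
        rw [if_pos rfl, this]
      · have := pderiv_eq_of_bracket hp i i i j r
        rw [if_pos rfl, if_neg h] at this
        rw [if_neg h, this, map_zero, zero_mul]
    simp only [h1]
    have h2 : ∀ i : Fin n, ∑ j : Fin n, ∑ r ∈ Finset.range R, (if i = j then
        φ (MvPolynomial.pderiv (⟨0, hn⟩, ⟨0, hn⟩, r) p) *
          Polynomial.C (v' (i, i, r) - v (i, i, r)) else 0) = ∑ r ∈ Finset.range R,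
        φ (MvPolynomial.pderiv (⟨0, hn⟩, ⟨0, hn⟩, r) p) *
          Polynomial.C (v' (i, i, r) - v (i, i, r)) := by
      intro i
      rw [Finset.sum_comm]
      simp
    rw [Finset.sum_congr rfl fun i _ => h2 i, Finset.sum_comm]
    refine Finset.sum_eq_zero fun r _ => ?_
    rw [← Finset.mul_sum, ← map_sum, Finset.sum_sub_distrib]
    have h3 : ∑ i : Fin n, v' (i, i, r) = ∑ i, v (i, i, r) := by
      simp only [hv', if_true, Finset.sum_const, Finset.card_univ, Fintype.card_fin, nsmul_eq_mul]
      rw [← mul_assoc, mul_one_div_cancel (by exact_mod_cast hn.ne'), one_mul]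
    rw [h3, sub_self, map_zero, mul_zero]
  have hc := Polynomial.eq_C_of_natDegree_eq_zero
    (Polynomial.derivative_eq_zero.1 hd)
  have h0 : ∀ x : ℂ, Polynomial.eval x (φ p) =
      MvPolynomial.eval (fun g => v g + (v' g - v g) * x) p := by
    intro x
    have : (Polynomial.aeval x).comp φ =
        MvPolynomial.aeval (R := ℂ) (fun g => v g + (v' g - v g) * x) := by
      apply MvPolynomial.algHom_ext
      intro g
      simp [φ]
    have h := DFunLike.congr_fun this p
    rw [AlgHom.comp_apply, Polynomial.coe_aeval_eq_eval] at h
    rw [h, MvPolynomial.aeval_eq_eval]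
  have h1 : MvPolynomial.eval v (average n p) = MvPolynomial.eval v' p := by
    have : (MvPolynomial.aeval (R := ℂ) v).comp (average n) = MvPolynomial.aeval v' := by
      apply MvPolynomial.algHom_ext
      intro g
      rw [AlgHom.comp_apply, average_X, MvPolynomial.aeval_X]
      simp only [hv']
      split_ifs <;> simp
    have h := DFunLike.congr_fun this p
    rwa [AlgHom.comp_apply, MvPolynomial.aeval_eq_eval, MvPolynomial.aeval_eq_eval] at h
  have h2 := h0 0
  have h3 := h0 1
  rw [hc, Polynomial.eval_C] at h2 h3
  rw [h1]
  simpa using h3.symm.trans h2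

end PoissonCenter

/-! ### The center -/

/-! ### Weights of series and the leading part of the quantum determinant -/

section SeriesFiltration

variable {n : ℕ}

/-- The series `∑ f_r u^{-r}` in which `f_r` has weight at most `2r - k`. -/
def SerFlt (n k : ℕ) : Submodule ℂ (Yangian n)⟦X⟧ where
  -- For 2r + 1 ≤ k the truncated difference is 0, and `Flt n 0` forces the coefficient to vanish.
  carrier := {f | ∀ r, coeff r f ∈ Flt n (2 * r + 1 - k)}
  zero_mem' r := by rw [map_zero]; exact zero_mem _
  add_mem' hf hg r := by rw [map_add]; exact add_mem (hf r) (hg r)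
  smul_mem' c f hf r := by rw [coeff_smul]; exact Submodule.smul_mem _ c (hf r)

theorem SerFlt_mono {k l : ℕ} (h : k ≤ l) : SerFlt n l ≤ SerFlt n k :=
  fun _ hf r => Flt_mono (by omega) (hf r)

theorem SerFlt_mul {k l : ℕ} {f g : (Yangian n)⟦X⟧} (hf : f ∈ SerFlt n k) (hg : g ∈ SerFlt n l) :
    f * g ∈ SerFlt n (k + l) := by
  intro r
  rw [coeff_mul]
  refine Submodule.sum_mem _ fun p hp => ?_
  rw [Finset.HasAntidiagonal.mem_antidiagonal] at hp
  exact mul_mem_of_words (fun a b ha hb => by omega) (hf p.1) (hg p.2)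

theorem one_mem_SerFlt : (1 : (Yangian n)⟦X⟧) ∈ SerFlt n 0 := by
  intro r
  rw [coeff_one]
  split_ifs
  · exact one_mem_Flt (by omega)
  · exact zero_mem _

theorem SerFlt_shift {k : ℕ} (a : ℂ) {f : (Yangian n)⟦X⟧} (hf : f ∈ SerFlt n k) :
    shift a f ∈ SerFlt n k := by
  intro m
  rw [shift, coeff_mk]
  refine Submodule.sum_mem _ fun r hr => Submodule.smul_mem _ _ (Flt_mono ?_ (hf r))
  rw [Finset.mem_range] at hr
  omega

/-- The term of the same index cancels, and every other contribution comes from a smaller index,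
each step of which is worth 2 in weight. -/
theorem SerFlt_shift_sub {k : ℕ} (a : ℂ) {f : (Yangian n)⟦X⟧} (hf : f ∈ SerFlt n k) :
    shift a f - f ∈ SerFlt n (k + 2) := by
  intro m
  rw [map_sub, coeff_shift, Finset.sum_range_succ, coeff_invShift_pow_self, one_smul,
    add_sub_cancel_right]
  refine Submodule.sum_mem _ fun r hr => Submodule.smul_mem _ _ (Flt_mono ?_ (hf r))
  rw [Finset.mem_range] at hr
  omega

theorem T_sub_mem_SerFlt (i j : Fin n) : T n i j - (if i = j then 1 else 0) ∈ SerFlt n 1 := by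
  intro r
  rcases r with _ | r
  · rw [map_sub, T, Matrix.of_apply, coeff_mk, t_zero]
    split_ifs <;> simp
  · have h : coeff (r + 1) (if i = j then (1 : (Yangian n)⟦X⟧) else 0) = 0 := by
      split_ifs
      · rw [coeff_one, if_neg (by omega)]
      · rw [map_zero]
    rw [map_sub, h, sub_zero, T, Matrix.of_apply, coeff_mk]
    exact Flt_mono (by simp [wt]; omega) (gen_mem (i, j, r))

theorem T_mem_SerFlt (i j : Fin n) : T n i j ∈ SerFlt n (if i = j then 0 else 1) := by
  have h := T_sub_mem_SerFlt i j
  split_ifs at h ⊢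
  · simpa using add_mem (SerFlt_mono (Nat.zero_le 1) h) one_mem_SerFlt
  · rwa [sub_zero] at h

theorem list_prod_mem_SerFlt {ι : Type*} {f : ι → (Yangian n)⟦X⟧} {k : ι → ℕ}
    (h : ∀ a, f a ∈ SerFlt n (k a)) (l : List ι) :
    (l.map f).prod ∈ SerFlt n (l.map k).sum := by
  induction l with
  | nil => exact one_mem_SerFlt
  | cons a l ih => exact SerFlt_mul (h a) ih

theorem list_prod_sub_mem_SerFlt {ι : Type*} {f : ι → (Yangian n)⟦X⟧}
    (h : ∀ a, f a - 1 ∈ SerFlt n 1) (l : List ι) :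
    (l.map f).prod - (1 + (l.map fun a => f a - 1).sum) ∈ SerFlt n 2 := by
  have h0 : ∀ a, f a ∈ SerFlt n 0 := fun a => by
    simpa using add_mem (SerFlt_mono (Nat.zero_le 1) (h a)) one_mem_SerFlt
  induction l with
  | nil => simp
  | cons a l ih =>
    have h1 : (l.map fun a => f a - 1).sum ∈ SerFlt n 1 := by
      refine list_sum_mem fun x hx => ?_
      obtain ⟨b, _, rfl⟩ := List.mem_map.1 hx
      exact h b
    have h2 : (f a - 1) * (l.map fun a => f a - 1).sum ∈ SerFlt n (1 + 1) :=
      SerFlt_mul (h a) h1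
    have h3 := SerFlt_mul (h0 a) ih
    rw [zero_add] at h3
    have h2 := add_mem h3 h2
    convert h2 using 1
    rw [List.map_cons, List.prod_cons, List.map_cons, List.sum_cons]
    noncomm_ring

/-- A permutation other than 1 moves at least two points and so has two off-diagonal factors, each
gaining 1. For the identity, products of two factors t_ii − 1 gain 2, and so does the removal of a
shift. -/
theorem qdet_sub_mem_SerFlt (n : ℕ) :
    qdet n - (1 + ∑ i, (T n i i - 1)) ∈ SerFlt n 2 := by
  have hT : ∀ i j (a : ℂ), shift a (T n i j) ∈ SerFlt n (if i = j then 0 else 1) :=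
    fun i j a => SerFlt_shift a (T_mem_SerFlt i j)
  have h1 : tProd (id : Fin n → Fin n) id - (1 + ∑ i, (T n i i - 1)) ∈ SerFlt n 2 := by
    have h2 : ∀ i : Fin n, shift (-((i : ℕ) : ℂ)) (T n i i) - 1 ∈ SerFlt n 1 := by
      intro i
      have h3 := SerFlt_shift (-((i : ℕ) : ℂ)) (T_sub_mem_SerFlt i i)
      rwa [if_pos rfl, shift_sub', shift_one] at h3
    have h3 := list_prod_sub_mem_SerFlt h2 (List.finRange n)
    have h4 : ((List.finRange n).map fun i : Fin n => shift (-((i : ℕ) : ℂ)) (T n i i) - 1).sum -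
        ∑ i, (T n i i - 1) ∈ SerFlt n 2 := by
      rw [← List.ofFn_eq_map, List.sum_ofFn, ← Finset.sum_sub_distrib]
      refine Submodule.sum_mem _ fun i _ => ?_
      have h5 := SerFlt_shift_sub (-((i : ℕ) : ℂ)) (T_mem_SerFlt i i)
      rw [if_pos rfl] at h5
      simpa using h5
    have h5 := add_mem h3 h4
    convert h5 using 1
    simp only [tProd, id]
    abel
  rw [qdet_eq_sum, ← Finset.add_sum_erase _ _ (Finset.mem_univ 1)]
  have h2 : ∀ σ ∈ Finset.univ.erase (1 : Equiv.Perm (Fin n)),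
      ((Equiv.Perm.sign σ : ℤˣ) : ℤ) • tProd (n := n) σ id ∈ SerFlt n 2 := by
    intro σ hσ
    rw [← Int.cast_smul_eq_zsmul ℂ]
    refine Submodule.smul_mem _ _ (SerFlt_mono ?_
      (list_prod_mem_SerFlt (fun a => hT (σ a) (id a) _) (List.finRange n)))
    rw [← List.ofFn_eq_map, List.sum_ofFn]
    have h3 := Equiv.Perm.two_le_card_support_of_ne_one (Finset.ne_of_mem_erase hσ)
    refine h3.trans (le_of_eq ?_)
    rw [Equiv.Perm.support, Finset.card_filter]
    exact Finset.sum_congr rfl fun a _ => by simp [ite_not]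
  have h3 := add_mem h1 (Submodule.sum_mem _ h2)
  convert h3 using 1
  rw [Equiv.Perm.sign_one, Units.val_one, one_smul, Equiv.Perm.coe_one]
  abel

theorem coeff_qdet_sub_mem (r : ℕ) :
    coeff (r + 1) (qdet n) - ∑ i, gen (i, i, r) ∈ Flt n (2 * r + 1) := by
  have h := qdet_sub_mem_SerFlt n (r + 1)
  have h1 : coeff (r + 1) (1 + ∑ i, (T n i i - 1)) = ∑ i, gen (i, i, r) := by
    rw [map_add, map_sum, coeff_one, if_neg (by omega), zero_add]
    refine Finset.sum_congr rfl fun i _ => ?_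
    rw [map_sub, coeff_one, if_neg (by omega), sub_zero, T, Matrix.of_apply, coeff_mk, gen]
  rw [map_sub, h1] at h
  exact Flt_mono (by omega) h

theorem coeff_qdet_mem_Flt (r : ℕ) : coeff (r + 1) (qdet n) ∈ Flt n (2 * r + 2) := by
  have h : ∑ i : Fin n, gen (i, i, r) ∈ Flt n (2 * r + 2) :=
    Submodule.sum_mem _ fun i _ => gen_mem (i, i, r)
  rw [← sub_add_cancel (coeff (r + 1) (qdet n)) (∑ i, gen (i, i, r))]
  exact add_mem (Flt_mono (by omega) (coeff_qdet_sub_mem r)) h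

theorem qdet_mem_SerFlt (n : ℕ) : qdet n ∈ SerFlt n 0 := by
  have h1 : ∀ i, T n i i - 1 ∈ SerFlt n 0 := by
    intro i
    have h2 := T_sub_mem_SerFlt i i
    rw [if_pos rfl] at h2
    exact SerFlt_mono (Nat.zero_le 1) h2
  have h2 : ∑ i, (T n i i - 1) ∈ SerFlt n 0 := Submodule.sum_mem _ fun i _ => h1 i
  rw [← sub_add_cancel (qdet n) (1 + ∑ i, (T n i i - 1))]
  exact add_mem (SerFlt_mono (Nat.zero_le 2) (qdet_sub_mem_SerFlt n))
    (add_mem one_mem_SerFlt h2)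

theorem mem_SerFlt_of_mul {k : ℕ} {f g : (Yangian n)⟦X⟧} (hf : f ∈ SerFlt n 0)
    (h0 : constantCoeff f = 1) (h : f * g ∈ SerFlt n k) : g ∈ SerFlt n k := by
  intro r
  induction r using Nat.strong_induction_on with
  | _ r ih =>
    have h1 := h r
    rw [coeff_mul, ← Finset.add_sum_erase _ _
      (show (0, r) ∈ Finset.HasAntidiagonal.antidiagonal r by simp),
      coeff_zero_eq_constantCoeff_apply, h0, one_mul] at h1
    refine (Submodule.add_mem_iff_left _ (Submodule.sum_mem _ fun p hp => ?_)).1 h1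
    obtain ⟨p, q⟩ := p
    rw [Finset.mem_erase, Finset.HasAntidiagonal.mem_antidiagonal] at hp
    have hpq : p ≠ 0 := by
      rintro rfl
      apply hp.1
      simpa using hp.2
    refine mul_mem_of_words (fun a b ha hb => ?_) (hf p) (ih q (by omega))
    omega

/-- By the Liouville formula qdet T(u)·(z(u) − 1) = qdet T(u − 1) − qdet T(u), a shift difference.
-/
theorem z_sub_one_mem_SerFlt (hn : 0 < n) : z n - 1 ∈ SerFlt n 2 := by
  refine mem_SerFlt_of_mul (qdet_mem_SerFlt n) (constantCoeff_qdet n) ?_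
  rw [mul_sub, ← shift_qdet hn, mul_one]
  exact SerFlt_shift_sub _ (qdet_mem_SerFlt n)

end SeriesFiltration

/-! ### The center as the algebra generated by the quantum determinant -/

section Center

variable {n : ℕ}

/-- The subalgebra generated by the coefficients of the quantum determinant. -/
def qdetAlg (n : ℕ) : Subalgebra ℂ (Yangian n) :=
  Algebra.adjoin ℂ (Set.range fun r => coeff r (qdet n))

/-- `average` turns each diagonal variable into 1/n times a trace, and that trace is the leading
symbol of a coefficient of qdet. Multiplying these coefficients lifts the averaged monomial. -/
theorem exists_qdetAlg_mon (L : List (Fin n × Fin n × ℕ)) :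
    average n (mon L) ∈ Hom n (wtL L) ∧ ∃ q ∈ qdetAlg n, q ∈ Flt n (wtL L + 1) ∧
      q - theta n (average n (mon L)) ∈ Flt n (wtL L) := by
  induction L with
  | nil =>
    rw [mon_nil, map_one]
    refine ⟨mon_mem rfl, 1, one_mem _, one_mem_Flt (by omega), ?_⟩
    have := theta_mon (n := n) []
    rwa [mon_nil, prodL_nil] at this
  | cons g L ih =>
    obtain ⟨hL, q, hq, hq1, hq2⟩ := ih
    rw [mon_cons, map_mul, average_X, wtL_cons]
    split_ifs with hg
    · have hw : ∀ j : Fin n, wt (j, j, g.2.2) = wt g := fun j => rfl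
      rw [smul_mul_assoc, Finset.sum_mul]
      refine ⟨Submodule.smul_mem _ _ (Submodule.sum_mem _ fun j _ => hw j ▸ X_mul_mem _ hL),
        ((1 / n : ℂ) • coeff (g.2.2 + 1) (qdet n)) * q,
        mul_mem (Subalgebra.smul_mem _ (Algebra.subset_adjoin (Set.mem_range_self _)) _) hq, ?_, ?_⟩
      · rw [smul_mul_assoc]
        exact Submodule.smul_mem _ _ (mul_mem_of_words (fun a b ha hb => by rw [wt]; omega)
          (coeff_qdet_mem_Flt g.2.2) hq1)
      · have h1 := mul_mem_right (coeff_qdet_sub_mem g.2.2) hq1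
        have h2 : ∀ j : Fin n, gen (j, j, g.2.2) * q - theta n (MvPolynomial.X (j, j, g.2.2) *
            average n (mon L)) ∈ Flt n (wt g + wtL L) := by
          intro j
          have h3 := add_mem (mul_mem_left (gen_mem (j, j, g.2.2)) hq2)
            (theta_X_mul (j, j, g.2.2) hL)
          rwa [mul_sub, sub_add_sub_cancel] at h3
        have h3 := Submodule.smul_mem _ (1 / n : ℂ)
          (add_mem h1 (Submodule.sum_mem _ fun j (_ : j ∈ Finset.univ) => h2 j))
        convert h3 using 1
        · rfl
        rw [map_smul, smul_mul_assoc, ← smul_sub, Finset.sum_sub_distrib, map_sum, sub_mul,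
          Finset.sum_mul, sub_add_sub_cancel]
    · rw [zero_mul]
      exact ⟨zero_mem _, 0, zero_mem _, zero_mem _, by simp⟩

theorem exists_qdetAlg {w : ℕ} {p} (hp : p ∈ Hom n w) :
    ∃ q ∈ qdetAlg n, q - theta n (average n p) ∈ Flt n w := by
  refine Hom_induction (p := fun p => ∃ q ∈ qdetAlg n, q - theta n (average n p) ∈ Flt n w)
    ⟨0, zero_mem _, by simp⟩ ?_ ?_ (fun L hL => ?_) hp
  · rintro x y ⟨q, hq, hx⟩ ⟨q', hq', hy⟩
    refine ⟨q + q', add_mem hq hq', ?_⟩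
    rw [map_add, map_add, add_sub_add_comm]
    exact add_mem hx hy
  · rintro c x ⟨q, hq, hx⟩
    refine ⟨c • q, Subalgebra.smul_mem _ hq _, ?_⟩
    rw [map_smul, map_smul, ← smul_sub]
    exact Submodule.smul_mem _ _ hx
  · obtain ⟨_, q, hq, _, h⟩ := exists_qdetAlg_mon L
    exact ⟨q, hq, hL ▸ h⟩

theorem qdetAlg_le_center (hn : 0 < n) : qdetAlg n ≤ Subalgebra.center ℂ (Yangian n) :=
  Algebra.adjoin_le (Set.range_subset_iff.2 (qdet_mem_center hn))

/-- The commutator of x with a generator is zero, whereas its leading symbol is, up to sign, the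
bracket of p; `eq_zero_of_theta_mem` turns this into an identity of polynomials. -/
theorem bracket_eq_zero_of_central {w : ℕ} {p} (hp : p ∈ Hom n w) {x : Yangian n}
    (hx : x ∈ Subalgebra.center ℂ (Yangian n)) (h : x - theta n p ∈ Flt n w)
    (g : Fin n × Fin n × ℕ) : bracket g p = 0 := by
  obtain ⟨i, j, s⟩ := g
  obtain ⟨h1, h2⟩ := bracket_theta i j s hp
  refine eq_zero_of_theta_mem h1 ?_
  have h3 := gen_commutator_mem i j s h
  have h4 := (Subalgebra.mem_center_iff.1 hx (gen (i, j, s)))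
  have h5 := neg_mem (add_mem h3 h2)
  convert h5 using 1
  rw [mul_sub, sub_mul, h4]
  abel

/-- Induction on weight: the symbol of a central x is Poisson central, hence equal to its average,
hence also the symbol of some q in `qdetAlg`. The difference x − q is central of smaller weight. -/
theorem center_le_qdetAlg (hn : 0 < n) : Subalgebra.center ℂ (Yangian n) ≤ qdetAlg n := by
  intro x hx
  obtain ⟨w, hw⟩ := exists_mem_Flt x
  induction w generalizing x with
  | zero =>
    rw [Flt_zero, Submodule.mem_bot] at hw
    rw [hw]
    exact zero_mem _
  | succ w ih =>
    obtain ⟨p, hp, hxp⟩ := exists_symbol hw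
    obtain ⟨q, hq, hqp⟩ := exists_qdetAlg hp
    rw [average_eq_self hn (bracket_eq_zero_of_central hp hx hxp)] at hqp
    have h := ih (sub_mem hx (qdetAlg_le_center hn hq)) (by simpa using sub_mem hxp hqp)
    simpa using add_mem h hq

/-- The subalgebra generated by the coefficients of `z(u)` is the center. -/
theorem adjoin_z_eq_center (hn : 0 < n) :
    Algebra.adjoin ℂ (Set.range fun r => coeff (r + 2) (z n)) =
      Subalgebra.center ℂ (Yangian n) := by
  apply le_antisymm
  · exact Algebra.adjoin_le (Set.range_subset_iff.2 fun r => z_mem_center hn _)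
  · exact (center_le_qdetAlg hn).trans
      (Algebra.adjoin_le (Set.range_subset_iff.2 (qdet_mem_adjoin hn)))

end Center

/-! ### Algebraic independence -/

section Independence

variable {K : Type*} [CommRing K] [Algebra ℂ K]

/-- The coefficients of a solution of `f(u - n) = f(u) g(u)`. -/
def shiftSolution (n : ℕ) (g : K⟦X⟧) : ℕ → K
  | 0 => 1
  -- Comparison of the coefficients of index m + 2: the unknown f_{m+2} cancels because g has
  -- constant term 1, and since g has no u⁻¹ term, f_{m+1} remains with factor (m + 1)n.
  | m + 1 => (1 / ((m + 1 : ℕ) * n) : ℂ) • ∑ r : Fin (m + 1),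
      (shiftSolution n g r * coeff (m + 2 - r) g -
        coeff (m + 2) (invShift (-(n : ℂ)) ^ (r : ℕ)) • shiftSolution n g r)

theorem exists_shift_eq_mul {n : ℕ} (hn : 0 < n) {g : K⟦X⟧} (h0 : coeff 0 g = 1)
    (h1 : coeff 1 g = 0) : ∃ f : K⟦X⟧, constantCoeff f = 1 ∧ shift (-(n : ℂ)) f = f * g := by
  have hf : constantCoeff (PowerSeries.mk (shiftSolution n g)) = 1 := by
    rw [← coeff_zero_eq_constantCoeff_apply, coeff_mk, shiftSolution]
  refine ⟨PowerSeries.mk (shiftSolution n g), hf, ?_⟩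
  set f := PowerSeries.mk (shiftSolution n g) with hf'
  ext m
  rcases m with _ | m
  · rw [coeff_zero_eq_constantCoeff_apply, constantCoeff_shift, hf,
      coeff_zero_eq_constantCoeff_apply, map_mul, hf, ← coeff_zero_eq_constantCoeff_apply, h0,
      one_mul]
  · have h2 : coeff (m + 1) (f * g) = ∑ r ∈ Finset.range m, coeff r f * coeff (m + 1 - r) g +
        coeff (m + 1) f := by
      rw [coeff_mul, Finset.Nat.sum_antidiagonal_eq_sum_range_succ
        (fun p q => coeff p f * coeff q g), Finset.sum_range_succ, Finset.sum_range_succ,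
        Nat.sub_self, h0, mul_one, Nat.add_sub_cancel_left, h1, mul_zero, add_zero]
    rw [coeff_shift_succ, h2]
    congr 1
    rcases m with _ | m
    · simp
    · have h3 : coeff (m + 1) f = (1 / ((m + 1 : ℕ) * n) : ℂ) • ∑ r ∈ Finset.range (m + 1),
          (coeff r f * coeff (m + 2 - r) g -
            coeff (m + 2) (invShift (-(n : ℂ)) ^ r) • coeff r f) := by
        rw [hf', coeff_mk, shiftSolution, Finset.sum_range]
        simp only [coeff_mk]
      have h4 : ((m + 1 : ℕ) * (n : ℂ)) ≠ 0 :=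
        mul_ne_zero (Nat.cast_ne_zero.2 m.succ_ne_zero) (Nat.cast_ne_zero.2 hn.ne')
      rw [h3, mul_neg, neg_neg, smul_smul, mul_one_div_cancel h4, one_smul,
        Finset.sum_sub_distrib, add_sub_cancel]

theorem rtt_diagonal {K : Type*} [CommRing K] {n : ℕ} (f : K⟦X⟧) :
    RTT (dd K) (ee K) ((Matrix.diagonal fun _ : Fin n => f).map inU)
      ((Matrix.diagonal fun _ : Fin n => f).map inV) := by
  intro i j k l
  simp only [Matrix.map_apply, Matrix.diagonal_apply]
  rw [mul_comm (inU _), sub_self, mul_zero]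
  split_ifs <;> simp [mul_comm]

/-- The one-dimensional representations of the Yangian. -/
def scalarRep {n : ℕ} (f : K⟦X⟧) (hf : constantCoeff f = 1) : Yangian n →ₐ[ℂ] K :=
  liftMat (Matrix.diagonal fun _ => f) (by
    ext i j
    rw [Matrix.map_apply, Matrix.diagonal_apply, Matrix.one_apply]
    split_ifs
    · exact hf
    · exact map_zero _) (rtt_diagonal f)

/-- When T(u) acts as f(u)·1, the normalized trace defining z(u)⁻¹ becomes f(u)/f(u − n). -/
theorem map_scalarRep_z {n : ℕ} (hn : 0 < n) {f g : K⟦X⟧} (hf : constantCoeff f = 1)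
    (hfg : shift (-(n : ℂ)) f = f * g) :
    PowerSeries.map (scalarRep (n := n) f hf).toRingHom (z n) = g := by
  set ψ := scalarRep (n := n) f hf with hψ
  obtain ⟨f', hf'⟩ : ∃ f', f * f' = 1 :=
    (PowerSeries.isUnit_iff_constantCoeff.2 (hf ▸ isUnit_one)).exists_right_inv
  have hT : (T n).map (PowerSeries.map ψ.toRingHom) = Matrix.diagonal fun _ => f := by
    ext i j r
    rw [Matrix.map_apply, coeff_map, coeff_T]
    exact liftMat_t _ _ _ i j r
  have hT' : (Tinv n).map (PowerSeries.map ψ.toRingHom) = Matrix.diagonal fun _ => f' := by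
    have h1 := congrArg (fun M => M.map (PowerSeries.map ψ.toRingHom)) (T_mul_Tinv n)
    simp only [Matrix.map_mul, hT] at h1
    rw [Matrix.map_one _ (map_zero _) (map_one _)] at h1
    have h2 : (Matrix.diagonal fun _ : Fin n => f') * Matrix.diagonal (fun _ => f) = 1 := by
      rw [Matrix.diagonal_mul_diagonal, mul_comm, hf', Matrix.diagonal_one]
    exact (left_inv_eq_right_inv h2 h1).symm
  have hw : PowerSeries.map ψ.toRingHom (zInv n) = f * shift (-(n : ℂ)) f' := by
    have h1 : ∀ i, PowerSeries.map ψ.toRingHom ((T n * (Tinv n).map (shift (-(n : ℂ)))) i i) =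
        f * shift (-(n : ℂ)) f' := by
      intro i
      have h2 : ((T n * (Tinv n).map (shift (-(n : ℂ)))).map (PowerSeries.map ψ.toRingHom)) =
          Matrix.diagonal fun _ => f * shift (-(n : ℂ)) f' := by
        rw [Matrix.map_mul, hT, ← Matrix.diagonal_mul_diagonal]
        congr 1
        ext1 i j
        have h3 := congrFun (congrFun hT' i) j
        rw [Matrix.map_apply] at h3
        rw [Matrix.map_apply, Matrix.map_apply]
        refine (map_shift ψ _ _).trans ((congrArg _ h3).trans ?_)
        rw [Matrix.diagonal_apply, Matrix.diagonal_apply]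
        split_ifs
        · rfl
        · exact shift_zero_series _
      simpa using congrFun (congrFun h2 i) i
    have h2 : PowerSeries.map ψ.toRingHom (zInv n) = (1 / n : ℂ) •
        ∑ i, PowerSeries.map ψ.toRingHom ((T n * (Tinv n).map (shift (-(n : ℂ)))) i i) := by
      rw [zInv, ← map_sum]
      ext r
      rw [coeff_map, coeff_smul, coeff_smul, coeff_map]
      exact map_smul ψ _ _
    rw [h2, Finset.sum_congr rfl fun i _ => h1 i, Finset.sum_const, Finset.card_univ,
      Fintype.card_fin, ← Nat.cast_smul_eq_nsmul ℂ, smul_smul,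
      one_div_mul_cancel (Nat.cast_ne_zero.2 hn.ne'), one_smul]
  have h1 := congrArg (PowerSeries.map ψ.toRingHom) (z_mul_zInv hn)
  rw [map_mul, hw, map_one] at h1
  refine left_inv_eq_right_inv h1 ?_
  rw [mul_right_comm, ← hfg, ← shift_mul, hf', shift_one]

/-- The coefficient of `u^{-r-2}` in `z(u)`, as an element of the center. -/
def zCentral {n : ℕ} (hn : 0 < n) (r : ℕ) : Subalgebra.center ℂ (Yangian n) :=
  ⟨coeff (r + 2) (z n), z_mem_center hn _⟩

/-- Specialize to the generic series g whose coefficients from u⁻² on are independent variables.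
Some scalar representation sends z(u) to g, and a relation among the coefficients of z would pass to
the variables. -/
theorem algebraicIndependent_zCentral {n : ℕ} (hn : 0 < n) :
    AlgebraicIndependent ℂ (zCentral hn) := by
  let g : (MvPolynomial ℕ ℂ)⟦X⟧ := PowerSeries.mk fun
    | 0 => 1
    | 1 => 0
    | r + 2 => MvPolynomial.X r
  obtain ⟨f, hf, hfg⟩ := exists_shift_eq_mul hn (g := g) (by simp [g]) (by simp [g])
  have hz := map_scalarRep_z hn hf hfg
  refine AlgebraicIndependent.of_comp
    ((scalarRep (n := n) f hf).comp (Subalgebra.center ℂ (Yangian n)).val) ?_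
  convert MvPolynomial.algebraicIndependent_X ℕ ℂ using 1
  funext r
  have h := congrArg (coeff (r + 2)) hz
  rw [coeff_map, coeff_mk] at h
  exact h

theorem adjoin_zCentral {n : ℕ} (hn : 0 < n) :
    Algebra.adjoin ℂ (Set.range (zCentral hn)) = ⊤ := by
  rw [eq_top_iff]
  intro x _
  have h : (x : Yangian n) ∈ Algebra.adjoin ℂ (Set.range fun r => coeff (r + 2) (z n)) := by
    rw [adjoin_z_eq_center hn]
    exact x.2
  have h1 : (Algebra.adjoin ℂ (Set.range (zCentral hn))).map
      (Subalgebra.center ℂ (Yangian n)).val =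
      Algebra.adjoin ℂ (Set.range fun r => coeff (r + 2) (z n)) := by
    rw [AlgHom.map_adjoin, ← Set.range_comp]
    rfl
  rw [← h1] at h
  obtain ⟨y, hy, hyx⟩ := h
  exact Subtype.ext hyx ▸ hy

end Independence

/-! ### The square of the antipode -/

section AntipodeSquare

variable {n : ℕ}

/-- The square of the antipode. -/
def antipodeSq (n : ℕ) : Yangian n →ₐ[ℂ] Yangian n :=
  AlgHom.ofLinearMap (antipodeLin n ∘ₗ antipodeLin n)
    (by rw [LinearMap.comp_apply, antipodeLin_one, antipodeLin_one])
    fun x y => by simp only [LinearMap.comp_apply, antipodeLin_mul]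

/-- The antipode applied to T T⁻¹ = 1. It reverses products, which is why the indices are contracted
in transposed position. -/
theorem sum_antipodeSq_T_mul_Tinv (i j : Fin n) :
    ∑ a, PowerSeries.map (antipodeSq n).toRingHom (T n a j) * Tinv n i a =
      if i = j then 1 else 0 := by
  ext r
  have h := congrArg (fun f => antipodeLin n (coeff r f)) (congrFun (congrFun (T_mul_Tinv n) i) j)
  simp only [Matrix.mul_apply, map_sum, coeff_mul, antipodeLin_mul, coeff_T, antipodeLin_t] at h
  rw [map_sum]
  refine Eq.trans (Finset.sum_congr rfl fun a _ => ?_) (h.trans ?_)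
  · rw [coeff_mul, ← Finset.Nat.sum_antidiagonal_swap]
    refine Finset.sum_congr rfl fun p _ => ?_
    rw [coeff_map, coeff_T]
    exact congrArg (fun y => antipodeLin n y * _) (antipodeLin_t _ _ _)
  · rw [Matrix.one_apply]
    split_ifs
    · rw [coeff_one]
      split_ifs
      · exact antipodeLin_one n
      · exact map_zero _
    · rw [map_zero, map_zero]

theorem shift_z_commute (hn : 0 < n) (a : ℂ) (f : (Yangian n)⟦X⟧) :
    shift a (z n) * f = f * shift a (z n) :=
  commute_of_coeff_mem_center
    (fun r => shift_mem (Subalgebra.toSubmodule (Subalgebra.center ℂ (Yangian n))) a (z_mem_center hn) r) f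

/-- Both sides are left inverses of the transpose of T⁻¹(u): the left one by
`sum_antipodeSq_T_mul_Tinv`, the right one by `sum_T_mul_Tinv_shift` with u replaced by u + n. -/
theorem map_antipodeSq_T (hn : 0 < n) (i j : Fin n) :
    PowerSeries.map (antipodeSq n).toRingHom (T n i j) =
      shift (n : ℂ) (z n) * shift (n : ℂ) (T n i j) := by
  have hN : IsUnit (Tinv n).transpose := by
    apply isUnit_of_constantCoeff
    rw [Matrix.transpose_map, Tinv_map_constantCoeff, Matrix.transpose_one]
  have h1 : (Matrix.of fun j i => PowerSeries.map (antipodeSq n).toRingHom (T n i j)) *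
      (Tinv n).transpose = 1 := by
    ext1 j i
    rw [Matrix.mul_apply, Matrix.one_apply]
    simp only [Matrix.of_apply, Matrix.transpose_apply]
    rw [sum_antipodeSq_T_mul_Tinv]
    simp only [eq_comm]
  have h2 : (Matrix.of fun j i => shift (n : ℂ) (z n) * shift (n : ℂ) (T n i j)) *
      (Tinv n).transpose = 1 := by
    ext1 j c
    rw [Matrix.mul_apply, Matrix.one_apply]
    simp only [Matrix.of_apply, Matrix.transpose_apply, mul_assoc]
    rw [← Finset.mul_sum]
    have h3 := congrArg (shift (n : ℂ)) (sum_T_mul_Tinv_shift hn j c)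
    simp only [shift_sum, shift_mul, shift_shift, add_neg_cancel, shift_zero] at h3
    rw [h3]
    split_ifs
    · rw [← shift_mul, z_mul_zInv hn, shift_one]
    · rw [shift_zero_series, mul_zero]
  have h3 := hN.mul_right_cancel (h1.trans h2.symm)
  exact congrFun (congrFun h3 j) i

theorem antipodeSq_gen_sub_mem (hn : 0 < n) (g : Fin n × Fin n × ℕ) :
    antipodeSq n (gen g) - gen g ∈ Flt n (wt g) := by
  obtain ⟨i, j, r⟩ := g
  have hT : T n i j ∈ SerFlt n 0 := SerFlt_mono (Nat.zero_le _) (T_mem_SerFlt i j)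
  have h1 : (z n - 1) * T n i j ∈ SerFlt n (2 + 0) := SerFlt_mul (z_sub_one_mem_SerFlt hn) hT
  have h2 := add_mem (SerFlt_shift (n : ℂ) h1) (SerFlt_shift_sub (n : ℂ) hT)
  have h3 := h2 (r + 1)
  have h4 : shift (n : ℂ) ((z n - 1) * T n i j) + (shift (n : ℂ) (T n i j) - T n i j) =
      PowerSeries.map (antipodeSq n).toRingHom (T n i j) - T n i j := by
    rw [map_antipodeSq_T hn, sub_mul, one_mul, shift_sub', shift_mul, sub_add_sub_cancel]
  rw [h4, map_sub, coeff_map, coeff_T] at h3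
  exact Flt_mono (by simp only [wt]; omega) h3

theorem algHom_sub_mem (φ : Yangian n →ₐ[ℂ] Yangian n)
    (h : ∀ g, φ (gen g) - gen g ∈ Flt n (wt g)) {w : ℕ} {x : Yangian n} (hx : x ∈ Flt n (w + 1)) :
    φ x - x ∈ Flt n w := by
  refine Flt_induction (p := fun x => φ x - x ∈ Flt n w) (by simp) ?_ ?_ (fun L hL => ?_) hx
  · intro x y hx hy
    rw [map_add, add_sub_add_comm]
    exact add_mem hx hy
  · intro c x hx
    rw [map_smul, ← smul_sub]
    exact Submodule.smul_mem _ _ hx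
  · refine Flt_mono (Nat.lt_succ_iff.1 hL) ?_
    clear hL hx
    induction L with
    | nil => simp
    | cons g L ih =>
      have h1 : φ (prodL L) ∈ Flt n (wtL L + 1) := by
        rw [← sub_add_cancel (φ (prodL L)) (prodL L)]
        exact add_mem (Flt_mono (Nat.le_succ _) ih) (prodL_mem (Nat.lt_succ_self _))
      have h2 := add_mem (mul_mem_right (h g) h1) (mul_mem_left (gen_mem g) ih)
      rw [prodL_cons, wtL_cons, map_mul]
      convert h2 using 1
      rw [sub_mul, mul_sub, sub_add_sub_cancel]

/-- By `algHom_sub_mem`, φ − 1 lowers the weight. The filtration is exhaustive and begins with 0, so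
a unipotent φ is injective and surjective by induction on weight. -/
theorem algHom_bijective (φ : Yangian n →ₐ[ℂ] Yangian n)
    (h : ∀ g, φ (gen g) - gen g ∈ Flt n (wt g)) : Function.Bijective φ := by
  constructor
  · rw [injective_iff_map_eq_zero]
    intro x hx
    obtain ⟨w, hw⟩ := exists_mem_Flt x
    induction w with
    | zero => rwa [Flt_zero, Submodule.mem_bot] at hw
    | succ w ih =>
      have h1 := algHom_sub_mem φ h hw
      rw [hx, zero_sub] at h1
      exact ih (by simpa using neg_mem h1)
  · intro x
    obtain ⟨w, hw⟩ := exists_mem_Flt x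
    induction w generalizing x with
    | zero =>
      rw [Flt_zero, Submodule.mem_bot] at hw
      exact ⟨0, by rw [hw, map_zero]⟩
    | succ w ih =>
      obtain ⟨y, hy⟩ := ih _ (algHom_sub_mem φ h hw)
      exact ⟨x - y, by rw [map_sub, hy, sub_sub_cancel]⟩

theorem list_prod_mul_of_central {ι B : Type*} [Monoid B] {c g : ι → B}
    (hc : ∀ a b, c a * b = b * c a) (l : List ι) :
    (l.map fun a => c a * g a).prod = (l.map c).prod * (l.map g).prod := by
  induction l with
  | nil => simp
  | cons a l ih =>
    have h : ∀ (l : List ι) b, (l.map c).prod * b = b * (l.map c).prod := by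
      intro l b
      induction l with
      | nil => simp
      | cons a l ih => rw [List.map_cons, List.prod_cons, mul_assoc, ih, ← mul_assoc, hc, mul_assoc]
    rw [List.map_cons, List.prod_cons, ih, List.map_cons, List.prod_cons, List.map_cons,
      List.prod_cons, mul_assoc, ← mul_assoc (g a), ← h l (g a)]
    simp only [mul_assoc]

theorem shift_qdet_mul_prod (hn : 0 < n) (b : ℂ) (m : ℕ) :
    shift b (qdet n) * ((List.range m).map fun a : ℕ => shift (b - (a : ℂ)) (z n)).prod =
      shift (b - (m : ℂ)) (qdet n) := by
  induction m with
  | zero => simp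
  | succ m ih =>
    rw [List.range_succ, List.map_append, List.prod_append, ← mul_assoc, ih, List.map_singleton,
      List.prod_singleton, ← shift_mul, ← shift_qdet hn, shift_shift]
    congr 1
    push_cast
    ring

/-- The central factors z(u + n − a), 0 ≤ a < n, come out of every product and leave qdet T(u + n).
By the Liouville formula their product telescopes to qdet T(u)/qdet T(u + n). -/
theorem map_antipodeSq_qdet (hn : 0 < n) :
    PowerSeries.map (antipodeSq n).toRingHom (qdet n) = qdet n := by
  set ζ := ((List.range n).map fun a : ℕ => shift ((n : ℂ) - (a : ℂ)) (z n)).prod with hζ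
  have h1 : ∀ σ : Equiv.Perm (Fin n), PowerSeries.map (antipodeSq n).toRingHom
      (tProd (n := n) σ id) = ζ * shift (n : ℂ) (tProd σ id) := by
    intro σ
    have h2 : ∀ a : Fin n, PowerSeries.map (antipodeSq n).toRingHom
        (shift (-((a : ℕ) : ℂ)) (T n (σ a) (id a))) =
        shift ((n : ℂ) - ((a : ℕ) : ℂ)) (z n) *
          shift (n : ℂ) (shift (-((a : ℕ) : ℂ)) (T n (σ a) (id a))) := by
      intro a
      refine (map_shift (antipodeSq n) _ _).trans ((congrArg _ (map_antipodeSq_T hn _ _)).trans ?_)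
      rw [shift_mul, shift_shift, shift_shift, shift_shift, neg_add_eq_sub, ← sub_eq_add_neg]
    rw [tProd, map_list_prod, ← shiftHom_apply, map_list_prod, List.map_map, List.map_map]
    have h3 : ζ = ((List.finRange n).map fun a : Fin n =>
        shift ((n : ℂ) - ((a : ℕ) : ℂ)) (z n)).prod := by
      rw [hζ, ← List.map_coe_finRange_eq_range, List.map_map]
      rfl
    rw [h3, ← list_prod_mul_of_central fun a b => shift_z_commute hn _ b]
    congr 1
    refine List.map_congr_left fun a _ => ?_
    rw [Function.comp_apply, Function.comp_apply, shiftHom_apply]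
    exact h2 a
  have h2 : PowerSeries.map (antipodeSq n).toRingHom (qdet n) = ζ * shift (n : ℂ) (qdet n) := by
    rw [qdet_eq_sum, map_sum, shift_sum, Finset.mul_sum]
    refine Finset.sum_congr rfl fun σ _ => ?_
    rw [map_zsmul, h1, ← shiftHom_apply, ← shiftHom_apply, map_zsmul, mul_smul_comm]
  have h3 : ∀ f, shift (n : ℂ) (qdet n) * f = f * shift (n : ℂ) (qdet n) :=
    commute_of_coeff_mem_center
      fun r => shift_mem (Subalgebra.toSubmodule (Subalgebra.center ℂ (Yangian n))) _ (qdet_mem_center hn) r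
  rw [h2, ← h3, hζ, shift_qdet_mul_prod hn, sub_self, shift_zero]

/-- The square of the antipode as an automorphism. -/
def antipodeSqEquiv (hn : 0 < n) : Yangian n ≃ₐ[ℂ] Yangian n :=
  AlgEquiv.ofBijective (antipodeSq n) (algHom_bijective _ (antipodeSq_gen_sub_mem hn))

end AntipodeSquare

end GLYangian

end

theorem mainTheorem5 (n : ℕ) (hn : 0 < n) :
    -- `qdet n` is the quantum determinant, a series that begins with `1`
    ((∀ d : PowerSeries (GLYangian.Yangian n),
        GLYangian.IsQuantumDeterminant n d ↔ d = GLYangian.qdet n) ∧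
      PowerSeries.constantCoeff (GLYangian.qdet n) = 1) ∧
    -- the quantum Liouville formula, for both orders of the factors of the quotient
    (GLYangian.z n =
        GLYangian.shift (-1) (GLYangian.qdet n) * Ring.inverse (GLYangian.qdet n) ∧
      GLYangian.z n =
        Ring.inverse (GLYangian.qdet n) * GLYangian.shift (-1) (GLYangian.qdet n)) ∧
    -- `z(u) = 1 + z₂ u⁻² + z₃ u⁻³ + ⋯`, and `z₂, z₃, …` freely generate the center
    (PowerSeries.coeff 0 (GLYangian.z n) = 1 ∧ PowerSeries.coeff 1 (GLYangian.z n) = 0 ∧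
      ∃ c : ℕ → Subalgebra.center ℂ (GLYangian.Yangian n),
        (∀ r, (c r : GLYangian.Yangian n) = PowerSeries.coeff (r + 2) (GLYangian.z n)) ∧
        AlgebraicIndependent ℂ c ∧ Algebra.adjoin ℂ (Set.range c) = ⊤) ∧
    -- the square of the antipode is the automorphism `T(u) ↦ z(u + n) T(u + n)`
    (∃ φ : GLYangian.Yangian n ≃ₐ[ℂ] GLYangian.Yangian n,
      (∀ x, φ x = HopfAlgebra.antipode ℂ (HopfAlgebra.antipode ℂ x)) ∧
      (∀ i j, PowerSeries.map (φ : GLYangian.Yangian n →+* GLYangian.Yangian n)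
          (GLYangian.T n i j) =
        GLYangian.shift (n : ℂ) (GLYangian.z n) * GLYangian.shift (n : ℂ) (GLYangian.T n i j)) ∧
      PowerSeries.map (φ : GLYangian.Yangian n →+* GLYangian.Yangian n) (GLYangian.qdet n) =
        GLYangian.qdet n) := by
  refine ⟨⟨fun d => ⟨GLYangian.IsQuantumDeterminant.eq_qdet, ?_⟩, GLYangian.constantCoeff_qdet n⟩,
    ⟨GLYangian.z_eq_mul_inverse hn, GLYangian.z_eq_inverse_mul hn⟩,
    ⟨?_, GLYangian.coeff_one_z hn, GLYangian.zCentral hn, fun r => rfl,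
      GLYangian.algebraicIndependent_zCentral hn, GLYangian.adjoin_zCentral hn⟩,
    GLYangian.antipodeSqEquiv hn, fun x => rfl, fun i j => ?_, ?_⟩
  · rintro rfl
    exact GLYangian.isQuantumDeterminant_qdet n
  · rw [PowerSeries.coeff_zero_eq_constantCoeff_apply, GLYangian.constantCoeff_z hn]
  · exact GLYangian.map_antipodeSq_T hn i j
  · exact GLYangian.map_antipodeSq_qdet hn
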